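/- **Theorem 2.1.** Let $\gamma\in\mathbb{R}$, $\psi_\gamma(x)=\dfrac{e^{-\gamma|x|}}{2\pi|x|}$ for $x\in\mathbb{R}^3\setminus\{0\}$, and $m_\gamma(dx)=\psi_\gamma(x)^2\,dx$ on $\mathbb{R}^3$. With $\nabla$ the weak gradient on $\mathbb{R}^3$ and all functions real-valued, set $$\mathcal{F}^3=\{f\in L^2(\mathbb{R}^3,m_\gamma):\ \nabla f\in L^2(\mathbb{R}^3,m_\gamma)\},\qquad \mathcal{E}^3(f,g)=\frac12\int_{\mathbb{R}^3}\nabla f\cdot\nabla g\,dm_\gamma\quad(f,g\in\mathcal{F}^3).$$ 1. $(\mathcal{E}^3,\mathcal{F}^3)$ is a regular and irreducible Dirichlet form on $L^2(\mathbb{R}^3,m_\gamma)$, and $C_c^\infty(\mathbb{R}^3)$ is a special standard core of it. 2. If $\gamma\ge 0$, then $(\mathcal{E}^3,\mathcal{F}^3)$ is recurrent. If $\gamma<0$, then it is transient. Here the terms have their usual meaning for a form $(\mathcal{E},\mathcal{F})$ on $L^2(X,m)$. Write $(\cdot,\cdot)$ for the inner product of $L^2(X,m)$ and $\mathcal{E}_1(u,v)=\mathcal{E}(u,v)+(u,v)$.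 * *Dirichlet form*: a densely defined, nonnegative definite, symmetric bilinear form such that $\mathcal{F}$ is complete under $\mathcal{E}_1$ and, for $u\in\mathcal{F}$, $v=(0\vee u)\wedge1$ satisfies $v\in\mathcal{F}$ and $\mathcal{E}(v,v)\le\mathcal{E}(u,u)$. * *Core*: a set $\mathcal{C}\subset\mathcal{F}\cap C_c(X)$ that is $\mathcal{E}_1$-dense in $\mathcal{F}$ and uniformly dense in $C_c(X)$. *Regular*: $m$ is a Radon measure with full support and a core exists. * *Special standard core*: a core $\mathcal{C}$ that is a subalgebra of $C_c(X)$, such that (a) for every $\varepsilon>0$ there is $\varphi_\varepsilon:\mathbb{R}\to\mathbb{R}$ with $\varphi_\varepsilon(t)=t$ on $[0,1]$, $-\varepsilon\le\varphi_\varepsilon\le1+\varepsilon$, $0\le\varphi_\varepsilon(t)-\varphi_\varepsilon(s)\le t-s$ for $s<t$, and $\varphi_\varepsilon(u)\in\mathcal{C}$ for all $u\in\mathcal{C}$; and (b) for every compact $K$ and relatively compact open $G\supset K$ there is a nonnegative $u\in\mathcal{C}$ with $u=1$ on $K$ and $u=0$ on $X\setminus G$. * *Resolvent*: for $\alpha>0$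 and $f\in L^2(X,m)$, $G_\alpha f\in\mathcal{F}$ is determined by $\mathcal{E}(G_\alpha f,v)+\alpha(G_\alpha f,v)=(f,v)$ for all $v\in\mathcal{F}$. * *Irreducible*: if $A$ is measurable and invariant, that is, $G_\alpha(1_Af)=1_A\,G_\alpha f$ $m$-a.e. for all $\alpha>0$ and $f\in L^2(X,m)$, then $m(A)=0$ or $m(X\setminus A)=0$. * *Recurrent / transient*: for $0\le f\in L^1(X,m)$ let $Gf=\lim_{\alpha\downarrow0}G_\alpha f$, where $G_\alpha f=\lim_{k\to\infty}G_\alpha(f\wedge k)$ (increasing limits). The form is recurrent if $Gf\in\{0,\infty\}$ $m$-a.e. for every such $f$, and transient if $Gf<\infty$ $m$-a.e. for every such $f$. -/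

import Mathlib

open MeasureTheory Filter Topology Set
open scoped ContDiff

/-! ### Symmetric forms on `L²` and Dirichlet forms -/

/-- The raw data `(𝓔, 𝓕)` of a form on the real Hilbert space `L²(X, μ)`: a domain `𝓕` and the values
of `𝓔` (only the values on `𝓕 × 𝓕` matter). All laws are part of `L2Form.IsDirichletForm`. -/
structure L2Form {X : Type*} [MeasurableSpace X] (μ : Measure X) where
  /-- the domain `𝓕` -/
  domain : Set (Lp ℝ 2 μ)
  /-- the form `𝓔` -/
  form : Lp ℝ 2 μ → Lp ℝ 2 μ → ℝ

namespace L2Form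

section Measurable

variable {X : Type*} [MeasurableSpace X] {μ : Measure X} (Q : L2Form μ)

/-- `𝓔₁(u, v) = 𝓔(u, v) + (u, v)_{L²(μ)}`. -/
noncomputable def formOne (u v : Lp ℝ 2 μ) : ℝ :=
  Q.form u v + inner ℝ u v

/-- `(𝓔, 𝓕)` is a (symmetric) Dirichlet form on `L²(X, μ)`: a densely defined, nonnegative definite,
symmetric bilinear form which is closed and on which the unit contraction operates. -/
structure IsDirichletForm : Prop where
  zero_mem : (0 : Lp ℝ 2 μ) ∈ Q.domain
  add_mem : ∀ u ∈ Q.domain, ∀ v ∈ Q.domain, u + v ∈ Q.domain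
  smul_mem : ∀ (c : ℝ), ∀ u ∈ Q.domain, c • u ∈ Q.domain
  dense : Dense Q.domain
  symm : ∀ u ∈ Q.domain, ∀ v ∈ Q.domain, Q.form u v = Q.form v u
  add_left : ∀ u ∈ Q.domain, ∀ v ∈ Q.domain, ∀ w ∈ Q.domain,
    Q.form (u + v) w = Q.form u w + Q.form v w
  smul_left : ∀ (c : ℝ), ∀ u ∈ Q.domain, ∀ v ∈ Q.domain, Q.form (c • u) v = c * Q.form u v
  nonneg : ∀ u ∈ Q.domain, 0 ≤ Q.form u u
  /-- closedness: `𝓕` is complete with respect to `𝓔₁` -/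
  complete : ∀ u : ℕ → Lp ℝ 2 μ, (∀ n, u n ∈ Q.domain) →
    (∀ ε > 0, ∃ N, ∀ k ≥ N, ∀ l ≥ N, Q.formOne (u k - u l) (u k - u l) < ε) →
    ∃ v ∈ Q.domain, Tendsto (fun n => Q.formOne (u n - v) (u n - v)) atTop (𝓝 0)
  /-- Markov property: `v = (0 ∨ u) ∧ 1` is in `𝓕` and `𝓔(v, v) ≤ 𝓔(u, u)` -/
  markov : ∀ u ∈ Q.domain, ∀ v : Lp ℝ 2 μ, (v =ᵐ[μ] fun x => min (max 0 (u x)) 1) →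
    v ∈ Q.domain ∧ Q.form v v ≤ Q.form u u

/-- `u = G_α f` for the resolvent `(G_α)` of `(𝓔, 𝓕)`: the element `u` of `𝓕` that satisfies
`𝓔(u, v) + α (u, v) = (f, v)` for all `v ∈ 𝓕`. -/
def IsResolventOf (α : ℝ) (f : X → ℝ) (u : Lp ℝ 2 μ) : Prop :=
  u ∈ Q.domain ∧ ∀ v ∈ Q.domain, Q.form u v + α * inner ℝ u v = ∫ x, f x * v x ∂μ

open Classical in
/-- The resolvent `G_α f` (`α > 0`, `f ∈ L²(X, μ)`) of the form `(𝓔, 𝓕)`. For a Dirichlet form it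
exists and is unique by the Riesz representation theorem. -/
noncomputable def resolvent (α : ℝ) (f : X → ℝ) : Lp ℝ 2 μ :=
  if h : ∃ u, Q.IsResolventOf α f u then h.choose else 0

/-- `A` is invariant: multiplication by `1_A` commutes with the resolvent (equivalently, with the
associated semigroup, of which the resolvent is the Laplace transform). -/
def IsInvariant (A : Set X) : Prop :=
  ∀ α : ℝ, 0 < α → ∀ f : X → ℝ, MemLp f 2 μ →
    (Q.resolvent α (A.indicator f) : X → ℝ) =ᵐ[μ] A.indicator (Q.resolvent α f : X → ℝ)

/-- Irreducibility: every invariant set is null or conull. -/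
def IsIrreducible : Prop :=
  ∀ A : Set X, MeasurableSet A → Q.IsInvariant A → μ A = 0 ∨ μ Aᶜ = 0

/-- The potential operator `G f = lim_{α ↓ 0} G_α f` (which is `∫₀^∞ T_t f dt`) on nonnegative
`f ∈ L¹(X, μ)`. Here `G_α f` is the increasing limit of `G_α (f ∧ k)` as `k → ∞`, with `f ∧ k ∈ L²`,
and `G_α f` increases as `α` decreases to `0`. Defined up to null sets. -/
noncomputable def potential (f : X → ℝ) (x : X) : ENNReal :=
  ⨆ n : ℕ, ⨆ k : ℕ,
    ENNReal.ofReal (Q.resolvent (1 / ((n : ℝ) + 1)) (fun y => min (f y) (k : ℝ)) x)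

/-- Recurrence: `G f ∈ {0, ∞}` a.e. for every nonnegative `f ∈ L¹(X, μ)`. -/
def IsRecurrent : Prop :=
  ∀ f : X → ℝ, Integrable f μ → 0 ≤ᵐ[μ] f → ∀ᵐ x ∂μ, Q.potential f x = 0 ∨ Q.potential f x = ⊤

/-- Transience: `G f < ∞` a.e. for every nonnegative `f ∈ L¹(X, μ)`. -/
def IsTransient : Prop :=
  ∀ f : X → ℝ, Integrable f μ → 0 ≤ᵐ[μ] f → ∀ᵐ x ∂μ, Q.potential f x < ⊤

end Measurable

section Topological

variable {X : Type*} [TopologicalSpace X] [MeasurableSpace X] {μ : Measure X} (Q : L2Form μ)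

/-- `C` is a core of `(𝓔, 𝓕)`: a subset of `𝓕 ∩ C_c(X)` which is uniformly dense in `C_c(X)` and
`𝓔₁`-dense in `𝓕`. -/
structure IsCore (C : Set (X → ℝ)) : Prop where
  continuous : ∀ φ ∈ C, Continuous φ
  hasCompactSupport : ∀ φ ∈ C, HasCompactSupport φ
  mem_domain : ∀ φ ∈ C, ∃ u ∈ Q.domain, u =ᵐ[μ] φ
  dense_uniform : ∀ f : X → ℝ, Continuous f → HasCompactSupport f →
    ∀ ε > 0, ∃ φ ∈ C, ∀ x, |f x - φ x| < ε
  dense_form : ∀ u ∈ Q.domain, ∀ ε > 0, ∃ φ ∈ C, ∃ v ∈ Q.domain, v =ᵐ[μ] φ ∧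
    Q.formOne (u - v) (u - v) < ε

/-- Regularity: the reference measure is finite on compacts with full support, and `(𝓔, 𝓕)` has a
core. -/
structure IsRegular : Prop where
  finite_on_compacts : IsFiniteMeasureOnCompacts μ
  full_support : μ.IsOpenPosMeasure
  exists_core : ∃ C : Set (X → ℝ), Q.IsCore C

/-- Special standard core: a core `C` which is a subalgebra of `C_c(X)`, stable under some approximate
unit contraction `φ_ε` for each `ε > 0`, and which contains cut-off functions for every compact set
inside a relatively compact open set. -/
structure IsSpecialStandardCore (C : Set (X → ℝ)) : Prop where
  isCore : Q.IsCore C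
  add_mem : ∀ φ ∈ C, ∀ χ ∈ C, φ + χ ∈ C
  smul_mem : ∀ (c : ℝ), ∀ φ ∈ C, c • φ ∈ C
  mul_mem : ∀ φ ∈ C, ∀ χ ∈ C, φ * χ ∈ C
  contraction : ∀ ε > 0, ∃ T : ℝ → ℝ, (∀ t ∈ Icc (0 : ℝ) 1, T t = t) ∧
    (∀ t, -ε ≤ T t ∧ T t ≤ 1 + ε) ∧ (∀ s t, s < t → 0 ≤ T t - T s ∧ T t - T s ≤ t - s) ∧
    ∀ φ ∈ C, T ∘ φ ∈ C
  cutoff : ∀ K G : Set X, IsCompact K → IsOpen G → IsCompact (closure G) → K ⊆ G →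
    ∃ φ ∈ C, (∀ x, 0 ≤ φ x) ∧ (∀ x ∈ K, φ x = 1) ∧ ∀ x, x ∉ G → φ x = 0

end Topological

end L2Form

/-! ### The distorted Brownian motion form on `ℝ³` -/

/-- Euclidean three-space. -/
abbrev E3 : Type := EuclideanSpace ℝ (Fin 3)

/-- `C_c^∞(ℝ³)`. -/
def smoothCompactlySupported : Set (E3 → ℝ) :=
  {φ | ContDiff ℝ ∞ φ ∧ HasCompactSupport φ}

/-- `G` is the weak gradient of `f` on `ℝ³`:
`∫ f ∂_v φ dx = - ∫ φ ⟨G, v⟩ dx` for all `φ ∈ C_c^∞(ℝ³)` and all directions `v`. -/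
structure HasWeakGradient (f : E3 → ℝ) (G : E3 → E3) : Prop where
  locallyIntegrable : LocallyIntegrable f volume
  locallyIntegrable_grad : LocallyIntegrable G volume
  integral_eq : ∀ φ ∈ smoothCompactlySupported, ∀ v : E3,
    ∫ x, f x * fderiv ℝ φ x v = - ∫ x, φ x * inner ℝ (G x) v

/-- The weak gradient is unique up to Lebesgue null sets. -/
theorem HasWeakGradient.ae_eq {f : E3 → ℝ} {G H : E3 → E3} (hG : HasWeakGradient f G)
    (hH : HasWeakGradient f H) : G =ᵐ[volume] H := by
  refine ae_eq_of_integral_contDiff_smul_eq hG.locallyIntegrable_grad hH.locallyIntegrable_grad ?_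
  intro φ hφ hc
  have key : ∀ K : E3 → E3, LocallyIntegrable K volume → ∀ v : E3,
      inner ℝ (∫ x, φ x • K x) v = ∫ x, φ x * inner ℝ (K x) v := by
    intro K hK v
    have hi : Integrable (fun x => φ x • K x) volume :=
      hK.integrable_smul_left_of_hasCompactSupport hφ.continuous hc
    rw [real_inner_comm, ← integral_inner hi v]
    simp only [inner_smul_right, real_inner_comm]
  refine ext_inner_right ℝ fun v => ?_
  rw [key G hG.locallyIntegrable_grad v, key H hH.locallyIntegrable_grad v]
  have h1 := hG.integral_eq φ ⟨hφ, hc⟩ v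
  have h2 := hH.integral_eq φ ⟨hφ, hc⟩ v
  linarith

open Classical in
/-- The weak gradient `∇f` (`0` if there is none); unique up to null sets. -/
noncomputable def weakGradient (f : E3 → ℝ) : E3 → E3 :=
  if h : ∃ G, HasWeakGradient f G then h.choose else 0

/-- `ψ_γ(x) = e^{-γ|x|} / (2π|x|)`; the value at the single point `0` is irrelevant. -/
noncomputable def psi (γ : ℝ) (x : E3) : ℝ :=
  Real.exp (-γ * ‖x‖) / (2 * Real.pi * ‖x‖)

/-- `m_γ(dx) = ψ_γ(x)² dx`. -/
noncomputable def mMeasure (γ : ℝ) : Measure E3 :=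
  volume.withDensity fun x => ENNReal.ofReal (psi γ x ^ 2)

/-- The form `(𝓔³, 𝓕³)` on `L²(ℝ³, m_γ)`: `𝓕³` consists of the `f ∈ L²(m_γ)` whose weak gradient
belongs to `L²(m_γ)`, and `𝓔³(f, g) = ½ ∫ ∇f · ∇g dm_γ`. -/
noncomputable def distortedForm (γ : ℝ) : L2Form (mMeasure γ) where
  domain := {f | ∃ G : E3 → E3, HasWeakGradient f G ∧ MemLp G 2 (mMeasure γ)}
  form f g := (1 / 2) * ∫ x, inner ℝ (weakGradient f x) (weakGradient g x) ∂(mMeasure γ)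

/-! The density is `exp (-2γ|x|) / (4π²|x|²)`. In polar coordinates the factor `|x|⁻²` cancels the
surface area of spheres, so radially the measure is a multiple of `exp (-2γr) dr`. This gives the
dichotomy between `γ ≥ 0` and `γ < 0`. The singularity at the origin is harmless for the function
theory, for two reasons. On each ball the density is bounded below by a positive constant, so
convergence in `L²(m_γ)` implies local `L¹` convergence and weak gradients pass to limits. Moreover
`|x|⁻²` is an `A₁` weight, so mollification is uniformly bounded on `L²(m_γ)`.

Cutting off and then mollifying therefore makes `C_c^∞` dense in the domain
(`HasWeakGradient.exists_smooth_approx`). The chain rule and the truncation rule follow by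
approximation, and with them the Markov property and the core properties.

Irreducibility: if `A` is invariant, multiplication by `1_A` maps the domain to itself
(`indicator_mem_domain`). Applied to cut-offs, this puts `1_A` locally in the domain. Composition
with a smooth function that fixes 0 and 1 and is stationary there leaves `1_A` unchanged but kills
its gradient, so `1_A` is constant.

Recurrence: for `γ ≥ 0` balls have at most linear volume growth, hence cut-offs at scale `n` have
energy of order `1/n`. Let `u` be the resolvent of a bounded `g ≥ 0` at `α` and let `F` be the
positive decreasing function `decay`. Testing the resolvent equation with `χ² F(u)` (`caccioppoli`)
bounds `∫ g χ² F(u)` and the local energy of `F(u)` by `∫ |∇χ|² + α ∫ χ²`. As `α ↓ 0`, `F(u)`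
decreases to a function with zero gradient, thus to a constant `c`. Letting `χ` increase to 1 gives
`c ∫ g ≤ 0`. So `c = 0`, which means that `u` tends to infinity almost everywhere.

Transience: for `γ = -a < 0` there is a spectral gap `a² ∫ f² ≤ ∫ |∇f|²`, obtained from the
divergence theorem for the field `exp (2a|x|) x / |x|³`, whose divergence is `2a` times the
unnormalised density. Testing the resolvent equation with `u ∧ N` and applying the gap to this
truncation shows that `m(u ≥ N)` is at most a constant times `1/N`, uniformly in `α` and in the
truncation of the data. Hence the potential is finite almost everywhere. -/

/-! ### The weight and the measure `m_γ`. -/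

theorem psi_sq (γ : ℝ) (x : E3) :
    psi γ x ^ 2 = Real.exp (-(2 * γ * ‖x‖)) * (4 * Real.pi ^ 2)⁻¹ * (‖x‖ ^ 2)⁻¹ := by
  rw [psi, div_pow, ← Real.exp_nat_mul, mul_pow, mul_pow, div_eq_mul_inv, mul_inv, ← mul_assoc]
  congr 3
  · push_cast; ring_nf
  · norm_num

theorem measurable_psi (γ : ℝ) : Measurable (psi γ) := by
  unfold psi; fun_prop

theorem measurable_psi_sq (γ : ℝ) : Measurable fun x => ENNReal.ofReal (psi γ x ^ 2) :=
  ((measurable_psi γ).pow_const 2).ennreal_ofReal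

theorem finrank_E3 : Module.finrank ℝ E3 = 3 := by simp [E3]

theorem volume_real_closedBall_E3 (x : E3) {r : ℝ} (hr : 0 ≤ r) :
    volume.real (Metric.closedBall x r) = r ^ 3 * volume.real (Metric.ball (0 : E3) 1) := by
  have h := Measure.addHaar_real_closedBall (volume : Measure E3) x hr
  rwa [finrank_E3] at h

theorem integrableOn_inv_norm_sq (R : ℝ) :
    IntegrableOn (fun x : E3 => (‖x‖ ^ 2)⁻¹) (Metric.ball 0 R) volume := by
  rw [integrableOn_fun_norm_addHaar (μ := (volume : Measure E3)) (f := fun y : ℝ => (y ^ 2)⁻¹),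
    finrank_E3]
  have : IntegrableOn (fun _ : ℝ => (1 : ℝ)) (Ioo 0 R) volume := by simp
  refine this.congr_fun (fun y hy => ?_) measurableSet_Ioo
  have : y ≠ 0 := hy.1.ne'
  simp [this]

/-- The Jacobian `r²` cancels the weight, which leaves the area of the unit sphere (three times the
volume of the unit ball) times the length of the radial interval. Growth linear in `R` is what makes
`γ ≥ 0` recurrent. -/
theorem setIntegral_inv_norm_sq {R : ℝ} (hR : 0 ≤ R) :
    ∫ x in Metric.ball (0 : E3) R, (‖x‖ ^ 2)⁻¹ = 3 * volume.real (Metric.ball (0 : E3) 1) * R := by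
  have h := integral_fun_norm_addHaar (volume : Measure E3)
    (fun y : ℝ => (Iio R).indicator (fun y => (y ^ 2)⁻¹) y)
  rw [finrank_E3] at h
  rw [← integral_indicator measurableSet_ball]
  have e1 : ∀ x : E3, (Metric.ball (0 : E3) R).indicator (fun x => (‖x‖ ^ 2)⁻¹) x
      = (Iio R).indicator (fun y => (y ^ 2)⁻¹) ‖x‖ := by
    intro x; simp [indicator]
  simp_rw [e1]
  rw [h]
  have e2 : ∫ y in Ioi (0 : ℝ), y ^ (3 - 1) • (Iio R).indicator (fun y => (y ^ 2)⁻¹) y = R := by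
    have : ∫ y in Ioi (0 : ℝ), y ^ (3 - 1) • (Iio R).indicator (fun y => (y ^ 2)⁻¹) y
        = ∫ y in Ioi (0 : ℝ), (Iio R).indicator (fun _ => (1 : ℝ)) y := by
      refine setIntegral_congr_fun measurableSet_Ioi fun y hy => ?_
      have : y ≠ 0 := (mem_Ioi.1 hy).ne'
      by_cases hyR : y < R <;> simp [indicator, hyR, this]
    rw [this, setIntegral_indicator measurableSet_Iio, Ioi_inter_Iio]
    simp [hR]
  rw [e2]
  simp; ring

theorem setLIntegral_inv_norm_sq {R : ℝ} (hR : 0 ≤ R) :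
    ∫⁻ x in Metric.ball (0 : E3) R, ENNReal.ofReal ((‖x‖ ^ 2)⁻¹)
      = ENNReal.ofReal (3 * volume.real (Metric.ball (0 : E3) 1) * R) := by
  rw [← setIntegral_inv_norm_sq hR, ofReal_integral_eq_lintegral_ofReal
    (integrableOn_inv_norm_sq R) (Eventually.of_forall fun x => by positivity)]

/-- `|x|⁻²` is an `A₁` weight on `ℝ³`. -/
theorem setLIntegral_closedBall_inv_norm_sq_le {x : E3} (hx : x ≠ 0) {ε : ℝ} (hε : 0 < ε) :
    ∫⁻ y in Metric.closedBall x ε, ENNReal.ofReal ((‖y‖ ^ 2)⁻¹)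
      ≤ ENNReal.ofReal (48 * volume.real (Metric.closedBall (0 : E3) ε) * (‖x‖ ^ 2)⁻¹) := by
  have hx' : 0 < ‖x‖ := norm_pos_iff.2 hx
  rw [volume_real_closedBall_E3 _ hε.le]
  set c := volume.real (Metric.ball (0 : E3) 1)
  have hc : 0 ≤ c := measureReal_nonneg
  -- Far from the origin the weight varies by a factor of at most 4 on the ball. Near the origin the
  -- ball lies inside `ball 0 (4ε)`, whose integral is `12 c ε`; since `‖x‖² ≤ 4ε²` this is at most
  -- `48 c ε³ / ‖x‖²`, which is the source of the constant.
  rcases le_or_gt (2 * ε) ‖x‖ with h | h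
  · have h1 : ∫⁻ y in Metric.closedBall x ε, ENNReal.ofReal ((‖y‖ ^ 2)⁻¹)
        ≤ ∫⁻ y in Metric.closedBall x ε, ENNReal.ofReal (4 * (‖x‖ ^ 2)⁻¹) := by
      refine setLIntegral_mono measurable_const fun y hy => ENNReal.ofReal_le_ofReal ?_
      have : ‖x‖ / 2 ≤ ‖y‖ := by
        have h2 : ‖x - y‖ ≤ ε := by rwa [Metric.mem_closedBall, dist_comm, dist_eq_norm] at hy
        have := norm_sub_norm_le x y
        linarith
      have h3 : (‖x‖ / 2) ^ 2 ≤ ‖y‖ ^ 2 := by gcongr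
      calc (‖y‖ ^ 2)⁻¹ ≤ ((‖x‖ / 2) ^ 2)⁻¹ := inv_anti₀ (by positivity) h3
        _ = 4 * (‖x‖ ^ 2)⁻¹ := by field_simp; norm_num
    refine h1.trans ?_
    rw [setLIntegral_const, ← ofReal_measureReal measure_closedBall_lt_top.ne, ← ENNReal.ofReal_mul (by positivity),
      volume_real_closedBall_E3 _ hε.le]
    refine ENNReal.ofReal_le_ofReal ?_
    have : 0 ≤ (‖x‖ ^ 2)⁻¹ * (ε ^ 3 * c) := by positivity
    nlinarith
  · have h1 : Metric.closedBall x ε ⊆ Metric.ball 0 (4 * ε) := by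
      intro y hy
      rw [Metric.mem_closedBall, dist_eq_norm] at hy
      have := norm_sub_norm_le y x
      simp only [Metric.mem_ball, dist_zero_right]
      linarith
    refine (lintegral_mono_set h1).trans ?_
    rw [setLIntegral_inv_norm_sq (by positivity)]
    refine ENNReal.ofReal_le_ofReal ?_
    have h2 : 1 ≤ 4 * ε ^ 2 * (‖x‖ ^ 2)⁻¹ := by
      rw [← div_eq_mul_inv, le_div_iff₀ (by positivity)]
      nlinarith
    have : 0 ≤ 12 * c * ε := by positivity
    calc 3 * c * (4 * ε) = (12 * c * ε) * 1 := by ring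
      _ ≤ (12 * c * ε) * (4 * ε ^ 2 * (‖x‖ ^ 2)⁻¹) := by gcongr
      _ = _ := by ring

/-- Averages of `ψ_γ²` over small balls are controlled by `ψ_γ²` at the centre. -/
theorem lintegral_bump_mul_psi_sq_le (γ : ℝ) (ρ : ContDiffBump (0 : E3))
    (hρ : ρ.rOut ≤ 2 * ρ.rIn) (hρ1 : ρ.rOut ≤ 1) {x : E3} (hx : x ≠ 0) :
    ∫⁻ y, ENNReal.ofReal (ρ.normed volume (y - x)) * ENNReal.ofReal (psi γ y ^ 2)
      ≤ ENNReal.ofReal (384 * Real.exp (2 * |γ|)) * ENNReal.ofReal (psi γ x ^ 2) := by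
  have hr := ρ.rOut_pos
  set r := ρ.rOut with hrdef
  set v := volume.real (Metric.closedBall (0 : E3) r) with hv
  have hvpos : 0 < v := ENNReal.toReal_pos (Metric.measure_closedBall_pos _ _ hr).ne'
    measure_closedBall_lt_top.ne
  -- Over a distance at most 1 the exponential factor changes by at most `exp (2|γ|)`. The kernel is
  -- at most `2³` over the volume of its ball, since the outer radius is at most twice the inner
  -- one. The final constant is `384 = 8 · 48`.
  set a := Real.exp (2 * |γ|) * Real.exp (-(2 * γ * ‖x‖)) * (4 * Real.pi ^ 2)⁻¹ with ha
  have key : ∀ y, ENNReal.ofReal (ρ.normed volume (y - x)) * ENNReal.ofReal (psi γ y ^ 2)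
      ≤ (Metric.closedBall x r).indicator
        (fun y => ENNReal.ofReal (8 / v * a) * ENNReal.ofReal ((‖y‖ ^ 2)⁻¹)) y := by
    intro y
    by_cases hy : y ∈ Metric.closedBall x r
    · rw [indicator_of_mem hy, ← ENNReal.ofReal_mul (ρ.nonneg_normed _),
        ← ENNReal.ofReal_mul (by positivity)]
      refine ENNReal.ofReal_le_ofReal ?_
      have h1 : ρ.normed volume (y - x) ≤ 8 / v := by
        have := ρ.normed_le_div_measure_closedBall_rOut volume 2 hρ (y - x)
        rw [finrank_E3] at this
        norm_num at this
        exact this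
      have h2 : psi γ y ^ 2 ≤ a * (‖y‖ ^ 2)⁻¹ := by
        rw [psi_sq, ha]
        gcongr
        rw [← Real.exp_add]
        gcongr
        have h3 : |‖x‖ - ‖y‖| ≤ 1 := by
          refine (abs_norm_sub_norm_le x y).trans ?_
          rw [← dist_eq_norm, dist_comm]
          exact hy.trans hρ1
        have h4 : γ * (‖x‖ - ‖y‖) ≤ |γ| * 1 := by
          refine (le_abs_self _).trans ?_
          rw [abs_mul]; gcongr
        linarith
      calc ρ.normed volume (y - x) * psi γ y ^ 2 ≤ (8 / v) * (a * (‖y‖ ^ 2)⁻¹) := by gcongr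
        _ = _ := by ring
    · rw [indicator_of_notMem hy]
      have : ρ.normed volume (y - x) = 0 := by
        rw [← Function.notMem_support, ρ.support_normed_eq]
        intro h
        apply hy
        rw [Metric.mem_ball, dist_zero_right] at h
        rw [Metric.mem_closedBall, dist_eq_norm]
        exact h.le
      simp [this]
  refine (lintegral_mono key).trans ?_
  rw [lintegral_indicator Metric.isClosed_closedBall.measurableSet, lintegral_const_mul _ (by fun_prop)]
  refine (mul_le_mul_right (setLIntegral_closedBall_inv_norm_sq_le hx hr) _).trans ?_
  rw [← ENNReal.ofReal_mul (by positivity), ← ENNReal.ofReal_mul (by positivity), psi_sq]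
  refine ENNReal.ofReal_le_ofReal (le_of_eq ?_)
  rw [ha, ← hv]
  field_simp
  norm_num

theorem psi_pos (γ : ℝ) {x : E3} (hx : x ≠ 0) : 0 < psi γ x := by
  have := norm_pos_iff.2 hx
  unfold psi; positivity

theorem ae_ne_zero_E3 : ∀ᵐ x : E3, x ≠ 0 := by
  simp [ae_iff]

theorem mMeasure_absolutelyContinuous (γ : ℝ) : mMeasure γ ≪ volume :=
  withDensity_absolutelyContinuous _ _

theorem volume_absolutelyContinuous_mMeasure (γ : ℝ) : (volume : Measure E3) ≪ mMeasure γ := by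
  refine withDensity_absolutelyContinuous' (measurable_psi_sq γ).aemeasurable ?_
  filter_upwards [ae_ne_zero_E3] with x hx
  have := psi_pos γ hx
  simp only [ne_eq, ENNReal.ofReal_eq_zero, not_le]
  positivity

theorem mMeasure_ball_lt_top (γ R : ℝ) : mMeasure γ (Metric.ball 0 R) < ⊤ := by
  rw [mMeasure, withDensity_apply _ measurableSet_ball]
  have key : ∫⁻ y in Metric.ball (0 : E3) R, ENNReal.ofReal (psi γ y ^ 2)
      ≤ ∫⁻ y in Metric.ball (0 : E3) R,
        ENNReal.ofReal (Real.exp (2 * |γ| * R) * (4 * Real.pi ^ 2)⁻¹) * ENNReal.ofReal ((‖y‖ ^ 2)⁻¹) := by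
    refine setLIntegral_mono (by fun_prop) fun y hy => ?_
    rw [← ENNReal.ofReal_mul (by positivity), psi_sq]
    gcongr
    rw [Metric.mem_ball, dist_zero_right] at hy
    have h1 : -γ * ‖y‖ ≤ |γ| * ‖y‖ := by gcongr; exact neg_le_abs γ
    have h2 : |γ| * ‖y‖ ≤ |γ| * R := by gcongr
    linarith
  refine key.trans_lt ?_
  rcases le_or_gt 0 R with hR | hR
  · rw [lintegral_const_mul _ (by fun_prop), setLIntegral_inv_norm_sq hR]
    finiteness
  · simp [Metric.ball_eq_empty.2 hR.le]

instance (γ : ℝ) : IsFiniteMeasureOnCompacts (mMeasure γ) where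
  lt_top_of_isCompact K hK := by
    obtain ⟨R, hR⟩ := hK.isBounded.subset_ball 0
    exact (measure_mono hR).trans_lt (mMeasure_ball_lt_top γ R)

instance (γ : ℝ) : (mMeasure γ).IsOpenPosMeasure :=
  (volume_absolutelyContinuous_mMeasure γ).isOpenPosMeasure

/-- `ψ_γ²` is locally bounded below. -/
theorem exists_volume_restrict_le (γ R : ℝ) :
    ∃ c : NNReal, (volume : Measure E3).restrict (Metric.ball 0 R) ≤
      c • (mMeasure γ).restrict (Metric.ball 0 R) := by
  -- The reciprocal of a lower bound for the density on the ball, where `|x| < R`.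
  set c : ℝ := Real.exp (2 * |γ| * R) * (4 * Real.pi ^ 2) * R ^ 2 with hc
  refine ⟨c.toNNReal, ?_⟩
  rw [mMeasure, restrict_withDensity measurableSet_ball, ENNReal.smul_def,
    ← withDensity_smul _ (measurable_psi_sq γ)]
  conv_lhs => rw [← withDensity_one (μ := (volume : Measure E3).restrict (Metric.ball 0 R))]
  refine withDensity_mono ?_
  rw [EventuallyLE, ae_restrict_iff' measurableSet_ball]
  filter_upwards [ae_ne_zero_E3] with x hx hxR
  rw [Metric.mem_ball, dist_zero_right] at hxR
  have hx' : 0 < ‖x‖ := norm_pos_iff.2 hx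
  have hR : 0 < R := hx'.trans hxR
  change (1 : ENNReal) ≤ ENNReal.ofReal c * ENNReal.ofReal (psi γ x ^ 2)
  rw [← ENNReal.ofReal_mul (by positivity), ← ENNReal.ofReal_one, psi_sq]
  refine ENNReal.ofReal_le_ofReal ?_
  have h1 : 1 ≤ Real.exp (2 * |γ| * R) * Real.exp (-(2 * γ * ‖x‖)) := by
    rw [← Real.exp_add]
    refine Real.one_le_exp ?_
    have h1 : γ * ‖x‖ ≤ |γ| * ‖x‖ := by gcongr; exact le_abs_self γ
    have h2 : |γ| * ‖x‖ ≤ |γ| * R := by gcongr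
    linarith
  have h2 : 1 ≤ R ^ 2 * (‖x‖ ^ 2)⁻¹ := by
    rw [← div_eq_mul_inv, le_div_iff₀ (by positivity), one_mul]
    gcongr
  calc (1 : ℝ) ≤ (Real.exp (2 * |γ| * R) * Real.exp (-(2 * γ * ‖x‖))) * (R ^ 2 * (‖x‖ ^ 2)⁻¹) :=
        one_le_mul_of_one_le_of_one_le h1 h2
    _ = _ := by rw [hc]; field_simp


/-! ### From `L²(m_γ)` to local `L¹`. -/

section Integrability

variable {F : Type*} [NormedAddCommGroup F]

theorem locallyIntegrable_of_forall_ball {f : E3 → F}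
    (h : ∀ R : ℝ, IntegrableOn f (Metric.ball 0 R) volume) : LocallyIntegrable f volume := by
  rw [locallyIntegrable_iff]
  intro K hK
  obtain ⟨R, hR⟩ := hK.isBounded.subset_ball 0
  exact (h R).mono_set hR

/-- On a ball Lebesgue measure is dominated by a multiple of `m_γ`, and `m_γ` is finite there, so
Hölder's inequality applies. Elements of `L²(m_γ)` are thus locally integrable and can carry weak
gradients. -/
theorem exists_eLpNorm_one_ball_le (γ R : ℝ) : ∃ c : ENNReal, c ≠ ⊤ ∧
    ∀ f : E3 → F, AEStronglyMeasurable f volume →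
      eLpNorm f 1 (volume.restrict (Metric.ball 0 R)) ≤
        c * eLpNorm f 2 ((mMeasure γ).restrict (Metric.ball 0 R)) := by
  obtain ⟨c, hc⟩ := exists_volume_restrict_le γ R
  refine ⟨c * mMeasure γ (Metric.ball 0 R) ^ (1 - (2 : ℝ)⁻¹), ?_, fun f hf => ?_⟩
  · exact ENNReal.mul_ne_top ENNReal.coe_ne_top
      (ENNReal.rpow_ne_top_of_nonneg (by norm_num) (mMeasure_ball_lt_top γ R).ne)
  · have hf' : AEStronglyMeasurable f ((mMeasure γ).restrict (Metric.ball 0 R)) :=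
      (hf.mono_ac (mMeasure_absolutelyContinuous γ)).restrict
    refine (eLpNorm_mono_measure f hc).trans ?_
    rw [ENNReal.smul_def, eLpNorm_smul_measure_of_ne_top (by simp)]
    have h := eLpNorm_le_eLpNorm_mul_rpow_measure_univ (p := 1) (q := 2) (by norm_num) hf'
    simp only [MeasurableSet.univ, Measure.restrict_apply, univ_inter, ENNReal.toReal_one,
      ENNReal.toReal_ofNat, one_div, inv_one] at h
    simp only [one_div, inv_one, ENNReal.toReal_one, ENNReal.rpow_one, smul_eq_mul]
    rw [mul_assoc, mul_comm (_ ^ _)]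
    gcongr

theorem aestronglyMeasurable_mMeasure_iff {γ : ℝ} {f : E3 → F} :
    AEStronglyMeasurable f (mMeasure γ) ↔ AEStronglyMeasurable f volume :=
  ⟨fun h => h.mono_ac (volume_absolutelyContinuous_mMeasure γ),
    fun h => h.mono_ac (mMeasure_absolutelyContinuous γ)⟩

theorem locallyIntegrable_of_memLp_mMeasure {γ : ℝ} {f : E3 → F} (hf : MemLp f 2 (mMeasure γ)) :
    LocallyIntegrable f volume := by
  refine locallyIntegrable_of_forall_ball fun R => ?_
  have hm := aestronglyMeasurable_mMeasure_iff.1 hf.aestronglyMeasurable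
  obtain ⟨c, hc, h⟩ := exists_eLpNorm_one_ball_le (F := F) γ R
  rw [IntegrableOn, ← memLp_one_iff_integrable]
  refine ⟨hm.restrict, (h f hm).trans_lt ?_⟩
  exact ENNReal.mul_lt_top hc.lt_top ((eLpNorm_restrict_le _ _ _ _).trans_lt hf.2)

/-- Convergence in `L²(m_γ)` implies convergence in `L¹` on balls. -/
theorem tendsto_eLpNorm_one_ball {γ : ℝ} {f : ℕ → E3 → F}
    (hf : ∀ n, AEStronglyMeasurable (f n) volume)
    (h : Tendsto (fun n => eLpNorm (f n) 2 (mMeasure γ)) atTop (𝓝 0)) (R : ℝ) :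
    Tendsto (fun n => eLpNorm (f n) 1 (volume.restrict (Metric.ball 0 R))) atTop (𝓝 0) := by
  obtain ⟨c, hc, h'⟩ := exists_eLpNorm_one_ball_le (F := F) γ R
  have h2 : Tendsto (fun n => c * eLpNorm (f n) 2 (mMeasure γ)) atTop (𝓝 0) := by
    simpa using ENNReal.Tendsto.const_mul h (Or.inr hc)
  refine tendsto_of_tendsto_of_tendsto_of_le_of_le tendsto_const_nhds h2 (fun _ => zero_le) fun n => ?_
  exact (h' _ (hf n)).trans (mul_le_mul_right (eLpNorm_restrict_le _ _ _ _) _)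

variable [NormedSpace ℝ F]

/-- Local `L¹` convergence implies convergence against continuous compactly supported functions. -/
theorem tendsto_integral_smul_of_tendsto_eLpNorm_ball {f : ℕ → E3 → F} {g : E3 → F}
    (hf : ∀ n, LocallyIntegrable (f n) volume) (hg : LocallyIntegrable g volume)
    (h : ∀ R : ℝ, Tendsto (fun n => eLpNorm (f n - g) 1 (volume.restrict (Metric.ball 0 R)))
      atTop (𝓝 0))
    {φ : E3 → ℝ} (hφ : Continuous φ) (hc : HasCompactSupport φ) :
    Tendsto (fun n => ∫ x, φ x • f n x) atTop (𝓝 (∫ x, φ x • g x)) := by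
  obtain ⟨R, hR⟩ := hc.isCompact.isBounded.subset_ball 0
  obtain ⟨M, hM⟩ := hφ.bounded_above_of_compact_support hc
  refine tendsto_integral_of_L1 _ (hg.integrable_smul_left_of_hasCompactSupport hφ hc).1
    (Eventually.of_forall fun n => (hf n).integrable_smul_left_of_hasCompactSupport hφ hc) ?_
  have h2 : Tendsto (fun n => ENNReal.ofReal M *
      eLpNorm (f n - g) 1 (volume.restrict (Metric.ball 0 R))) atTop (𝓝 0) := by
    simpa using ENNReal.Tendsto.const_mul (h R) (Or.inr ENNReal.ofReal_ne_top)
  refine tendsto_of_tendsto_of_tendsto_of_le_of_le tendsto_const_nhds h2 (fun _ => zero_le) fun n => ?_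
  rw [eLpNorm_one_eq_lintegral_enorm, ← lintegral_const_mul' _ _ ENNReal.ofReal_ne_top,
    ← lintegral_indicator measurableSet_ball]
  refine lintegral_mono fun x => ?_
  by_cases hx : x ∈ Metric.ball (0 : E3) R
  · rw [indicator_of_mem hx, ← smul_sub, enorm_smul]
    gcongr
    · rw [← ofReal_norm]
      exact ENNReal.ofReal_le_ofReal (hM x)
    · rfl
  · have : φ x = 0 := image_eq_zero_of_notMem_tsupport fun h => hx (hR h)
    simp [this]

end Integrability

/-! ### Weak gradients: linearity, Leibniz rule, closedness. -/

theorem LocallyIntegrable.continuous_smul_E3 {F : Type*} [NormedAddCommGroup F] [NormedSpace ℝ F]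
    {f : E3 → F} (hf : LocallyIntegrable f volume) {χ : E3 → ℝ} (hχ : Continuous χ) :
    LocallyIntegrable (fun x => χ x • f x) volume := by
  rw [locallyIntegrable_iff] at *
  exact fun K hK => (hf K hK).continuousOn_smul hχ.continuousOn hK

theorem LocallyIntegrable.smul_continuous_E3 {F : Type*} [NormedAddCommGroup F] [NormedSpace ℝ F]
    {f : E3 → ℝ} (hf : LocallyIntegrable f volume) {χ : E3 → F} (hχ : Continuous χ) :
    LocallyIntegrable (fun x => f x • χ x) volume := by
  rw [locallyIntegrable_iff] at *
  exact fun K hK => (hf K hK).smul_continuousOn hχ.continuousOn hK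

namespace smoothCompactlySupported

variable {φ χ : E3 → ℝ}

theorem continuous_fderiv_apply (h : φ ∈ smoothCompactlySupported) (v : E3) :
    Continuous fun x => fderiv ℝ φ x v :=
  (h.1.continuous_fderiv (by simp)).clm_apply continuous_const

theorem hasCompactSupport_fderiv_apply (h : φ ∈ smoothCompactlySupported) (v : E3) :
    HasCompactSupport fun x => fderiv ℝ φ x v :=
  h.2.fderiv_apply (𝕜 := ℝ) v

theorem mul_contDiff (h : φ ∈ smoothCompactlySupported) (hχ : ContDiff ℝ ∞ χ) :
    (fun x => φ x * χ x) ∈ smoothCompactlySupported :=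
  ⟨h.1.mul hχ, h.2.mul_right⟩

end smoothCompactlySupported

theorem continuous_gradient {f : E3 → ℝ} (hf : ContDiff ℝ 1 f) : Continuous (gradient f) :=
  (InnerProductSpace.toDual ℝ E3).symm.continuous.comp (hf.continuous_fderiv (by simp))

theorem hasCompactSupport_gradient {f : E3 → ℝ} (hf : HasCompactSupport f) :
    HasCompactSupport (gradient f) := by
  have := hf.fderiv (𝕜 := ℝ)
  exact this.comp_left (g := (InnerProductSpace.toDual ℝ E3).symm) (map_zero _)

namespace HasWeakGradient

variable {f g : E3 → ℝ} {G H : E3 → E3}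

theorem integral_smul_inner {φ : E3 → ℝ} (hG : LocallyIntegrable G volume)
    (hφ : Continuous φ) (hc : HasCompactSupport φ) (v : E3) :
    inner ℝ (∫ x, φ x • G x) v = ∫ x, φ x * inner ℝ (G x) v := by
  have hi : Integrable (fun x => φ x • G x) volume :=
    hG.integrable_smul_left_of_hasCompactSupport hφ hc
  rw [real_inner_comm, ← integral_inner hi v]
  simp only [inner_smul_right, real_inner_comm]

theorem integrable_mul_inner {φ : E3 → ℝ} (hG : LocallyIntegrable G volume)
    (hφ : Continuous φ) (hc : HasCompactSupport φ) (v : E3) :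
    Integrable (fun x => φ x * inner ℝ (G x) v) volume := by
  have hi : Integrable (fun x => φ x • G x) volume :=
    hG.integrable_smul_left_of_hasCompactSupport hφ hc
  have := hi.inner_const (𝕜 := ℝ) v
  simpa [inner_smul_left] using this

theorem integrable_mul_fderiv (hf : LocallyIntegrable f volume) {φ : E3 → ℝ}
    (hφ : φ ∈ smoothCompactlySupported) (v : E3) :
    Integrable (fun x => f x * fderiv ℝ φ x v) volume := by
  have := hf.integrable_smul_left_of_hasCompactSupport (smoothCompactlySupported.continuous_fderiv_apply hφ v)
    (smoothCompactlySupported.hasCompactSupport_fderiv_apply hφ v)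
  simpa [mul_comm] using this

theorem congr (h : HasWeakGradient f G) (hf : f =ᵐ[volume] g) (hG : G =ᵐ[volume] H) :
    HasWeakGradient g H where
  locallyIntegrable := h.1.congr hf
  locallyIntegrable_grad := h.2.congr hG
  integral_eq φ hφ v := by
    have h1 : ∫ x, g x * fderiv ℝ φ x v = ∫ x, f x * fderiv ℝ φ x v :=
      integral_congr_ae (by filter_upwards [hf] with x hx; rw [hx])
    have h2 : ∫ x, φ x * inner ℝ (H x) v = ∫ x, φ x * inner ℝ (G x) v :=
      integral_congr_ae (by filter_upwards [hG] with x hx; rw [hx])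
    rw [h1, h2, h.3 φ hφ v]

theorem add (hf : HasWeakGradient f G) (hg : HasWeakGradient g H) :
    HasWeakGradient (f + g) (G + H) where
  locallyIntegrable := hf.1.add hg.1
  locallyIntegrable_grad := hf.2.add hg.2
  integral_eq φ hφ v := by
    simp only [Pi.add_apply, add_mul, inner_add_left, mul_add]
    rw [integral_add (integrable_mul_fderiv hf.1 hφ v) (integrable_mul_fderiv hg.1 hφ v),
      integral_add (integrable_mul_inner hf.2 hφ.1.continuous hφ.2 v)
        (integrable_mul_inner hg.2 hφ.1.continuous hφ.2 v), hf.3 φ hφ v, hg.3 φ hφ v]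
    ring

theorem const_smul (c : ℝ) (hf : HasWeakGradient f G) : HasWeakGradient (c • f) (c • G) where
  locallyIntegrable := hf.1.smul c
  locallyIntegrable_grad := hf.2.smul c
  integral_eq φ hφ v := by
    simp only [Pi.smul_apply, smul_eq_mul, real_inner_smul_left]
    have e1 : ∀ x, c * f x * fderiv ℝ φ x v = c * (f x * fderiv ℝ φ x v) := fun x => by ring
    have e2 : ∀ x, φ x * (c * inner ℝ (G x) v) = c * (φ x * inner ℝ (G x) v) := fun x => by ring
    simp_rw [e1, e2, integral_const_mul, hf.3 φ hφ v]
    ring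

theorem neg (hf : HasWeakGradient f G) : HasWeakGradient (-f) (-G) := by
  simpa using hf.const_smul (-1)

theorem sub (hf : HasWeakGradient f G) (hg : HasWeakGradient g H) :
    HasWeakGradient (f - g) (G - H) := by
  simpa [sub_eq_add_neg] using hf.add hg.neg

theorem of_contDiff {f : E3 → ℝ} (hf : ContDiff ℝ 1 f) : HasWeakGradient f (gradient f) where
  locallyIntegrable := hf.continuous.locallyIntegrable
  locallyIntegrable_grad := (continuous_gradient hf).locallyIntegrable
  integral_eq φ hφ v := by
    simp only [inner_gradient_left]
    have hd : Continuous fun x => fderiv ℝ f x v :=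
      (hf.continuous_fderiv (by simp)).clm_apply continuous_const
    rw [integral_mul_fderiv_eq_neg_fderiv_mul_of_integrable]
    · simp only [mul_comm]
    · exact (hd.mul hφ.1.continuous).integrable_of_hasCompactSupport hφ.2.mul_left
    · exact integrable_mul_fderiv hf.continuous.locallyIntegrable hφ v
    · exact (hf.continuous.mul hφ.1.continuous).integrable_of_hasCompactSupport hφ.2.mul_left
    · exact fun x _ => hf.differentiable (by simp) x
    · exact fun x _ => hφ.1.differentiable (by simp) x

theorem const (c : ℝ) : HasWeakGradient (fun _ => c) 0 := by
  refine (of_contDiff (contDiff_const (c := c))).congr EventuallyEq.rfl ?_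
  refine Eventually.of_forall fun x => ?_
  simp [gradient]

/-- Leibniz rule for multiplication by a smooth function. -/
theorem contDiff_mul (hf : HasWeakGradient f G) {χ : E3 → ℝ} (hχ : ContDiff ℝ ∞ χ) :
    HasWeakGradient (fun x => χ x * f x) (fun x => χ x • G x + f x • gradient χ x) where
  locallyIntegrable := LocallyIntegrable.continuous_smul_E3 hf.1 hχ.continuous
  locallyIntegrable_grad := (LocallyIntegrable.continuous_smul_E3 hf.2 hχ.continuous).add
    (LocallyIntegrable.smul_continuous_E3 hf.1 (continuous_gradient (hχ.of_le (by simp))))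
  integral_eq φ hφ v := by
    have hχd : Continuous fun x => fderiv ℝ χ x v :=
      (hχ.continuous_fderiv (by simp)).clm_apply continuous_const
    have h := hf.3 _ (smoothCompactlySupported.mul_contDiff hφ hχ) v
    have e1 : ∀ x, f x * fderiv ℝ (fun x => φ x * χ x) x v
        = χ x * f x * fderiv ℝ φ x v + (φ x * fderiv ℝ χ x v) • f x := by
      intro x
      rw [fderiv_fun_mul (hφ.1.differentiable (by simp) x) (hχ.differentiable (by simp) x)]
      simp; ring
    have i1 : Integrable (fun x => χ x * f x * fderiv ℝ φ x v) volume :=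
      integrable_mul_fderiv (LocallyIntegrable.continuous_smul_E3 hf.1 hχ.continuous) hφ v
    have i2 : Integrable (fun x => (φ x * fderiv ℝ χ x v) • f x) volume :=
      hf.1.integrable_smul_left_of_hasCompactSupport (hφ.1.continuous.mul hχd) hφ.2.mul_right
    have i3 : Integrable (fun x => φ x * χ x * inner ℝ (G x) v) volume :=
      integrable_mul_inner hf.2 (hφ.1.continuous.mul hχ.continuous) hφ.2.mul_right v
    simp_rw [e1] at h
    rw [integral_add i1 i2] at h
    have e2 : ∀ x, φ x * inner ℝ (χ x • G x + f x • gradient χ x) v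
        = φ x * χ x * inner ℝ (G x) v + (φ x * fderiv ℝ χ x v) • f x := by
      intro x
      rw [inner_add_left, real_inner_smul_left, real_inner_smul_left, inner_gradient_left]
      simp; ring
    simp_rw [e2]
    rw [integral_add i3 i2]
    linarith

/-- Both sides of the defining identity are pairings with continuous compactly supported functions,
`∂_v φ` and `φ`, so weak convergence is enough. Functions and gradients may converge for different
reasons, as happens in the proof of recurrence. -/
theorem of_tendsto_integral {f : ℕ → E3 → ℝ} {G : ℕ → E3 → E3} {g : E3 → ℝ} {H : E3 → E3}
    (h : ∀ n, HasWeakGradient (f n) (G n)) (hg : LocallyIntegrable g volume)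
    (hH : LocallyIntegrable H volume)
    (hf : ∀ φ : E3 → ℝ, Continuous φ → HasCompactSupport φ →
      Tendsto (fun n => ∫ x, φ x • f n x) atTop (𝓝 (∫ x, φ x • g x)))
    (hG : ∀ φ : E3 → ℝ, Continuous φ → HasCompactSupport φ →
      Tendsto (fun n => ∫ x, φ x • G n x) atTop (𝓝 (∫ x, φ x • H x))) :
    HasWeakGradient g H where
  locallyIntegrable := hg
  locallyIntegrable_grad := hH
  integral_eq φ hφ v := by
    have h1 := hf _ (smoothCompactlySupported.continuous_fderiv_apply hφ v) (smoothCompactlySupported.hasCompactSupport_fderiv_apply hφ v)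
    have h2 := (hG _ hφ.1.continuous hφ.2).inner (𝕜 := ℝ) (tendsto_const_nhds (x := v))
    simp_rw [fun n => integral_smul_inner (h n).2 hφ.1.continuous hφ.2 v] at h2
    rw [integral_smul_inner hH hφ.1.continuous hφ.2 v] at h2
    simp only [smul_eq_mul, mul_comm (fderiv ℝ φ _ v)] at h1
    refine tendsto_nhds_unique h1 (h2.neg.congr fun n => ?_)
    exact ((h n).3 φ hφ v).symm

theorem of_tendsto_eLpNorm_ball {f : ℕ → E3 → ℝ} {G : ℕ → E3 → E3} {g : E3 → ℝ} {H : E3 → E3}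
    (h : ∀ n, HasWeakGradient (f n) (G n)) (hg : LocallyIntegrable g volume)
    (hH : LocallyIntegrable H volume)
    (hf : ∀ R : ℝ, Tendsto (fun n => eLpNorm (f n - g) 1 (volume.restrict (Metric.ball 0 R)))
      atTop (𝓝 0))
    (hG : ∀ R : ℝ, Tendsto (fun n => eLpNorm (G n - H) 1 (volume.restrict (Metric.ball 0 R)))
      atTop (𝓝 0)) :
    HasWeakGradient g H :=
  of_tendsto_integral h hg hH
    (fun _ hφ hc => tendsto_integral_smul_of_tendsto_eLpNorm_ball (fun n => (h n).1) hg hf hφ hc)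
    (fun _ hφ hc => tendsto_integral_smul_of_tendsto_eLpNorm_ball (fun n => (h n).2) hH hG hφ hc)

/-- The weak gradient is closed under convergence in `L²(m_γ)`. -/
theorem of_tendsto_eLpNorm {γ : ℝ} {f : ℕ → E3 → ℝ} {G : ℕ → E3 → E3} {g : E3 → ℝ} {H : E3 → E3}
    (h : ∀ n, HasWeakGradient (f n) (G n)) (hg : LocallyIntegrable g volume)
    (hH : LocallyIntegrable H volume)
    (hf : Tendsto (fun n => eLpNorm (f n - g) 2 (mMeasure γ)) atTop (𝓝 0))
    (hG : Tendsto (fun n => eLpNorm (G n - H) 2 (mMeasure γ)) atTop (𝓝 0)) :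
    HasWeakGradient g H :=
  of_tendsto_eLpNorm_ball h hg hH
    (tendsto_eLpNorm_one_ball
      (fun n => (h n).1.aestronglyMeasurable.sub hg.aestronglyMeasurable) hf)
    (tendsto_eLpNorm_one_ball
      (fun n => (h n).2.aestronglyMeasurable.sub hH.aestronglyMeasurable) hG)

/-- The weak gradient is closed under locally dominated pointwise convergence. -/
theorem of_dominated {f : ℕ → E3 → ℝ} {G : ℕ → E3 → E3} {g : E3 → ℝ} {H : E3 → E3}
    {b c : E3 → ℝ} (h : ∀ n, HasWeakGradient (f n) (G n))
    (hb : LocallyIntegrable b volume) (hc : LocallyIntegrable c volume)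
    (hfb : ∀ n, ∀ᵐ x, ‖f n x‖ ≤ b x) (hGc : ∀ n, ∀ᵐ x, ‖G n x‖ ≤ c x)
    (hf : ∀ᵐ x, Tendsto (fun n => f n x) atTop (𝓝 (g x)))
    (hG : ∀ᵐ x, Tendsto (fun n => G n x) atTop (𝓝 (H x))) :
    HasWeakGradient g H := by
  have hgm : AEStronglyMeasurable g volume :=
    aestronglyMeasurable_of_tendsto_ae _ (fun n => (h n).1.aestronglyMeasurable) hf
  have hHm : AEStronglyMeasurable H volume :=
    aestronglyMeasurable_of_tendsto_ae _ (fun n => (h n).2.aestronglyMeasurable) hG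
  refine of_tendsto_integral h ?_ ?_ ?_ ?_
  · refine hb.mono hgm ?_
    filter_upwards [hf, ae_all_iff.2 hfb] with x hx hxb
    exact (le_of_tendsto hx.norm (Eventually.of_forall hxb)).trans (le_abs_self _)
  · refine hc.mono hHm ?_
    filter_upwards [hG, ae_all_iff.2 hGc] with x hx hxb
    exact (le_of_tendsto hx.norm (Eventually.of_forall hxb)).trans (le_abs_self _)
  · intro φ hφ hφc
    refine tendsto_integral_of_dominated_convergence (fun x => ‖φ x‖ * b x) (fun n =>
      hφ.aestronglyMeasurable.smul (h n).1.aestronglyMeasurable)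
      (hb.integrable_smul_left_of_hasCompactSupport hφ.norm hφc.norm) (fun n => ?_) ?_
    · filter_upwards [hfb n] with x hx
      rw [norm_smul]; gcongr
    · filter_upwards [hf] with x hx using hx.const_smul _
  · intro φ hφ hφc
    refine tendsto_integral_of_dominated_convergence (fun x => ‖φ x‖ * c x) (fun n =>
      hφ.aestronglyMeasurable.smul (h n).2.aestronglyMeasurable)
      (hc.integrable_smul_left_of_hasCompactSupport hφ.norm hφc.norm) (fun n => ?_) ?_
    · filter_upwards [hGc n] with x hx
      rw [norm_smul]; gcongr
    · filter_upwards [hG] with x hx using hx.const_smul _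

end HasWeakGradient


/-! ### Mollification in the weighted space. -/

theorem eLpNorm_two_sq {X F : Type*} [MeasurableSpace X] [NormedAddCommGroup F] (μ : Measure X)
    (f : X → F) : eLpNorm f 2 μ ^ 2 = ∫⁻ y, ‖f y‖ₑ ^ 2 ∂μ := by
  rw [eLpNorm_eq_lintegral_rpow_enorm_toReal (by norm_num) (by norm_num), ← ENNReal.rpow_natCast,
    ← ENNReal.rpow_mul]
  norm_num

open scoped Convolution in
/-- Mollification by a normalised bump function. -/
noncomputable def mollify {F : Type*} [NormedAddCommGroup F] [NormedSpace ℝ F]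
    (ρ : ContDiffBump (0 : E3)) (g : E3 → F) : E3 → F :=
  ρ.normed volume ⋆[ContinuousLinearMap.lsmul ℝ ℝ, volume] g

/-- A sequence of bump functions whose supports shrink to the origin. -/
noncomputable def shrinkingBump (n : ℕ) : ContDiffBump (0 : E3) where
  rIn := 1 / (2 * ((n : ℝ) + 1))
  rOut := 1 / ((n : ℝ) + 1)
  rIn_pos := by positivity
  rIn_lt_rOut := by
    apply one_div_lt_one_div_of_lt <;> linarith [(n.cast_nonneg : (0:ℝ) ≤ n)]

theorem shrinkingBump_rOut_le (n : ℕ) : (shrinkingBump n).rOut ≤ 2 * (shrinkingBump n).rIn := by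
  simp only [shrinkingBump]
  apply le_of_eq
  field_simp

theorem shrinkingBump_rOut_le_one (n : ℕ) : (shrinkingBump n).rOut ≤ 1 := by
  simp only [shrinkingBump]
  rw [div_le_one (by positivity)]
  linarith [(n.cast_nonneg : (0:ℝ) ≤ n)]

theorem tendsto_shrinkingBump_rOut : Tendsto (fun n => (shrinkingBump n).rOut) atTop (𝓝 0) :=
  tendsto_one_div_add_atTop_nhds_zero_nat

section

variable {F : Type*} [NormedAddCommGroup F] [NormedSpace ℝ F] (ρ : ContDiffBump (0 : E3))

theorem mollify_apply (g : E3 → F) (x : E3) :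
    mollify ρ g x = ∫ y, ρ.normed volume (y - x) • g y := by
  rw [mollify, convolution_eq_swap]
  congr 1 with y
  rw [ContinuousLinearMap.lsmul_apply, ← neg_sub, ρ.normed_neg]

theorem integrable_normed_smul {g : E3 → F} (hg : LocallyIntegrable g volume) (x : E3) :
    Integrable (fun y => ρ.normed volume (y - x) • g y) volume := by
  refine hg.integrable_smul_left_of_hasCompactSupport ?_ ?_
  · exact ρ.continuous_normed.comp (continuous_id.sub continuous_const)
  · exact ρ.hasCompactSupport_normed.comp_homeomorph (Homeomorph.subRight x)

theorem mollify_sub {f g : E3 → F} (hf : LocallyIntegrable f volume)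
    (hg : LocallyIntegrable g volume) : mollify ρ (f - g) = mollify ρ f - mollify ρ g := by
  ext x
  simp only [mollify_apply, Pi.sub_apply, smul_sub]
  exact integral_sub (integrable_normed_smul ρ hf x) (integrable_normed_smul ρ hg x)

theorem contDiff_mollify {f : E3 → F} (hf : LocallyIntegrable f volume) :
    ContDiff ℝ ∞ (mollify ρ f) :=
  ρ.hasCompactSupport_normed.contDiff_convolution_left _ ρ.contDiff_normed hf

theorem hasCompactSupport_mollify {f : E3 → F} (hf : HasCompactSupport f) :
    HasCompactSupport (mollify ρ f) :=
  HasCompactSupport.convolution _ ρ.hasCompactSupport_normed hf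

theorem lintegral_ofReal_normed (x : E3) :
    ∫⁻ y, ENNReal.ofReal (ρ.normed volume (y - x)) = 1 := by
  rw [lintegral_sub_right_eq_self (fun y => ENNReal.ofReal (ρ.normed volume y)),
    ← ofReal_integral_eq_lintegral_ofReal ρ.integrable_normed
    (Eventually.of_forall fun y => ρ.nonneg_normed y), ρ.integral_normed, ENNReal.ofReal_one]

theorem measurable_ofReal_normed :
    Measurable fun p : E3 × E3 => ENNReal.ofReal (ρ.normed volume (p.2 - p.1)) :=
  (ρ.continuous_normed.measurable.comp (measurable_snd.sub measurable_fst)).ennreal_ofReal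

theorem measurable_ofReal_normed_sub (x : E3) :
    Measurable fun y => ENNReal.ofReal (ρ.normed volume (y - x)) :=
  (ρ.continuous_normed.comp (continuous_id.sub continuous_const)).measurable.ennreal_ofReal

/-- Jensen's inequality for the probability measure with density `ρ(y - x)`. -/
theorem enorm_mollify_sq_le {g : E3 → F} (hg : AEStronglyMeasurable g volume) (x : E3) :
    ‖mollify ρ g x‖ₑ ^ 2 ≤ ∫⁻ y, ENNReal.ofReal (ρ.normed volume (y - x)) * ‖g y‖ₑ ^ 2 := by
  have hk := measurable_ofReal_normed_sub ρ x
  set ν := (volume : Measure E3).withDensity fun y => ENNReal.ofReal (ρ.normed volume (y - x))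
    with hν
  have : IsProbabilityMeasure ν := ⟨by
    rw [hν, withDensity_apply _ MeasurableSet.univ, Measure.restrict_univ,
      lintegral_ofReal_normed]⟩
  have hgν : AEStronglyMeasurable g ν := hg.mono_ac (withDensity_absolutelyContinuous _ _)
  have h1 : ‖mollify ρ g x‖ₑ ≤ eLpNorm g 1 ν := by
    rw [eLpNorm_one_eq_lintegral_enorm, hν,
      lintegral_withDensity_eq_lintegral_mul₀ hk.aemeasurable hg.enorm, mollify_apply]
    refine (enorm_integral_le_lintegral_enorm _).trans (lintegral_mono fun y => ?_)
    rw [enorm_smul, Real.enorm_of_nonneg (ρ.nonneg_normed _), Pi.mul_apply]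
  have h2 : eLpNorm g 1 ν ≤ eLpNorm g 2 ν :=
    eLpNorm_le_eLpNorm_of_exponent_le (by norm_num) hgν
  have h3 : eLpNorm g 2 ν ^ 2 = ∫⁻ y, ENNReal.ofReal (ρ.normed volume (y - x)) * ‖g y‖ₑ ^ 2 := by
    rw [eLpNorm_two_sq, hν, lintegral_withDensity_eq_lintegral_mul₀ hk.aemeasurable (hg.enorm.pow_const 2)]
    rfl
  rw [← h3]
  gcongr
  exact h1.trans h2

/-- Mollification is bounded on `L²(m_γ)`, uniformly in the mollifier. -/
theorem eLpNorm_mollify_le (γ : ℝ) (hρ : ρ.rOut ≤ 2 * ρ.rIn) (hρ1 : ρ.rOut ≤ 1) {g : E3 → F}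
    (hg : AEStronglyMeasurable g volume) :
    eLpNorm (mollify ρ g) 2 (mMeasure γ) ^ 2 ≤
      ENNReal.ofReal (384 * Real.exp (2 * |γ|)) * eLpNorm g 2 (mMeasure γ) ^ 2 := by
  rw [eLpNorm_two_sq, eLpNorm_two_sq, mMeasure]
  refine (lintegral_withDensity_le_lintegral_mul _ (measurable_psi_sq γ) _).trans ?_
  rw [lintegral_withDensity_eq_lintegral_mul₀ (measurable_psi_sq γ).aemeasurable
    (hg.enorm.pow_const 2)]
  calc ∫⁻ x, ((fun x => ENNReal.ofReal (psi γ x ^ 2)) * fun x => ‖mollify ρ g x‖ₑ ^ 2) x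
      ≤ ∫⁻ x, ∫⁻ y, ENNReal.ofReal (psi γ x ^ 2) *
          (ENNReal.ofReal (ρ.normed volume (y - x)) * ‖g y‖ₑ ^ 2) := by
        refine lintegral_mono fun x => ?_
        rw [lintegral_const_mul' _ _ ENNReal.ofReal_ne_top, Pi.mul_apply]
        exact mul_le_mul_right (enorm_mollify_sq_le ρ hg x) _
    _ = ∫⁻ y, ∫⁻ x, ENNReal.ofReal (psi γ x ^ 2) *
          (ENNReal.ofReal (ρ.normed volume (y - x)) * ‖g y‖ₑ ^ 2) := by
        refine lintegral_lintegral_swap ?_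
        exact ((measurable_psi_sq γ).comp measurable_fst).aemeasurable.mul
          ((measurable_ofReal_normed ρ).aemeasurable.mul (hg.comp_snd.enorm.pow_const 2))
    -- After the interchange the kernel averages the weight around `y` instead of averaging `g`. The
    -- kernel is even, so the `A₁` estimate applies.
    _ ≤ ∫⁻ y, ENNReal.ofReal (384 * Real.exp (2 * |γ|)) *
          (ENNReal.ofReal (psi γ y ^ 2) * ‖g y‖ₑ ^ 2) := by
        refine lintegral_mono_ae ?_
        filter_upwards [ae_ne_zero_E3] with y hy
        have h1 : ∀ x, ENNReal.ofReal (psi γ x ^ 2) *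
            (ENNReal.ofReal (ρ.normed volume (y - x)) * ‖g y‖ₑ ^ 2) =
            (ENNReal.ofReal (ρ.normed volume (x - y)) * ENNReal.ofReal (psi γ x ^ 2))
              * ‖g y‖ₑ ^ 2 := by
          intro x
          rw [← neg_sub x y, ρ.normed_neg]; ring
        simp_rw [h1]
        rw [lintegral_mul_const' _ _ (by finiteness), ← mul_assoc]
        exact mul_le_mul_left (lintegral_bump_mul_psi_sq_le γ ρ hρ hρ1 hy) _
    _ = _ := by
        rw [lintegral_const_mul' _ _ ENNReal.ofReal_ne_top]
        rfl

variable [CompleteSpace F]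

/-- Uniform continuity gives uniform convergence, and all differences are supported in one ball,
which has finite `m_γ` measure. -/
theorem tendsto_mollify_of_continuous (γ : ℝ) {g : E3 → F} (hg : Continuous g)
    (hc : HasCompactSupport g) :
    Tendsto (fun n => eLpNorm (mollify (shrinkingBump n) g - g) 2 (mMeasure γ)) atTop (𝓝 0) := by
  obtain ⟨R, hR⟩ := hc.isCompact.isBounded.subset_ball 0
  have hu : UniformContinuous g := hg.uniformContinuous_of_tendsto_cocompact
    hc.is_zero_at_infty
  have hs : ∀ n, Function.support (mollify (shrinkingBump n) g - g) ⊆ Metric.ball 0 (R + 1) := by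
    intro n x hx
    by_contra hxR
    apply hx
    simp only [Metric.mem_ball, dist_zero_right, not_lt] at hxR
    have h0 : ∀ y, R ≤ ‖y‖ → g y = 0 := fun y hy =>
      image_eq_zero_of_notMem_tsupport fun h => by
        have := hR h
        simp only [Metric.mem_ball, dist_zero_right] at this
        linarith
    have h1 : mollify (shrinkingBump n) g x = 0 := by
      rw [mollify_apply]
      refine integral_eq_zero_of_ae (Eventually.of_forall fun y => ?_)
      rcases le_or_gt R ‖y‖ with hy | hy
      · simp [h0 y hy]
      · have : (shrinkingBump n).normed volume (y - x) = 0 := by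
          rw [← Function.notMem_support, ContDiffBump.support_normed_eq, Metric.mem_ball,
            dist_zero_right, not_lt]
          have h2 := norm_sub_norm_le x y
          have h3 := shrinkingBump_rOut_le_one n
          rw [norm_sub_rev] at h2
          linarith
        simp [this]
    rw [Pi.sub_apply, h1, h0 x (by linarith), sub_zero]
  have hm : mMeasure γ (Metric.ball 0 (R + 1)) ≠ ⊤ := (mMeasure_ball_lt_top γ _).ne
  set A := mMeasure γ (Metric.ball 0 (R + 1)) ^ ((2 : ENNReal).toReal)⁻¹ with hA
  have hAtop : A ≠ ⊤ := ENNReal.rpow_ne_top_of_nonneg (by simp) hm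
  have hbound : ∀ ε : ℝ, 0 < ε → ∀ᶠ n in atTop,
      eLpNorm (mollify (shrinkingBump n) g - g) 2 (mMeasure γ) ≤ A * ENNReal.ofReal ε := by
    intro ε hε
    obtain ⟨δ, hδ, h⟩ := Metric.uniformContinuous_iff.1 hu ε hε
    filter_upwards [tendsto_shrinkingBump_rOut.eventually (gt_mem_nhds hδ)] with n hn
    rw [← eLpNorm_restrict_eq_of_support_subset (hs n), hA]
    refine (eLpNorm_le_of_ae_bound (C := ε) (Eventually.of_forall fun x => ?_)).trans ?_
    · rw [Pi.sub_apply, ← dist_eq_norm]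
      refine ContDiffBump.dist_normed_convolution_le hg.aestronglyMeasurable fun y hy => ?_
      exact (h ((Metric.mem_ball.1 hy).trans hn)).le
    · rw [Measure.restrict_apply MeasurableSet.univ, univ_inter]
  rw [ENNReal.tendsto_nhds_zero]
  intro δ hδ
  rcases eq_or_ne δ ⊤ with rfl | hδt
  · exact Eventually.of_forall fun _ => le_top
  have hlim : Tendsto (fun ε : ℝ => A * ENNReal.ofReal ε) (𝓝[>] 0) (𝓝 0) := by
    have h1 : Tendsto (fun ε : ℝ => ENNReal.ofReal ε) (𝓝[>] 0) (𝓝 0) := by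
      have := (ENNReal.continuous_ofReal.tendsto 0).mono_left (nhdsWithin_le_nhds (s := Ioi 0))
      simpa using this
    simpa using ENNReal.Tendsto.const_mul h1 (Or.inr hAtop)
  obtain ⟨ε, h1, h2⟩ := ((hlim.eventually (gt_mem_nhds hδ)).and self_mem_nhdsWithin).exists
  exact (hbound ε h2).mono fun n hn => hn.trans h1.le

/-- Mollifications converge in `L²(m_γ)`. -/
theorem tendsto_mollify (γ : ℝ) {g : E3 → F} (hg : MemLp g 2 (mMeasure γ)) :
    Tendsto (fun n => eLpNorm (mollify (shrinkingBump n) g - g) 2 (mMeasure γ)) atTop (𝓝 0) := by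
  set K : ENNReal := ENNReal.ofReal (384 * Real.exp (2 * |γ|)) with hK
  -- The available bound concerns squares. The constant `1 + K` avoids a square root, since `K ≤ (1
  -- + K)²`.
  have hT (n : ℕ) (f : E3 → F) (hf : AEStronglyMeasurable f volume) :
      eLpNorm (mollify (shrinkingBump n) f) 2 (mMeasure γ) ≤
        (1 + K) * eLpNorm f 2 (mMeasure γ) := by
    have h := eLpNorm_mollify_le (shrinkingBump n) γ (shrinkingBump_rOut_le n)
      (shrinkingBump_rOut_le_one n) hf
    rw [← hK] at h
    refine (ENNReal.pow_right_strictMono two_ne_zero).le_iff_le.1 (h.trans ?_)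
    rw [mul_pow]
    refine mul_le_mul_left ?_ _
    calc K ≤ 1 + K := le_add_self
      _ = (1 + K) * 1 := (mul_one _).symm
      _ ≤ (1 + K) * (1 + K) := by gcongr; exact le_self_add
      _ = _ := (sq _).symm
  rw [ENNReal.tendsto_nhds_zero]
  intro δ hδ
  rcases eq_or_ne δ ⊤ with rfl | hδt
  · exact Eventually.of_forall fun _ => le_top
  -- The error is at most `(1 + K) η` from mollifying `g - h`, plus `η` from `h - g`, plus `δ / 2`
  -- from mollifying `h`; this `η` makes the first two add up to `δ / 2`.
  set η := δ / (2 * (2 + K)) with hη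
  have hKt : 2 * (2 + K) ≠ ⊤ := by simp [hK]; finiteness
  have hη0 : η ≠ 0 := by
    rw [hη]; exact (ENNReal.div_pos hδ.ne' hKt).ne'
  obtain ⟨h, hhc, hgh, hhcont, hhL⟩ := hg.exists_hasCompactSupport_eLpNorm_sub_le (by norm_num) hη0
  have hm := aestronglyMeasurable_mMeasure_iff.1 (hg.sub hhL).aestronglyMeasurable
  have hgl := locallyIntegrable_of_memLp_mMeasure hg
  have hδ2 : 0 < δ / 2 := ENNReal.half_pos hδ.ne'
  filter_upwards [(ENNReal.tendsto_nhds_zero.1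
    (tendsto_mollify_of_continuous γ hhcont hhc)) (δ / 2) hδ2] with n hn
  have e : mollify (shrinkingBump n) g - g = mollify (shrinkingBump n) (g - h) +
      ((mollify (shrinkingBump n) h - h) + (h - g)) := by
    rw [mollify_sub _ hgl hhcont.locallyIntegrable]; abel
  have hl1 := contDiff_mollify (shrinkingBump n) (hgl.sub hhcont.locallyIntegrable)
  have hl2 := contDiff_mollify (shrinkingBump n) hhcont.locallyIntegrable
  rw [e]
  calc eLpNorm (mollify (shrinkingBump n) (g - h) +
      ((mollify (shrinkingBump n) h - h) + (h - g))) 2 (mMeasure γ)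
      ≤ eLpNorm (mollify (shrinkingBump n) (g - h)) 2 (mMeasure γ) +
        (eLpNorm (mollify (shrinkingBump n) h - h) 2 (mMeasure γ) +
          eLpNorm (h - g) 2 (mMeasure γ)) := by
        refine (eLpNorm_add_le hl1.continuous.aestronglyMeasurable ?_ (by norm_num)).trans ?_
        · exact (hl2.continuous.sub hhcont).aestronglyMeasurable.add
            (hhL.sub hg).aestronglyMeasurable
        · gcongr
          exact eLpNorm_add_le (hl2.continuous.sub hhcont).aestronglyMeasurable
            (hhL.sub hg).aestronglyMeasurable (by norm_num)
    _ ≤ (1 + K) * η + (δ / 2 + η) := by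
        gcongr
        · exact (hT n _ hm).trans (by gcongr)
        · rw [eLpNorm_sub_comm]; exact hgh
    _ = (2 + K) * η + δ / 2 := by ring
    _ ≤ δ / 2 + δ / 2 := by
        gcongr
        rw [hη, ENNReal.div_eq_inv_mul, ENNReal.mul_inv (by simp) (by simp)]
        have h3 : (2 + K) * (2 + K)⁻¹ = 1 := ENNReal.mul_inv_cancel (by simp) (by
          rw [hK]; finiteness)
        calc (2 + K) * (2⁻¹ * (2 + K)⁻¹ * δ) = ((2 + K) * (2 + K)⁻¹) * (2⁻¹ * δ) := by ring
          _ ≤ δ / 2 := by rw [h3, one_mul, ENNReal.div_eq_inv_mul]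
    _ = δ := ENNReal.add_halves δ

end

/-- Differentiating the convolution puts the derivative on the kernel. A translate of the kernel is
a test function, so the weak gradient identity moves the derivative onto `f`. -/
theorem HasWeakGradient.gradient_mollify {f : E3 → ℝ} {G : E3 → E3} (h : HasWeakGradient f G)
    (ρ : ContDiffBump (0 : E3)) : gradient (mollify ρ f) = mollify ρ G := by
  ext1 x
  refine ext_inner_right ℝ fun v => ?_
  have hρ : ContDiff ℝ ∞ (ρ.normed (volume : Measure E3)) := ρ.contDiff_normed
  have hρc := ρ.hasCompactSupport_normed (μ := (volume : Measure E3))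
  have hφ : (fun y => ρ.normed volume (y - x)) ∈ smoothCompactlySupported :=
    ⟨hρ.comp (contDiff_id.sub contDiff_const), hρc.comp_homeomorph (Homeomorph.subRight x)⟩
  have h1 := hρc.hasFDerivAt_convolution_left (ContinuousLinearMap.lsmul ℝ ℝ)
    (hρ.of_le (by simp)) h.1 x
  have hex : ConvolutionExistsAt (fderiv ℝ (ρ.normed (volume : Measure E3))) f x
      ((ContinuousLinearMap.lsmul ℝ ℝ).precompL E3) volume :=
    (hρc.fderiv (𝕜 := ℝ)).convolutionExists_left _ (hρ.continuous_fderiv (by simp)) h.1 x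
  rw [inner_gradient_left, mollify, h1.fderiv, convolution_def,
    ContinuousLinearMap.integral_apply hex]
  simp only [ContinuousLinearMap.precompL_apply, ContinuousLinearMap.lsmul_apply]
  rw [mollify_apply, integral_smul_inner h.2 hφ.1.continuous hφ.2, ← neg_eq_iff_eq_neg.2
    (h.3 _ hφ v), ← integral_neg, ← integral_sub_left_eq_self _ _ x]
  congr 1 with y
  -- The kernel is even, so its derivative is odd. The resulting sign cancels the minus in the weak
  -- gradient identity.
  have h2 : fderiv ℝ (ρ.normed volume) (x - y) = -fderiv ℝ (ρ.normed volume) (y - x) := by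
    have h3 : (fun z => ρ.normed volume (-z)) = ρ.normed volume := funext fun z => ρ.normed_neg z
    have h4 : HasFDerivAt (fun z => ρ.normed volume (-z))
        ((fderiv ℝ (ρ.normed volume) (-(y - x))).comp (-ContinuousLinearMap.id ℝ E3)) (y - x) :=
      (hρ.differentiable (by simp) _).hasFDerivAt.comp _ (hasFDerivAt_id _).neg
    rw [h3, neg_sub] at h4
    rw [h4.fderiv]
    ext; simp
  rw [fderiv_comp_sub, h2]
  simp [mul_comm]


theorem tendsto_eLpNorm_two_of_dominated {X F : Type*} [MeasurableSpace X] [NormedAddCommGroup F]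
    {μ : Measure X} {f : ℕ → X → F} {g : X → F} {b : X → ℝ}
    (hf : ∀ n, AEStronglyMeasurable (f n) μ) (hg : AEStronglyMeasurable g μ) (hb : MemLp b 2 μ)
    (hbound : ∀ n, ∀ᵐ x ∂μ, ‖f n x - g x‖ ≤ b x)
    (h : ∀ᵐ x ∂μ, Tendsto (fun n => f n x) atTop (𝓝 (g x))) :
    Tendsto (fun n => eLpNorm (f n - g) 2 μ) atTop (𝓝 0) := by
  have h1 : Tendsto (fun n => ∫⁻ x, ‖(f n - g) x‖ₑ ^ 2 ∂μ) atTop (𝓝 (∫⁻ _, 0 ∂μ)) := by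
    refine tendsto_lintegral_of_dominated_convergence' (fun x => ‖b x‖ₑ ^ 2)
      (fun n => ((hf n).sub hg).enorm.pow_const 2) (fun n => ?_) ?_ ?_
    · filter_upwards [hbound n] with x hx
      have h2 : ‖(f n - g) x‖ₑ ≤ ‖b x‖ₑ :=
        enorm_le_iff_norm_le.2 (hx.trans (le_abs_self _))
      exact ENNReal.pow_le_pow_left h2
    · rw [← eLpNorm_two_sq]
      exact (ENNReal.pow_lt_top hb.2).ne
    · filter_upwards [h] with x hx
      have h2 : Tendsto (fun n => ‖f n x - g x‖ₑ) atTop (𝓝 0) := by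
        have := (tendsto_sub_nhds_zero_iff.2 hx).enorm
        simpa using this
      simpa using ENNReal.Tendsto.pow (n := 2) h2
  rw [lintegral_zero] at h1
  simp_rw [← eLpNorm_two_sq] at h1
  have h2 := h1.ennrpow_const (1 / 2)
  simp only [one_div, ENNReal.zero_rpow_of_pos (show (0 : ℝ) < 2⁻¹ by norm_num)] at h2
  refine h2.congr fun n => ?_
  rw [← ENNReal.rpow_natCast, ← ENNReal.rpow_mul]
  norm_num

theorem eLpNorm_two_le_of_ae_le_mul {X F F' : Type*} [MeasurableSpace X] [NormedAddCommGroup F]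
    [NormedAddCommGroup F'] {μ : Measure X} {f : X → F} {g : X → F'} {c : ℝ}
    (h : ∀ᵐ x ∂μ, ‖f x‖ ≤ c * ‖g x‖) : eLpNorm f 2 μ ≤ ENNReal.ofReal c * eLpNorm g 2 μ :=
  eLpNorm_le_mul_eLpNorm_of_ae_le_mul h 2

/-! ### Cut-off functions -/

/-- A fixed smooth bump, equal to `1` on the unit ball and supported in the ball of radius `2`. -/
noncomputable def unitBump : ContDiffBump (0 : E3) where
  rIn := 1
  rOut := 2
  rIn_pos := one_pos
  rIn_lt_rOut := one_lt_two

/-- Smooth cut-off functions that exhaust `ℝ³`. -/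
noncomputable def cutoff (n : ℕ) (x : E3) : ℝ := unitBump (((n : ℝ) + 1)⁻¹ • x)

theorem contDiff_cutoff (n : ℕ) : ContDiff ℝ ∞ (cutoff n) :=
  unitBump.contDiff.comp (contDiff_const_smul _)

theorem cutoff_nonneg (n : ℕ) (x : E3) : 0 ≤ cutoff n x := unitBump.nonneg

theorem cutoff_le_one (n : ℕ) (x : E3) : cutoff n x ≤ 1 := unitBump.le_one

theorem norm_inv_smul_nat (n : ℕ) (x : E3) :
    ‖((n : ℝ) + 1)⁻¹ • x‖ = ((n : ℝ) + 1)⁻¹ * ‖x‖ := by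
  rw [norm_smul, Real.norm_of_nonneg (by positivity)]

theorem cutoff_eq_one {n : ℕ} {x : E3} (hx : ‖x‖ ≤ n + 1) : cutoff n x = 1 := by
  refine unitBump.one_of_mem_closedBall ?_
  rw [mem_closedBall_zero_iff, norm_inv_smul_nat]
  exact inv_mul_le_one_of_le₀ hx (by positivity)

theorem cutoff_eq_zero {n : ℕ} {x : E3} (hx : 2 * ((n : ℝ) + 1) ≤ ‖x‖) : cutoff n x = 0 := by
  refine unitBump.zero_of_le_dist ?_
  rw [dist_zero_right, norm_inv_smul_nat, le_inv_mul_iff₀ (by positivity)]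
  calc ((n : ℝ) + 1) * 2 = 2 * ((n : ℝ) + 1) := by ring
    _ ≤ _ := hx

theorem hasCompactSupport_cutoff (n : ℕ) : HasCompactSupport (cutoff n) := by
  refine HasCompactSupport.intro (isCompact_closedBall (0 : E3) (2 * ((n : ℝ) + 1))) fun x hx => ?_
  refine cutoff_eq_zero ?_
  simp only [Metric.mem_closedBall, dist_zero_right, not_le] at hx
  exact hx.le

theorem cutoff_mem (n : ℕ) : cutoff n ∈ smoothCompactlySupported :=
  ⟨contDiff_cutoff n, hasCompactSupport_cutoff n⟩

theorem gradient_eq_zero_of_notMem_tsupport {f : E3 → ℝ} {x : E3} (hx : x ∉ tsupport f) :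
    gradient f x = 0 := by
  rw [gradient, image_eq_zero_of_notMem_tsupport fun h => hx (tsupport_fderiv_subset ℝ h), map_zero]

theorem tendsto_cutoff (x : E3) : Tendsto (fun n => cutoff n x) atTop (𝓝 1) := by
  refine tendsto_const_nhds.congr' ?_
  filter_upwards [eventually_ge_atTop ⌈‖x‖⌉₊] with n hn
  refine (cutoff_eq_one ?_).symm
  have h1 := Nat.le_ceil ‖x‖
  have h2 : (⌈‖x‖⌉₊ : ℝ) ≤ n := by exact_mod_cast hn
  linarith

theorem norm_gradient (f : E3 → ℝ) (x : E3) : ‖gradient f x‖ = ‖fderiv ℝ f x‖ := by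
  rw [gradient, LinearIsometryEquiv.norm_map]

/-- Scaling of one fixed bump. The square of the rate `1 / (n + 1)` beats linear volume growth, and
this gives vanishing energy for `γ ≥ 0`. -/
theorem exists_norm_gradient_cutoff_le :
    ∃ M : ℝ, 0 ≤ M ∧ ∀ n x, ‖gradient (cutoff n) x‖ ≤ M * ((n : ℝ) + 1)⁻¹ := by
  have hc : HasCompactSupport (fderiv ℝ unitBump) :=
    unitBump.hasCompactSupport.fderiv (𝕜 := ℝ)
  have hcont : Continuous (fderiv ℝ unitBump) :=
    (unitBump.contDiff (n := 1)).continuous_fderiv (by simp)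
  obtain ⟨M, hM⟩ := hcont.bounded_above_of_compact_support hc
  refine ⟨M, (norm_nonneg _).trans (hM 0), fun n x => ?_⟩
  have h0 : HasFDerivAt (fun y : E3 => ((n : ℝ) + 1)⁻¹ • y)
      (((n : ℝ) + 1)⁻¹ • ContinuousLinearMap.id ℝ E3) x :=
    (hasFDerivAt_id x).const_smul (((n : ℝ) + 1)⁻¹)
  have h1 : HasFDerivAt (cutoff n)
      ((fderiv ℝ unitBump (((n : ℝ) + 1)⁻¹ • x)).comp
        (((n : ℝ) + 1)⁻¹ • ContinuousLinearMap.id ℝ E3)) x :=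
    ((unitBump.contDiff (n := 1)).differentiable (by simp) _).hasFDerivAt.comp x h0
  rw [norm_gradient, h1.fderiv, ContinuousLinearMap.comp_smul, ContinuousLinearMap.comp_id,
    norm_smul, mul_comm, Real.norm_of_nonneg (by positivity)]
  gcongr
  exact hM _

/-! ### Density of test functions -/

section

variable {γ : ℝ} {f : E3 → ℝ} {G : E3 → E3}

theorem tendsto_cutoff_mul (hf : MemLp f 2 (mMeasure γ)) :
    Tendsto (fun n => eLpNorm ((fun x => cutoff n x * f x) - f) 2 (mMeasure γ)) atTop (𝓝 0) := by
  refine tendsto_eLpNorm_two_of_dominated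
    (fun n => (contDiff_cutoff n).continuous.aestronglyMeasurable.mul hf.1) hf.1 hf.norm
    (fun n => Eventually.of_forall fun x => ?_) (Eventually.of_forall fun x => ?_)
  · have : cutoff n x * f x - f x = (cutoff n x - 1) * f x := by ring
    rw [this, norm_mul]
    refine mul_le_of_le_one_left (norm_nonneg _) ?_
    rw [Real.norm_eq_abs, abs_le]
    constructor <;> linarith [cutoff_nonneg n x, cutoff_le_one n x]
  · simpa using (tendsto_cutoff x).mul_const (f x)

theorem tendsto_gradient_cutoff_mul (hf : MemLp f 2 (mMeasure γ)) (hG : MemLp G 2 (mMeasure γ)) :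
    Tendsto (fun n => eLpNorm
      ((fun x => cutoff n x • G x + f x • gradient (cutoff n) x) - G) 2 (mMeasure γ))
      atTop (𝓝 0) := by
  obtain ⟨M, hM0, hM⟩ := exists_norm_gradient_cutoff_le
  have hM' (n : ℕ) (x : E3) : ‖gradient (cutoff n) x‖ ≤ M := by
    refine (hM n x).trans (mul_le_of_le_one_right hM0 ?_)
    exact inv_le_one_of_one_le₀ (by linarith [(n.cast_nonneg : (0 : ℝ) ≤ n)])
  have hgc (n : ℕ) : Continuous (gradient (cutoff n)) :=
    continuous_gradient ((contDiff_cutoff n).of_le (by simp))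
  refine tendsto_eLpNorm_two_of_dominated (b := fun x => ‖G x‖ + M * ‖f x‖)
    (fun n => ((contDiff_cutoff n).continuous.aestronglyMeasurable.smul hG.1).add
      (hf.1.smul (hgc n).aestronglyMeasurable)) hG.1 (hG.norm.add (hf.norm.const_mul M))
    (fun n => Eventually.of_forall fun x => ?_) (Eventually.of_forall fun x => ?_)
  · have : cutoff n x • G x + f x • gradient (cutoff n) x - G x
        = (cutoff n x - 1) • G x + f x • gradient (cutoff n) x := by
      rw [sub_smul, one_smul]; abel
    rw [this]
    refine (norm_add_le _ _).trans (add_le_add ?_ ?_)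
    · rw [norm_smul]
      refine mul_le_of_le_one_left (norm_nonneg _) ?_
      rw [Real.norm_eq_abs, abs_le]
      constructor <;> linarith [cutoff_nonneg n x, cutoff_le_one n x]
    · rw [norm_smul, mul_comm]
      gcongr
      exact hM' n x
  · have h1 := (tendsto_cutoff x).smul_const (G x)
    have h2 : Tendsto (fun n => gradient (cutoff n) x) atTop (𝓝 0) := by
      refine squeeze_zero_norm (fun n => hM n x) ?_
      have := (tendsto_one_div_add_atTop_nhds_zero_nat (𝕜 := ℝ)).const_mul M
      simpa using this
    simpa using h1.add (h2.const_smul (f x))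

/-- `C_c^∞(ℝ³)` is dense in the domain of the distorted form. -/
theorem HasWeakGradient.exists_smooth_approx (h : HasWeakGradient f G)
    (hf : MemLp f 2 (mMeasure γ)) (hG : MemLp G 2 (mMeasure γ)) {ε : ENNReal} (hε : 0 < ε) :
    ∃ φ ∈ smoothCompactlySupported, eLpNorm (φ - f) 2 (mMeasure γ) < ε ∧
      eLpNorm (gradient φ - G) 2 (mMeasure γ) < ε := by
  have hε2 : 0 < ε / 2 := ENNReal.half_pos hε.ne'
  -- Cutting off comes first, so that the mollification has compact support. Its gradient is the
  -- mollified weak gradient, so one mollifier approximates both the function and the gradient.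
  obtain ⟨n, hn1, hn2⟩ := (((tendsto_cutoff_mul hf).eventually (gt_mem_nhds hε2)).and
    ((tendsto_gradient_cutoff_mul hf hG).eventually (gt_mem_nhds hε2))).exists
  have hc := h.contDiff_mul (contDiff_cutoff n)
  set f' := fun x => cutoff n x * f x with hf'
  set G' := fun x => cutoff n x • G x + f x • gradient (cutoff n) x with hG'
  have hgc : Continuous (gradient (cutoff n)) :=
    continuous_gradient ((contDiff_cutoff n).of_le (by simp))
  have mf' : MemLp (f' - f) 2 (mMeasure γ) :=
    ⟨((contDiff_cutoff n).continuous.aestronglyMeasurable.mul hf.1).sub hf.1,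
      hn1.trans_le le_top⟩
  have mG' : MemLp (G' - G) 2 (mMeasure γ) :=
    ⟨(((contDiff_cutoff n).continuous.aestronglyMeasurable.smul hG.1).add
      (hf.1.smul hgc.aestronglyMeasurable)).sub hG.1, hn2.trans_le le_top⟩
  have lf' : MemLp f' 2 (mMeasure γ) := by simpa using mf'.add hf
  have lG' : MemLp G' 2 (mMeasure γ) := by simpa using mG'.add hG
  obtain ⟨k, hk1, hk2⟩ := (((tendsto_mollify γ lf').eventually (gt_mem_nhds hε2)).and
    ((tendsto_mollify γ lG').eventually (gt_mem_nhds hε2))).exists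
  refine ⟨mollify (shrinkingBump k) f', ⟨contDiff_mollify _ hc.1,
    hasCompactSupport_mollify _ (hasCompactSupport_cutoff n).mul_right⟩, ?_, ?_⟩
  · have e : mollify (shrinkingBump k) f' - f = (mollify (shrinkingBump k) f' - f') + (f' - f) := by
      abel
    rw [e, ← ENNReal.add_halves ε]
    refine (eLpNorm_add_le ?_ mf'.1 (by norm_num)).trans_lt (ENNReal.add_lt_add hk1 hn1)
    exact (contDiff_mollify _ hc.1).continuous.aestronglyMeasurable.sub lf'.1
  · have e : gradient (mollify (shrinkingBump k) f') - G
        = (mollify (shrinkingBump k) G' - G') + (G' - G) := by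
      rw [hc.gradient_mollify]; abel
    rw [e, ← ENNReal.add_halves ε]
    refine (eLpNorm_add_le ?_ mG'.1 (by norm_num)).trans_lt (ENNReal.add_lt_add hk2 hn2)
    exact (contDiff_mollify _ hc.2).continuous.aestronglyMeasurable.sub lG'.1

/-- Almost everywhere convergence, obtained along a subsequence, is what lets `F' (φ n)` converge in
the chain rule, where `F'` is merely continuous and bounded. -/
theorem HasWeakGradient.exists_smooth_seq (h : HasWeakGradient f G)
    (hf : MemLp f 2 (mMeasure γ)) (hG : MemLp G 2 (mMeasure γ)) :
    ∃ φ : ℕ → E3 → ℝ, (∀ n, φ n ∈ smoothCompactlySupported) ∧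
      Tendsto (fun n => eLpNorm (φ n - f) 2 (mMeasure γ)) atTop (𝓝 0) ∧
      Tendsto (fun n => eLpNorm (gradient (φ n) - G) 2 (mMeasure γ)) atTop (𝓝 0) ∧
      ∀ᵐ x ∂(mMeasure γ), Tendsto (fun n => φ n x) atTop (𝓝 (f x)) := by
  choose φ hφ h1 h2 using fun n : ℕ => h.exists_smooth_approx hf hG
    (ε := ((n : ENNReal) + 1)⁻¹) (by simp)
  have hlim : Tendsto (fun n : ℕ => ((n : ENNReal) + 1)⁻¹) atTop (𝓝 0) := by
    have := (tendsto_add_atTop_iff_nat 1).2 ENNReal.tendsto_inv_nat_nhds_zero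
    simpa using this
  have t1 : Tendsto (fun n => eLpNorm (φ n - f) 2 (mMeasure γ)) atTop (𝓝 0) :=
    tendsto_of_tendsto_of_tendsto_of_le_of_le tendsto_const_nhds hlim (fun _ => zero_le)
      fun n => (h1 n).le
  have t2 : Tendsto (fun n => eLpNorm (gradient (φ n) - G) 2 (mMeasure γ)) atTop (𝓝 0) :=
    tendsto_of_tendsto_of_tendsto_of_le_of_le tendsto_const_nhds hlim (fun _ => zero_le)
      fun n => (h2 n).le
  obtain ⟨ns, hns, hae⟩ := (tendstoInMeasure_of_tendsto_eLpNorm (by norm_num)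
    (fun n => (hφ n).1.continuous.aestronglyMeasurable) hf.1 t1).exists_seq_tendsto_ae
  exact ⟨fun n => φ (ns n), fun n => hφ _, t1.comp hns.tendsto_atTop, t2.comp hns.tendsto_atTop, hae⟩

end


/-! ### Chain rule and truncation. -/

theorem locallyIntegrable_norm {F : Type*} [NormedAddCommGroup F] {f : E3 → F}
    (hf : LocallyIntegrable f volume) : LocallyIntegrable (fun x => ‖f x‖) volume :=
  hf.mono hf.aestronglyMeasurable.norm (Eventually.of_forall fun _ => (norm_norm _).le)

namespace HasWeakGradient

variable {γ : ℝ} {f : E3 → ℝ} {G : E3 → E3}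

/-- Chain rule for `C¹` functions with bounded derivative. -/
theorem comp_of_hasDerivAt (h : HasWeakGradient f G) (hf : MemLp f 2 (mMeasure γ))
    (hG : MemLp G 2 (mMeasure γ)) {F F' : ℝ → ℝ} (hF : ∀ t, HasDerivAt F (F' t) t)
    (hF' : Continuous F') {C : ℝ} (hC : ∀ t, |F' t| ≤ C) :
    HasWeakGradient (fun x => F (f x)) (fun x => F' (f x) • G x) := by
  obtain ⟨φ, hφ, h1, h2, h3⟩ := h.exists_smooth_seq hf hG
  have hFd : Differentiable ℝ F := fun t => (hF t).differentiableAt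
  have hderiv : deriv F = F' := funext fun t => (hF t).deriv
  have hF1 : ContDiff ℝ 1 F := contDiff_one_iff_deriv.2 ⟨hFd, by rwa [hderiv]⟩
  have hFc : Continuous F := hFd.continuous
  have hLip : ∀ s t, ‖F s - F t‖ ≤ C * ‖s - t‖ := fun s t =>
    convex_univ.norm_image_sub_le_of_norm_hasDerivWithin_le
      (fun t _ => (hF t).hasDerivWithinAt) (fun t _ => hC t) (mem_univ t) (mem_univ s)
  have hw (n : ℕ) : HasWeakGradient (fun x => F (φ n x))
      (fun x => F' (φ n x) • gradient (φ n) x) := by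
    refine (of_contDiff (hF1.comp ((hφ n).1.of_le (by simp)))).congr EventuallyEq.rfl
      (Eventually.of_forall fun x => ?_)
    refine HasGradientAt.gradient ?_
    rw [hasGradientAt_iff_hasFDerivAt]
    have := (hF (φ n x)).comp_hasFDerivAt x ((hφ n).1.differentiable (by simp) x).hasFDerivAt
    rw [map_smul, toDual_gradient]
    exact this
  have hFf : AEStronglyMeasurable (fun x => F (f x)) (mMeasure γ) :=
    hFc.comp_aestronglyMeasurable hf.1
  have hF'G : AEStronglyMeasurable (fun x => F' (f x) • G x) (mMeasure γ) :=
    (hF'.comp_aestronglyMeasurable hf.1).smul hG.1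
  refine of_tendsto_eLpNorm (γ := γ) hw ?_ ?_ ?_ ?_
  · have hb : LocallyIntegrable (fun x => |F 0| + C * ‖f x‖) volume :=
      (locallyIntegrable_const _).add ((locallyIntegrable_norm h.1).smul C)
    refine hb.mono (aestronglyMeasurable_mMeasure_iff.1 hFf) (Eventually.of_forall fun x => ?_)
    refine le_trans ?_ (le_abs_self _)
    have h4 := hLip (f x) 0
    rw [sub_zero] at h4
    calc ‖F (f x)‖ = ‖F 0 + (F (f x) - F 0)‖ := by congr 1; ring
      _ ≤ |F 0| + C * ‖f x‖ := (norm_add_le _ _).trans (add_le_add le_rfl h4)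
  · refine ((locallyIntegrable_norm h.2).smul C).mono (aestronglyMeasurable_mMeasure_iff.1 hF'G)
      (Eventually.of_forall fun x => ?_)
    refine le_trans ?_ (le_abs_self _)
    rw [norm_smul]
    exact mul_le_mul_of_nonneg_right (hC _) (norm_nonneg _)
  · have h4 : Tendsto (fun n => ENNReal.ofReal C * eLpNorm (φ n - f) 2 (mMeasure γ)) atTop (𝓝 0) := by
      simpa using ENNReal.Tendsto.const_mul h1 (Or.inr ENNReal.ofReal_ne_top)
    exact tendsto_of_tendsto_of_tendsto_of_le_of_le tendsto_const_nhds h4 (fun _ => zero_le)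
      fun n => eLpNorm_two_le_of_ae_le_mul (Eventually.of_forall fun x => hLip _ _)
  · have h4 : Tendsto (fun n => ENNReal.ofReal C * eLpNorm (gradient (φ n) - G) 2 (mMeasure γ))
        atTop (𝓝 0) := by
      simpa using ENNReal.Tendsto.const_mul h2 (Or.inr ENNReal.ofReal_ne_top)
    have hF'n (n : ℕ) : Continuous fun x => F' (φ n x) := hF'.comp (hφ n).1.continuous
    have hgn (n : ℕ) : Continuous (gradient (φ n)) := continuous_gradient ((hφ n).1.of_le (by simp))
    have h5 : Tendsto (fun n => eLpNorm ((fun x => F' (φ n x) • G x) - fun x => F' (f x) • G x) 2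
        (mMeasure γ)) atTop (𝓝 0) := by
      refine tendsto_eLpNorm_two_of_dominated (b := fun x => 2 * C * ‖G x‖)
        (fun n => (hF'n n).aestronglyMeasurable.smul hG.1) hF'G (hG.norm.const_mul _)
        (fun n => Eventually.of_forall fun x => ?_) ?_
      · rw [← sub_smul, norm_smul]
        refine mul_le_mul_of_nonneg_right ?_ (norm_nonneg _)
        have := norm_sub_le (F' (φ n x)) (F' (f x))
        have h6 := hC (φ n x)
        have h7 := hC (f x)
        simp only [Real.norm_eq_abs] at *
        linarith
      · filter_upwards [h3] with x hx
        exact ((hF'.tendsto _).comp hx).smul_const _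
    have h6 := h4.add h5
    rw [add_zero] at h6
    refine tendsto_of_tendsto_of_tendsto_of_le_of_le tendsto_const_nhds h6 (fun _ => zero_le)
      fun n => ?_
    -- The first summand is small because `F'` is bounded by `C`, the second by dominated
    -- convergence.
    have e : (fun x => F' (φ n x) • gradient (φ n) x) - (fun x => F' (f x) • G x)
        = (fun x => F' (φ n x) • (gradient (φ n) - G) x) +
          ((fun x => F' (φ n x) • G x) - fun x => F' (f x) • G x) := by
      ext1 x; simp [smul_sub]
    simp only [e]
    refine (eLpNorm_add_le ?_ ?_ (by norm_num)).trans (add_le_add ?_ le_rfl)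
    · exact (hF'n n).aestronglyMeasurable.smul ((hgn n).aestronglyMeasurable.sub hG.1)
    · exact ((hF'n n).aestronglyMeasurable.smul hG.1).sub hF'G
    · refine eLpNorm_two_le_of_ae_le_mul (Eventually.of_forall fun x => ?_)
      rw [norm_smul]
      exact mul_le_mul_of_nonneg_right (hC _) (norm_nonneg _)

end HasWeakGradient

theorem hasDerivAt_sqrt_sq_add (a : ℝ) {ε : ℝ} (hε : 0 < ε) (t : ℝ) :
    HasDerivAt (fun t => √((t - a) ^ 2 + ε ^ 2)) ((t - a) / √((t - a) ^ 2 + ε ^ 2)) t := by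
  have h1 : HasDerivAt (fun t : ℝ => (t - a) ^ 2 + ε ^ 2) (2 * (t - a)) t := by
    simpa using (((hasDerivAt_id t).sub_const a).pow 2).add_const (ε ^ 2)
  have h2 := h1.sqrt (by positivity)
  convert h2 using 1
  field_simp

theorem abs_div_sqrt_sq_add_le_one (s ε : ℝ) : |s / √(s ^ 2 + ε ^ 2)| ≤ 1 := by
  rw [abs_div, abs_of_nonneg (Real.sqrt_nonneg _)]
  refine div_le_one_of_le₀ ?_ (Real.sqrt_nonneg _)
  rw [← Real.sqrt_sq_eq_abs]
  exact Real.sqrt_le_sqrt (by nlinarith [sq_nonneg ε])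

theorem tendsto_div_sqrt_sq_add (s : ℝ) {ε : ℕ → ℝ} (hε : Tendsto ε atTop (𝓝 0)) :
    Tendsto (fun n => s / √(s ^ 2 + ε n ^ 2)) atTop (𝓝 (Real.sign s)) := by
  rcases eq_or_ne s 0 with rfl | hs
  · simp
  · have h1 : Tendsto (fun n => √(s ^ 2 + ε n ^ 2)) atTop (𝓝 |s|) := by
      have := ((hε.pow 2).const_add (s ^ 2)).sqrt
      simpa [Real.sqrt_sq_eq_abs] using this
    have h2 := (tendsto_const_nhds (x := s)).div h1 (abs_ne_zero.2 hs)
    have : s / |s| = Real.sign s := by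
      rcases lt_or_gt_of_ne hs with h | h
      · rw [Real.sign_of_neg h, abs_of_neg h, div_neg, div_self hs]
      · rw [Real.sign_of_pos h, abs_of_pos h, div_self hs]
    rwa [this] at h2

namespace HasWeakGradient

variable {γ : ℝ} {f : E3 → ℝ} {G : E3 → E3}

/-- The functions `√((t - a)² + ε²)` have derivatives bounded by 1 that converge at every point to
the sign of `t - a`. At `t = a` all these derivatives vanish, in agreement with the convention
`Real.sign 0 = 0`, so level sets need no separate argument. -/
theorem abs_sub_const (h : HasWeakGradient f G) (hf : MemLp f 2 (mMeasure γ))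
    (hG : MemLp G 2 (mMeasure γ)) (a : ℝ) :
    HasWeakGradient (fun x => |f x - a|) (fun x => Real.sign (f x - a) • G x) := by
  set ε : ℕ → ℝ := fun n => 1 / ((n : ℝ) + 1) with hε
  have hεpos (n : ℕ) : 0 < ε n := by rw [hε]; positivity
  have hε1 (n : ℕ) : ε n ≤ 1 := by
    rw [hε]; exact div_le_one_of_le₀ (by linarith [(n.cast_nonneg : (0 : ℝ) ≤ n)]) (by positivity)
  have hlim : Tendsto ε atTop (𝓝 0) := tendsto_one_div_add_atTop_nhds_zero_nat
  refine of_dominated (b := fun x => ‖f x‖ + (|a| + 1)) (c := fun x => ‖G x‖)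
    (fun n => h.comp_of_hasDerivAt hf hG (hasDerivAt_sqrt_sq_add a (hεpos n)) ?_
      (fun t => abs_div_sqrt_sq_add_le_one (t - a) (ε n)))
    ((locallyIntegrable_norm h.1).add (locallyIntegrable_const _)) (locallyIntegrable_norm h.2) (fun n => Eventually.of_forall fun x => ?_)
    (fun n => Eventually.of_forall fun x => ?_) (Eventually.of_forall fun x => ?_)
    (Eventually.of_forall fun x => ?_)
  · have : ∀ t : ℝ, √((t - a) ^ 2 + ε n ^ 2) ≠ 0 := fun t =>
      (Real.sqrt_pos.2 (by have := hεpos n; positivity)).ne'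
    fun_prop (disch := assumption)
  · rw [Real.norm_of_nonneg (Real.sqrt_nonneg _)]
    have h1 : √((f x - a) ^ 2 + ε n ^ 2) ≤ |f x - a| + ε n := by
      rw [Real.sqrt_le_left (by have := hεpos n; positivity), add_sq, sq_abs]
      have := mul_nonneg (abs_nonneg (f x - a)) (hεpos n).le
      linarith
    have h2 := abs_sub (f x) a
    have h3 := hε1 n
    rw [Real.norm_eq_abs]
    linarith
  · rw [norm_smul]
    exact mul_le_of_le_one_left (norm_nonneg _) (abs_div_sqrt_sq_add_le_one _ _)
  · have := ((hlim.pow 2).const_add ((f x - a) ^ 2)).sqrt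
    simpa [Real.sqrt_sq_eq_abs] using this
  · exact (tendsto_div_sqrt_sq_add (f x - a) hlim).smul_const (G x)

end HasWeakGradient

/-- Reduces the truncation rule to the rule for absolute values. -/
theorem min_max_zero_eq {N : ℝ} (hN : 0 ≤ N) (t : ℝ) :
    min (max 0 t) N = 2⁻¹ * (|t - 0| - |t - N| + N) := by
  rw [sub_zero]
  rcases le_total t 0 with h | h
  · rw [max_eq_left h, min_eq_left hN, abs_of_nonpos h, abs_of_nonpos (by linarith)]; ring
  · rw [max_eq_right h, abs_of_nonneg h]
    rcases le_total t N with h' | h'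
    · rw [min_eq_left h', abs_of_nonpos (by linarith)]; ring
    · rw [min_eq_right h', abs_of_nonneg (by linarith)]; ring

/-- The derivative of the truncation `t ↦ (0 ∨ t) ∧ N`. -/
noncomputable def truncDeriv (N t : ℝ) : ℝ := 2⁻¹ * (Real.sign (t - 0) - Real.sign (t - N))

theorem truncDeriv_mem {N : ℝ} (hN : 0 ≤ N) (t : ℝ) : truncDeriv N t ∈ Icc (0 : ℝ) 1 := by
  have h (s : ℝ) : -1 ≤ Real.sign s ∧ Real.sign s ≤ 1 := by
    rcases Real.sign_apply_eq s with h | h | h <;> rw [h] <;> norm_num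
  have h1 := h t
  have h2 := h (t - N)
  rw [truncDeriv, sub_zero]
  constructor
  · have : Real.sign (t - N) ≤ Real.sign t := by
      rcases lt_trichotomy t 0 with ht | rfl | ht
      · rw [Real.sign_of_neg ht, Real.sign_of_neg (by linarith)]
      · rcases hN.eq_or_lt with rfl | hN
        · simp
        · rw [Real.sign_zero, Real.sign_of_neg (by linarith)]; norm_num
      · rw [Real.sign_of_pos ht]; exact h2.2
    linarith
  · linarith

theorem HasWeakGradient.trunc {γ : ℝ} {f : E3 → ℝ} {G : E3 → E3} (h : HasWeakGradient f G)
    (hf : MemLp f 2 (mMeasure γ)) (hG : MemLp G 2 (mMeasure γ)) {N : ℝ} (hN : 0 ≤ N) :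
    HasWeakGradient (fun x => min (max 0 (f x)) N) (fun x => truncDeriv N (f x) • G x) := by
  have h1 := ((((h.abs_sub_const hf hG 0).sub (h.abs_sub_const hf hG N)).add
    (HasWeakGradient.const N)).const_smul 2⁻¹)
  refine h1.congr (Eventually.of_forall fun x => ?_) (Eventually.of_forall fun x => ?_)
  · simp only [min_max_zero_eq hN]; rfl
  · simp [truncDeriv, mul_smul, sub_smul, smul_sub]


/-! ### The Dirichlet form properties. -/

theorem HasWeakGradient.weakGradient_ae_eq {f : E3 → ℝ} {G : E3 → E3} (h : HasWeakGradient f G) :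
    weakGradient f =ᵐ[volume] G := by
  have hex : ∃ G, HasWeakGradient f G := ⟨G, h⟩
  rw [weakGradient, dif_pos hex]
  exact hex.choose_spec.ae_eq h

namespace distortedForm

variable {γ : ℝ}

theorem ae_volume_of_ae {p : E3 → Prop} (h : ∀ᵐ x ∂(mMeasure γ), p x) : ∀ᵐ x, p x :=
  volume_absolutelyContinuous_mMeasure γ h

/-- A function with a square integrable weak gradient defines an element of the domain. -/
theorem mem_domain_of_ae_eq {u : Lp ℝ 2 (mMeasure γ)} {f : E3 → ℝ} {G : E3 → E3}
    (h : HasWeakGradient f G) (hG : MemLp G 2 (mMeasure γ)) (huf : u =ᵐ[mMeasure γ] f) :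
    u ∈ (distortedForm γ).domain :=
  ⟨G, h.congr (ae_volume_of_ae huf.symm) EventuallyEq.rfl, hG⟩

/-- The form is defined through a chosen gradient of a chosen representative. Uniqueness almost
everywhere allows any explicit representative and gradient to be used instead. -/
theorem form_eq_integral {u v : Lp ℝ 2 (mMeasure γ)} {f g : E3 → ℝ} {G H : E3 → E3}
    (hf : HasWeakGradient f G) (hg : HasWeakGradient g H)
    (hu : u =ᵐ[mMeasure γ] f) (hv : v =ᵐ[mMeasure γ] g) :
    (distortedForm γ).form u v = 1 / 2 * ∫ x, inner ℝ (G x) (H x) ∂(mMeasure γ) := by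
  have h1 := mMeasure_absolutelyContinuous γ
    (hf.congr (ae_volume_of_ae hu.symm) EventuallyEq.rfl).weakGradient_ae_eq
  have h2 := mMeasure_absolutelyContinuous γ
    (hg.congr (ae_volume_of_ae hv.symm) EventuallyEq.rfl).weakGradient_ae_eq
  change 1 / 2 * ∫ x, inner ℝ (weakGradient u x) (weakGradient v x) ∂(mMeasure γ) = _
  congr 1
  refine integral_congr_ae ?_
  filter_upwards [h1, h2] with x hx1 hx2
  rw [hx1, hx2]

theorem form_eq_inner {u v : Lp ℝ 2 (mMeasure γ)} {f g : E3 → ℝ} {G H : E3 → E3}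
    (hf : HasWeakGradient f G) (hg : HasWeakGradient g H)
    (hu : u =ᵐ[mMeasure γ] f) (hv : v =ᵐ[mMeasure γ] g)
    (hG : MemLp G 2 (mMeasure γ)) (hH : MemLp H 2 (mMeasure γ)) :
    (distortedForm γ).form u v = 1 / 2 * inner ℝ hG.toLp hH.toLp := by
  rw [form_eq_integral hf hg hu hv, L2.inner_def]
  congr 1
  refine integral_congr_ae ?_
  filter_upwards [hG.coeFn_toLp, hH.coeFn_toLp] with x hx1 hx2
  rw [hx1, hx2]

theorem formOne_self_eq {u : Lp ℝ 2 (mMeasure γ)} {f : E3 → ℝ} {G : E3 → E3}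
    (hf : HasWeakGradient f G) (hu : u =ᵐ[mMeasure γ] f) (hG : MemLp G 2 (mMeasure γ)) :
    (distortedForm γ).formOne u u = 1 / 2 * ‖hG.toLp‖ ^ 2 + ‖u‖ ^ 2 := by
  rw [L2Form.formOne, form_eq_inner hf hf hu hu hG hG, real_inner_self_eq_norm_sq,
    real_inner_self_eq_norm_sq]

theorem memLp_of_mem {φ : E3 → ℝ} (h : φ ∈ smoothCompactlySupported) :
    MemLp φ 2 (mMeasure γ) :=
  h.1.continuous.memLp_of_hasCompactSupport h.2

theorem memLp_gradient_of_mem {φ : E3 → ℝ} (h : φ ∈ smoothCompactlySupported) :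
    MemLp (gradient φ) 2 (mMeasure γ) :=
  (continuous_gradient (h.1.of_le (by simp))).memLp_of_hasCompactSupport
    (hasCompactSupport_gradient h.2)

theorem hasWeakGradient_of_mem {φ : E3 → ℝ} (h : φ ∈ smoothCompactlySupported) :
    HasWeakGradient φ (gradient φ) :=
  .of_contDiff (h.1.of_le (by simp))

theorem toLp_mem_domain {φ : E3 → ℝ} (h : φ ∈ smoothCompactlySupported) :
    (memLp_of_mem (γ := γ) h).toLp ∈ (distortedForm γ).domain :=
  mem_domain_of_ae_eq (hasWeakGradient_of_mem h) (memLp_gradient_of_mem h) (MemLp.coeFn_toLp _)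

theorem exists_smooth_eLpNorm_sub_lt {f : E3 → ℝ} (hf : MemLp f 2 (mMeasure γ)) {ε : ENNReal}
    (hε : 0 < ε) : ∃ φ ∈ smoothCompactlySupported, eLpNorm (φ - f) 2 (mMeasure γ) < ε := by
  have hε2 : 0 < ε / 2 := ENNReal.half_pos hε.ne'
  obtain ⟨n, hn⟩ := ((tendsto_cutoff_mul hf).eventually (gt_mem_nhds hε2)).exists
  set f' := fun x => cutoff n x * f x with hf'
  have mf' : MemLp (f' - f) 2 (mMeasure γ) :=
    ⟨((contDiff_cutoff n).continuous.aestronglyMeasurable.mul hf.1).sub hf.1,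
      hn.trans_le le_top⟩
  have lf' : MemLp f' 2 (mMeasure γ) := by simpa using mf'.add hf
  obtain ⟨k, hk⟩ := ((tendsto_mollify γ lf').eventually (gt_mem_nhds hε2)).exists
  have hl := locallyIntegrable_of_memLp_mMeasure lf'
  refine ⟨mollify (shrinkingBump k) f', ⟨contDiff_mollify _ hl,
    hasCompactSupport_mollify _ (hasCompactSupport_cutoff n).mul_right⟩, ?_⟩
  have e : mollify (shrinkingBump k) f' - f = (mollify (shrinkingBump k) f' - f') + (f' - f) := by
    abel
  rw [e, ← ENNReal.add_halves ε]
  refine (eLpNorm_add_le ?_ mf'.1 (by norm_num)).trans_lt (ENNReal.add_lt_add hk hn)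
  exact (contDiff_mollify _ hl).continuous.aestronglyMeasurable.sub lf'.1

theorem dense_domain : Dense (distortedForm γ).domain := by
  intro u
  rw [Metric.mem_closure_iff]
  intro ε hε
  obtain ⟨φ, hφ, h⟩ := exists_smooth_eLpNorm_sub_lt (Lp.memLp u) (ENNReal.ofReal_pos.2 hε)
  refine ⟨_, toLp_mem_domain hφ, ?_⟩
  have hu : u = (Lp.memLp u).toLp := (Lp.toLp_coeFn u (Lp.memLp u)).symm
  rw [dist_comm, dist_eq_norm]
  nth_rewrite 1 [hu]
  rw [← MemLp.toLp_sub, Lp.norm_toLp]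
  exact ENNReal.toReal_lt_of_lt_ofReal h

theorem hasWeakGradient_add {u v : Lp ℝ 2 (mMeasure γ)} {G H : E3 → E3}
    (hu : HasWeakGradient u G) (hv : HasWeakGradient v H) : HasWeakGradient (u + v : Lp ℝ 2 _) (G + H) :=
  (hu.add hv).congr (ae_volume_of_ae (Lp.coeFn_add u v).symm) EventuallyEq.rfl

theorem hasWeakGradient_sub {u v : Lp ℝ 2 (mMeasure γ)} {G H : E3 → E3}
    (hu : HasWeakGradient u G) (hv : HasWeakGradient v H) : HasWeakGradient (u - v : Lp ℝ 2 _) (G - H) :=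
  (hu.sub hv).congr (ae_volume_of_ae (Lp.coeFn_sub u v).symm) EventuallyEq.rfl

theorem hasWeakGradient_smul {u : Lp ℝ 2 (mMeasure γ)} {G : E3 → E3} (c : ℝ)
    (hu : HasWeakGradient u G) : HasWeakGradient (c • u : Lp ℝ 2 _) (c • G) :=
  (hu.const_smul c).congr (ae_volume_of_ae (Lp.coeFn_smul c u).symm) EventuallyEq.rfl

/-- The norm of `𝓔₁` is equivalent to the graph norm of the gradient from `L²` to `L²`. Both
components converge, and the weak gradient is closed. -/
theorem complete_domain (u : ℕ → Lp ℝ 2 (mMeasure γ)) (hu : ∀ n, u n ∈ (distortedForm γ).domain)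
    (hc : ∀ ε > 0, ∃ N, ∀ k ≥ N, ∀ l ≥ N, (distortedForm γ).formOne (u k - u l) (u k - u l) < ε) :
    ∃ v ∈ (distortedForm γ).domain,
      Tendsto (fun n => (distortedForm γ).formOne (u n - v) (u n - v)) atTop (𝓝 0) := by
  choose G hw hG using hu
  have key (k l : ℕ) : (distortedForm γ).formOne (u k - u l) (u k - u l)
      = 1 / 2 * ‖(hG k).toLp - (hG l).toLp‖ ^ 2 + ‖u k - u l‖ ^ 2 := by
    rw [formOne_self_eq (hasWeakGradient_sub (hw k) (hw l)) EventuallyEq.rfl ((hG k).sub (hG l)),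
      MemLp.toLp_sub]
  have c1 : CauchySeq u := by
    refine Metric.cauchySeq_iff.2 fun ε hε => ?_
    obtain ⟨N, hN⟩ := hc (ε ^ 2) (by positivity)
    refine ⟨N, fun k hk l hl => ?_⟩
    have h := hN k hk l hl
    rw [key] at h
    rw [dist_eq_norm]
    refine lt_of_pow_lt_pow_left₀ 2 hε.le ?_
    nlinarith [sq_nonneg ‖(hG k).toLp - (hG l).toLp‖]
  have c2 : CauchySeq fun n => (hG n).toLp := by
    refine Metric.cauchySeq_iff.2 fun ε hε => ?_
    -- The gradient part of `𝓔₁` carries the factor `1 / 2`.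
    obtain ⟨N, hN⟩ := hc (ε ^ 2 / 2) (by positivity)
    refine ⟨N, fun k hk l hl => ?_⟩
    have h := hN k hk l hl
    rw [key] at h
    rw [dist_eq_norm]
    refine lt_of_pow_lt_pow_left₀ 2 hε.le ?_
    nlinarith [sq_nonneg ‖u k - u l‖]
  obtain ⟨v, hv⟩ := cauchySeq_tendsto_of_complete c1
  obtain ⟨H, hH⟩ := cauchySeq_tendsto_of_complete c2
  have hvH : HasWeakGradient v H := by
    refine HasWeakGradient.of_tendsto_eLpNorm (γ := γ) hw
      (locallyIntegrable_of_memLp_mMeasure (Lp.memLp v))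
      (locallyIntegrable_of_memLp_mMeasure (Lp.memLp H))
      ((Lp.tendsto_Lp_iff_tendsto_eLpNorm' u v).1 hv) ?_
    refine ((Lp.tendsto_Lp_iff_tendsto_eLpNorm' _ H).1 hH).congr fun n => ?_
    refine eLpNorm_congr_ae ?_
    filter_upwards [(hG n).coeFn_toLp] with x hx
    simp [hx]
  refine ⟨v, ⟨H, hvH, Lp.memLp H⟩, ?_⟩
  have e (n : ℕ) : (distortedForm γ).formOne (u n - v) (u n - v)
      = 1 / 2 * ‖(hG n).toLp - H‖ ^ 2 + ‖u n - v‖ ^ 2 := by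
    rw [formOne_self_eq (hasWeakGradient_sub (hw n) hvH) EventuallyEq.rfl ((hG n).sub (Lp.memLp H)),
      MemLp.toLp_sub (hG n) (Lp.memLp H), Lp.toLp_coeFn]
  simp_rw [e]
  have h1 := ((tendsto_iff_norm_sub_tendsto_zero.1 hH).pow 2).const_mul (1 / 2)
  have h2 := (tendsto_iff_norm_sub_tendsto_zero.1 hv).pow 2
  simpa using h1.add h2

theorem isDirichletForm : (distortedForm γ).IsDirichletForm where
  zero_mem := mem_domain_of_ae_eq (HasWeakGradient.const 0) MemLp.zero (Lp.coeFn_zero ℝ 2 _)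
  add_mem := fun u ⟨_, hu, mu⟩ v ⟨_, hv, mv⟩ => ⟨_, hasWeakGradient_add hu hv, mu.add mv⟩
  smul_mem := fun c u ⟨_, hu, mu⟩ => ⟨_, hasWeakGradient_smul c hu, mu.const_smul c⟩
  dense := dense_domain
  symm u _ v _ := by
    change 1 / 2 * _ = 1 / 2 * _
    simp only [real_inner_comm]
  add_left := fun u ⟨_, hu, mu⟩ v ⟨_, hv, mv⟩ w ⟨_, hw, mw⟩ => by
    rw [form_eq_inner (hasWeakGradient_add hu hv) hw EventuallyEq.rfl EventuallyEq.rfl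
      (mu.add mv) mw, form_eq_inner hu hw EventuallyEq.rfl EventuallyEq.rfl mu mw,
      form_eq_inner hv hw EventuallyEq.rfl EventuallyEq.rfl mv mw, MemLp.toLp_add mu mv, inner_add_left]
    ring
  smul_left := fun c u ⟨_, hu, mu⟩ v ⟨_, hv, mv⟩ => by
    rw [form_eq_inner (hasWeakGradient_smul c hu) hv EventuallyEq.rfl EventuallyEq.rfl
      (mu.const_smul c) mv, form_eq_inner hu hv EventuallyEq.rfl EventuallyEq.rfl mu mv,
      MemLp.toLp_const_smul c mu, real_inner_smul_left]
    ring
  nonneg := fun u ⟨_, hu, mu⟩ => by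
    rw [form_eq_inner hu hu EventuallyEq.rfl EventuallyEq.rfl mu mu]
    exact mul_nonneg (by norm_num) real_inner_self_nonneg
  complete := complete_domain
  markov := fun u ⟨G, hu, mu⟩ v hv => by
    have ht := hu.trunc (Lp.memLp u) mu zero_le_one
    have hb : ∀ x, ‖truncDeriv 1 (u x) • G x‖ ≤ ‖G x‖ := fun x => by
      have h := truncDeriv_mem zero_le_one (u x)
      rw [norm_smul, Real.norm_of_nonneg h.1]
      exact mul_le_of_le_one_left (norm_nonneg _) h.2
    have mt : MemLp (fun x => truncDeriv 1 (u x) • G x) 2 (mMeasure γ) :=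
      mu.mono (ht.2.aestronglyMeasurable.mono_ac (mMeasure_absolutelyContinuous γ))
        (Eventually.of_forall hb)
    refine ⟨mem_domain_of_ae_eq ht mt hv, ?_⟩
    rw [form_eq_inner ht ht hv hv mt mt, form_eq_inner hu hu EventuallyEq.rfl EventuallyEq.rfl mu mu,
      real_inner_self_eq_norm_sq, real_inner_self_eq_norm_sq]
    have h : ‖mt.toLp‖ ≤ ‖mu.toLp‖ := by
      rw [Lp.norm_toLp, Lp.norm_toLp]
      exact ENNReal.toReal_mono mu.2.ne (eLpNorm_mono hb)
    gcongr

/-! ### Regularity and the special standard core. -/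

theorem exists_smooth_uniform_approx {f : E3 → ℝ} (hf : Continuous f) (hc : HasCompactSupport f)
    {ε : ℝ} (hε : 0 < ε) : ∃ φ ∈ smoothCompactlySupported, ∀ x, |f x - φ x| < ε := by
  have hu : UniformContinuous f := hf.uniformContinuous_of_tendsto_cocompact hc.is_zero_at_infty
  obtain ⟨δ, hδ, h⟩ := Metric.uniformContinuous_iff.1 hu (ε / 2) (by positivity)
  obtain ⟨n, hn⟩ := (tendsto_shrinkingBump_rOut.eventually (gt_mem_nhds hδ)).exists
  refine ⟨mollify (shrinkingBump n) f, ⟨contDiff_mollify _ hf.locallyIntegrable,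
    hasCompactSupport_mollify _ hc⟩, fun x => ?_⟩
  rw [← Real.dist_eq, dist_comm]
  refine lt_of_le_of_lt (b := ε / 2) ?_ (by linarith)
  refine ContDiffBump.dist_normed_convolution_le hf.aestronglyMeasurable fun y hy => ?_
  exact (h ((Metric.mem_ball.1 hy).trans hn)).le

theorem isCore : (distortedForm γ).IsCore smoothCompactlySupported where
  continuous φ hφ := hφ.1.continuous
  hasCompactSupport φ hφ := hφ.2
  mem_domain φ hφ := ⟨_, toLp_mem_domain hφ, MemLp.coeFn_toLp _⟩
  dense_uniform f hf hc ε hε := exists_smooth_uniform_approx hf hc hε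
  dense_form := fun u ⟨G, hu, mu⟩ ε hε => by
    -- With `δ ≤ 1` the value of `𝓔₁` is at most `(3/2) δ² ≤ (3/2) δ ≤ (3/4) ε`.
    set δ : ℝ := min 1 (ε / 2) with hδ
    have hδ0 : 0 < δ := by positivity
    have hδ1 : δ ≤ 1 := min_le_left _ _
    have hδ2 : δ ≤ ε / 2 := min_le_right _ _
    obtain ⟨φ, hφ, h1, h2⟩ := hu.exists_smooth_approx (Lp.memLp u) mu (ENNReal.ofReal_pos.2 hδ0)
    refine ⟨φ, hφ, _, toLp_mem_domain hφ, MemLp.coeFn_toLp _, ?_⟩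
    have hw : HasWeakGradient ((memLp_of_mem (γ := γ) hφ).toLp) (gradient φ) :=
      (hasWeakGradient_of_mem hφ).congr (ae_volume_of_ae (MemLp.coeFn_toLp _).symm) EventuallyEq.rfl
    rw [formOne_self_eq (hasWeakGradient_sub hu hw) EventuallyEq.rfl
      (mu.sub (memLp_gradient_of_mem hφ)), Lp.norm_toLp]
    have e1 : ‖u - (memLp_of_mem (γ := γ) hφ).toLp‖ < δ := by
      have hu' : u = (Lp.memLp u).toLp := (Lp.toLp_coeFn u (Lp.memLp u)).symm
      rw [norm_sub_rev]
      nth_rewrite 1 [hu']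
      rw [← MemLp.toLp_sub, Lp.norm_toLp]
      exact ENNReal.toReal_lt_of_lt_ofReal h1
    have e2 : (eLpNorm (G - gradient φ) 2 (mMeasure γ)).toReal < δ := by
      rw [eLpNorm_sub_comm]
      exact ENNReal.toReal_lt_of_lt_ofReal h2
    have e3 : ‖u - (memLp_of_mem (γ := γ) hφ).toLp‖ ^ 2 ≤ δ ^ 2 := by gcongr
    have e4 : (eLpNorm (G - gradient φ) 2 (mMeasure γ)).toReal ^ 2 ≤ δ ^ 2 := by gcongr
    nlinarith

theorem isRegular : (distortedForm γ).IsRegular where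
  finite_on_compacts := inferInstance
  full_support := inferInstance
  exists_core := ⟨_, isCore⟩

end distortedForm

/-- Smooth approximations of the unit contraction. -/
theorem exists_smooth_contraction {ε : ℝ} (hε : 0 < ε) : ∃ T : ℝ → ℝ, ContDiff ℝ ∞ T ∧
    (∀ t ∈ Icc (0 : ℝ) 1, T t = t) ∧ (∀ t, -ε ≤ T t ∧ T t ≤ 1 + ε) ∧
    ∀ s t, s < t → 0 ≤ T t - T s ∧ T t - T s ≤ t - s := by
  -- The contraction is the primitive, from 0, of a bump equal to 1 on `[0, 1]` and zero outside
  -- `[-ε, 1 + ε]`. Since `0 ≤ b ≤ 1` it is nondecreasing and 1-Lipschitz, and it is constant on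
  -- either side of `[-ε, 1 + ε]`.
  let b : ContDiffBump (1 / 2 : ℝ) :=
    { rIn := 1 / 2, rOut := 1 / 2 + ε, rIn_pos := by norm_num, rIn_lt_rOut := by linarith }
  have hbi (s t : ℝ) : IntervalIntegrable b volume s t := b.continuous.intervalIntegrable s t
  set T : ℝ → ℝ := fun t => ∫ r in (0 : ℝ)..t, b r with hT
  have hdiff (s t : ℝ) : T t - T s = ∫ r in s..t, b r :=
    intervalIntegral.integral_interval_sub_left (hbi 0 t) (hbi 0 s)
  have hderiv (t : ℝ) : HasDerivAt T (b t) t :=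
    intervalIntegral.integral_hasDerivAt_right (hbi 0 t)
      (b.continuous.stronglyMeasurableAtFilter _ _) b.continuous.continuousAt
  have h0 : T 0 = 0 := intervalIntegral.integral_same
  have hid : ∀ t ∈ Icc (0 : ℝ) 1, T t = t := by
    intro t ht
    have : ∫ r in (0 : ℝ)..t, b r = ∫ r in (0 : ℝ)..t, (1 : ℝ) := by
      refine intervalIntegral.integral_congr fun r hr => ?_
      rw [uIcc_of_le ht.1] at hr
      refine b.one_of_mem_closedBall ?_
      rw [Real.closedBall_eq_Icc]
      constructor
      · change 1 / 2 - 1 / 2 ≤ r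
        linarith [hr.1]
      · change r ≤ 1 / 2 + 1 / 2
        linarith [hr.2, ht.2]
    rw [hT]
    simp only [this, intervalIntegral.integral_const, smul_eq_mul, sub_zero, mul_one]
  have hmono (s t : ℝ) (hst : s ≤ t) : 0 ≤ T t - T s ∧ T t - T s ≤ t - s := by
    rw [hdiff]
    constructor
    · exact intervalIntegral.integral_nonneg hst fun r _ => b.nonneg
    · have := intervalIntegral.integral_mono_on hst (hbi s t) intervalIntegrable_const
        (fun r _ => b.le_one (x := r))
      simpa using this
  have hzero (s t : ℝ) (h : ∀ r ∈ uIcc s t, b r = 0) : T t = T s := by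
    have : T t - T s = 0 := by
      rw [hdiff, intervalIntegral.integral_congr (g := fun _ => (0 : ℝ)) h]
      simp
    linarith
  refine ⟨T, ?_, hid, fun t => ⟨?_, ?_⟩, fun s t hst => hmono s t hst.le⟩
  · rw [contDiff_infty_iff_deriv]
    refine ⟨fun t => (hderiv t).differentiableAt, ?_⟩
    rw [show deriv T = b from funext fun t => (hderiv t).deriv]
    exact b.contDiff
  · rcases le_total (-ε) t with ht | ht
    · rcases le_total 0 t with h | h
      · linarith [(hmono 0 t h).1]
      · linarith [(hmono t 0 h).2]
    · have : T (-ε) = T t := hzero _ _ fun r hr => by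
        rw [uIcc_of_le ht] at hr
        refine b.zero_of_le_dist ?_
        change 1 / 2 + ε ≤ _
        rw [Real.dist_eq, abs_of_nonpos (by linarith [hr.2])]
        linarith [hr.2]
      linarith [(hmono (-ε) 0 (by linarith)).2]
  · rcases le_total t (1 + ε) with ht | ht
    · rcases le_total t 0 with h | h
      · linarith [(hmono t 0 h).1]
      · linarith [(hmono 0 t h).2]
    · have : T t = T (1 + ε) := hzero _ _ fun r hr => by
        rw [uIcc_of_le ht] at hr
        refine b.zero_of_le_dist ?_
        change 1 / 2 + ε ≤ _
        rw [Real.dist_eq, abs_of_nonneg (by linarith [hr.1])]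
        linarith [hr.1]
      linarith [(hmono 0 (1 + ε) (by linarith)).2]

open scoped Manifold in
theorem exists_smooth_cutoff {K G : Set E3} (hK : IsCompact K) (hG : IsOpen G)
    (hGc : IsCompact (closure G)) (hKG : K ⊆ G) :
    ∃ φ ∈ smoothCompactlySupported, (∀ x, 0 ≤ φ x) ∧ (∀ x ∈ K, φ x = 1) ∧ ∀ x, x ∉ G → φ x = 0 := by
  obtain ⟨φ, h1, h2, h3, h4⟩ := exists_contMDiff_support_eq_eq_one_iff (n := ⊤) 𝓘(ℝ, E3) hG
    hK.isClosed hKG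
  refine ⟨φ, ⟨h1.contDiff, ?_⟩, fun x => (h2 (mem_range_self x)).1, fun x hx => (h4 x).1 hx,
    fun x hx => ?_⟩
  · rwa [HasCompactSupport, tsupport, h3]
  · rwa [← h3, Function.notMem_support] at hx

theorem distortedForm.isSpecialStandardCore {γ : ℝ} :
    (distortedForm γ).IsSpecialStandardCore smoothCompactlySupported where
  isCore := isCore
  add_mem φ hφ χ hχ := ⟨hφ.1.add hχ.1, hφ.2.add hχ.2⟩
  smul_mem c φ hφ := ⟨contDiff_const.smul hφ.1, hφ.2.smul_left⟩
  mul_mem φ hφ χ hχ := ⟨hφ.1.mul hχ.1, hφ.2.mul_right⟩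
  contraction ε hε := by
    obtain ⟨T, h1, h2, h3, h4⟩ := exists_smooth_contraction hε
    exact ⟨T, h2, h3, h4, fun φ hφ =>
      ⟨h1.comp hφ.1, hφ.2.comp_left (h2 0 ⟨le_rfl, zero_le_one⟩)⟩⟩
  cutoff K G hK hG hGc hKG := exists_smooth_cutoff hK hG hGc hKG


/-! ### Resolvents of a general Dirichlet form, and invariant sets. -/

theorem inner_toLp_eq_integral {X : Type*} [MeasurableSpace X] {μ : Measure X} {f : X → ℝ}
    (hf : MemLp f 2 μ) (v : Lp ℝ 2 μ) : inner ℝ hf.toLp v = ∫ x, f x * v x ∂μ := by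
  rw [L2.inner_def]
  refine integral_congr_ae ?_
  filter_upwards [hf.coeFn_toLp] with x hx
  rw [hx]; exact mul_comm _ _

theorem inner_eq_integral_mul {X : Type*} [MeasurableSpace X] {μ : Measure X}
    (u v : Lp ℝ 2 μ) : inner ℝ u v = ∫ x, u x * v x ∂μ := by
  rw [L2.inner_def]
  refine integral_congr_ae (Eventually.of_forall fun x => ?_)
  exact mul_comm _ _

namespace L2Form

variable {X : Type*} [MeasurableSpace X] {μ : Measure X} {Q : L2Form μ}

namespace IsDirichletForm

/-- The domain of a Dirichlet form as a subspace of `L²`. -/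
def domainSubmodule (h : Q.IsDirichletForm) : Submodule ℝ (Lp ℝ 2 μ) where
  carrier := Q.domain
  add_mem' hu hv := h.add_mem _ hu _ hv
  zero_mem' := h.zero_mem
  smul_mem' c _ hu := h.smul_mem c _ hu

/-- The Dirichlet form as a bilinear form on its domain. -/
noncomputable def bilin (h : Q.IsDirichletForm) :
    h.domainSubmodule →ₗ[ℝ] h.domainSubmodule →ₗ[ℝ] ℝ :=
  LinearMap.mk₂ ℝ (fun u v => Q.form u v)
    (fun u v w => h.add_left u u.2 v v.2 w w.2)
    (fun c u v => h.smul_left c u u.2 v v.2)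
    (fun u v w => by
      have h1 := h.add_left v v.2 w w.2 u u.2
      rw [h.symm u u.2 _ (v + w).2, h.symm u u.2 v v.2, h.symm u u.2 w w.2]
      exact h1)
    (fun c u v => by
      have h1 := h.smul_left c v v.2 u u.2
      rw [h.symm u u.2 _ (c • v).2, h.symm u u.2 v v.2]
      exact h1)

theorem sub_mem (h : Q.IsDirichletForm) {u v : Lp ℝ 2 μ} (hu : u ∈ Q.domain)
    (hv : v ∈ Q.domain) : u - v ∈ Q.domain :=
  h.domainSubmodule.sub_mem hu hv

theorem form_sub_left (h : Q.IsDirichletForm) {u v w : Lp ℝ 2 μ} (hu : u ∈ Q.domain)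
    (hv : v ∈ Q.domain) (hw : w ∈ Q.domain) : Q.form (u - v) w = Q.form u w - Q.form v w :=
  h.bilin.map_sub₂ ⟨u, hu⟩ ⟨v, hv⟩ ⟨w, hw⟩

theorem form_sub_right (h : Q.IsDirichletForm) {u v w : Lp ℝ 2 μ} (hu : u ∈ Q.domain)
    (hv : v ∈ Q.domain) (hw : w ∈ Q.domain) : Q.form w (u - v) = Q.form w u - Q.form w v :=
  (h.bilin ⟨w, hw⟩).map_sub ⟨u, hu⟩ ⟨v, hv⟩

theorem norm_sq_le_formOne (h : Q.IsDirichletForm) {u : Lp ℝ 2 μ} (hu : u ∈ Q.domain) :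
    ‖u‖ ^ 2 ≤ Q.formOne u u := by
  rw [formOne, real_inner_self_eq_norm_sq]
  linarith [h.nonneg u hu]

theorem formOne_sub_self (h : Q.IsDirichletForm) {u v : Lp ℝ 2 μ} (hu : u ∈ Q.domain)
    (hv : v ∈ Q.domain) : Q.formOne (u - v) (u - v) =
      Q.formOne u u - 2 * Q.formOne u v + Q.formOne v v := by
  have hd := h.sub_mem hu hv
  have h1 := norm_sub_sq_real u v
  rw [formOne, formOne, formOne, formOne, h.form_sub_left hu hv hd, h.form_sub_right hu hv hu,
    h.form_sub_right hu hv hv, h.symm v hv u hu, real_inner_self_eq_norm_sq, h1,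
    real_inner_self_eq_norm_sq, real_inner_self_eq_norm_sq]
  ring

theorem formOne_self_nonneg (h : Q.IsDirichletForm) {u : Lp ℝ 2 μ} (hu : u ∈ Q.domain) :
    0 ≤ Q.formOne u u :=
  (sq_nonneg _).trans (h.norm_sq_le_formOne hu)

theorem two_mul_formOne_le (h : Q.IsDirichletForm) {u v : Lp ℝ 2 μ} (hu : u ∈ Q.domain)
    (hv : v ∈ Q.domain) : 2 * Q.formOne u v ≤ Q.formOne u u + Q.formOne v v := by
  have h1 := h.formOne_self_nonneg (h.sub_mem hu hv)
  rw [h.formOne_sub_self hu hv] at h1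
  linarith

theorem formOne_sub_self_le (h : Q.IsDirichletForm) {u v : Lp ℝ 2 μ} (hu : u ∈ Q.domain)
    (hv : v ∈ Q.domain) :
    Q.formOne (u - v) (u - v) ≤ 2 * (Q.formOne u u + Q.formOne v v) := by
  have hn := h.smul_mem (-1) v hv
  have h1 := h.two_mul_formOne_le hu hn
  have h2 : Q.form u ((-1 : ℝ) • v) = -Q.form u v := by
    rw [h.symm u hu _ hn, h.smul_left _ v hv u hu, h.symm v hv u hu]; ring
  have h3 : Q.form ((-1 : ℝ) • v) ((-1 : ℝ) • v) = Q.form v v := by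
    rw [h.smul_left _ v hv _ hn, h.symm v hv _ hn, h.smul_left _ v hv v hv]; ring
  rw [h.formOne_sub_self hu hv]
  simp only [formOne, h2, h3, inner_smul_left, inner_smul_right] at *
  simp only [conj_trivial] at h1
  linarith

/-- The domain of a Dirichlet form, to be equipped with the norm of `𝓔_α`. -/
def FormSpace (h : Q.IsDirichletForm) : Type _ := h.domainSubmodule

noncomputable instance (h : Q.IsDirichletForm) : AddCommGroup h.FormSpace :=
  inferInstanceAs (AddCommGroup h.domainSubmodule)

noncomputable instance (h : Q.IsDirichletForm) : Module ℝ h.FormSpace :=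
  inferInstanceAs (Module ℝ h.domainSubmodule)

/-- The inclusion of the domain into `L²`. -/
def incl (h : Q.IsDirichletForm) : h.FormSpace →ₗ[ℝ] Lp ℝ 2 μ := h.domainSubmodule.subtype

/-- An element of the domain, as an element of `FormSpace`. -/
def toFormSpace (h : Q.IsDirichletForm) (v : Lp ℝ 2 μ) (hv : v ∈ Q.domain) : h.FormSpace :=
  (⟨v, hv⟩ : h.domainSubmodule)

theorem incl_toFormSpace (h : Q.IsDirichletForm) {v : Lp ℝ 2 μ} (hv : v ∈ Q.domain) :
    h.incl (h.toFormSpace v hv) = v := rfl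

theorem incl_mem (h : Q.IsDirichletForm) (x : h.FormSpace) : h.incl x ∈ Q.domain := x.2

/-- The inner product `𝓔_α(u, v) = 𝓔(u, v) + α (u, v)` on the domain. -/
@[reducible] noncomputable def formCore (h : Q.IsDirichletForm) {α : ℝ} (hα : 0 < α) :
    InnerProductSpace.Core ℝ h.FormSpace where
  inner x y := Q.form (h.incl x) (h.incl y) + α * inner ℝ (h.incl x) (h.incl y)
  conj_inner_symm x y := by
    simp only [conj_trivial]
    rw [h.symm _ (h.incl_mem x) _ (h.incl_mem y), real_inner_comm]
  re_inner_nonneg x := by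
    have := h.nonneg _ (h.incl_mem x)
    have := real_inner_self_nonneg (x := h.incl x)
    simp only [RCLike.re_to_real]
    positivity
  add_left x y z := by
    rw [map_add, h.add_left _ (h.incl_mem x) _ (h.incl_mem y) _ (h.incl_mem z), inner_add_left]
    ring
  smul_left x y c := by
    rw [map_smul, h.smul_left _ _ (h.incl_mem x) _ (h.incl_mem y), real_inner_smul_left]
    simp only [conj_trivial]
    ring
  definite x hx := by
    have h1 := h.nonneg _ (h.incl_mem x)
    have h2 := real_inner_self_nonneg (x := h.incl x)
    have h3 : inner ℝ (h.incl x) (h.incl x) = 0 := by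
      have : 0 ≤ α * inner ℝ (h.incl x) (h.incl x) := by positivity
      have h4 : α * inner ℝ (h.incl x) (h.incl x) = 0 := by linarith
      exact (mul_eq_zero.1 h4).resolve_left hα.ne'
    exact Subtype.ext (inner_self_eq_zero.1 h3)

/-- The form norm is complete, and the embedding into `L²` is bounded: so its adjoint is the
resolvent, with dense range. -/
theorem exists_resolvent_aux (h : Q.IsDirichletForm) {α : ℝ} (hα : 0 < α) :
    (∀ F : Lp ℝ 2 μ, ∃ u ∈ Q.domain, ∀ v ∈ Q.domain,
      Q.form u v + α * inner ℝ u v = inner ℝ F v) ∧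
    ∀ w ∈ Q.domain, ∀ ε > 0, ∃ F : Lp ℝ 2 μ, ∃ u ∈ Q.domain, (∀ v ∈ Q.domain,
      Q.form u v + α * inner ℝ u v = inner ℝ F v) ∧
      Q.form (w - u) (w - u) + α * inner ℝ (w - u) (w - u) < ε := by
  let _ : NormedAddCommGroup h.FormSpace := (h.formCore hα).toNormedAddCommGroup
  let _ : InnerProductSpace ℝ h.FormSpace := InnerProductSpace.ofCore (h.formCore hα).toCore
  have hin (x y : h.FormSpace) : inner ℝ x y =
      Q.form (h.incl x) (h.incl y) + α * inner ℝ (h.incl x) (h.incl y) := rfl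
  have hnorm (x : h.FormSpace) : ‖x‖ ^ 2 =
      Q.form (h.incl x) (h.incl x) + α * ‖h.incl x‖ ^ 2 := by
    rw [← real_inner_self_eq_norm_sq x, hin, real_inner_self_eq_norm_sq]
  have hone (x : h.FormSpace) : Q.formOne (h.incl x) (h.incl x) =
      Q.form (h.incl x) (h.incl x) + ‖h.incl x‖ ^ 2 := by
    rw [formOne, real_inner_self_eq_norm_sq]
  -- The forms `𝓔_α` and `𝓔₁` dominate each other, with factors `1 + α` and `1 + α⁻¹`, so
  -- completeness under `𝓔₁` transfers.
  have hcomp : CompleteSpace h.FormSpace := by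
    refine Metric.complete_of_cauchySeq_tendsto fun x hx => ?_
    have hle (y : h.FormSpace) :
        Q.formOne (h.incl y) (h.incl y) ≤ (1 + α⁻¹) * ‖y‖ ^ 2 := by
      rw [hone, hnorm]
      have h1 := h.nonneg _ (h.incl_mem y)
      have h2 : 0 ≤ α⁻¹ := by positivity
      have h3 : 0 ≤ ‖h.incl y‖ ^ 2 := by positivity
      have h4 : (1 + α⁻¹) * (Q.form (h.incl y) (h.incl y) + α * ‖h.incl y‖ ^ 2)
          = Q.form (h.incl y) (h.incl y) + α⁻¹ * Q.form (h.incl y) (h.incl y)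
            + α * ‖h.incl y‖ ^ 2 + ‖h.incl y‖ ^ 2 := by
        field_simp; ring
      rw [h4]
      have := mul_nonneg h2 h1
      have := mul_nonneg hα.le h3
      linarith
    obtain ⟨v, hv, hlim⟩ := h.complete (fun n => h.incl (x n)) (fun n => h.incl_mem _) (by
      intro ε hε
      obtain ⟨N, hN⟩ := Metric.cauchySeq_iff.1 hx (√(ε / (1 + α⁻¹)))
        (Real.sqrt_pos.2 (by positivity))
      refine ⟨N, fun k hk l hl => ?_⟩
      have h1 := hN k hk l hl
      rw [dist_eq_norm, Real.lt_sqrt (norm_nonneg _), lt_div_iff₀ (by positivity)] at h1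
      rw [← map_sub]
      refine (hle _).trans_lt ?_
      rw [mul_comm]
      exact h1)
    refine ⟨h.toFormSpace v hv, ?_⟩
    rw [tendsto_iff_norm_sub_tendsto_zero]
    have hlim2 : Tendsto (fun n => √((1 + α) * Q.formOne (h.incl (x n) - v) (h.incl (x n) - v)))
        atTop (𝓝 0) := by
      simpa using (hlim.const_mul (1 + α)).sqrt
    refine squeeze_zero (fun _ => norm_nonneg _) (fun n => ?_) hlim2
    refine Real.le_sqrt_of_sq_le ?_
    set y : h.FormSpace := x n - h.toFormSpace v hv with hy
    have e : h.incl (x n) - v = h.incl y := by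
      rw [hy, map_sub, h.incl_toFormSpace hv]
    rw [e, hone, hnorm]
    have h1 := h.nonneg _ (h.incl_mem y)
    have h3 : 0 ≤ ‖h.incl y‖ ^ 2 := by positivity
    nlinarith [mul_nonneg hα.le h1]
  let J : h.FormSpace →L[ℝ] Lp ℝ 2 μ := h.incl.mkContinuous (√(α⁻¹)) (fun x => by
    rw [← Real.sqrt_sq (norm_nonneg (h.incl x)), ← Real.sqrt_sq (norm_nonneg x),
      ← Real.sqrt_mul (by positivity)]
    refine Real.sqrt_le_sqrt ?_
    rw [hnorm, mul_add, inv_mul_cancel_left₀ hα.ne']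
    have h1 := h.nonneg _ (h.incl_mem x)
    have : 0 ≤ α⁻¹ * Q.form (h.incl x) (h.incl x) := by positivity
    linarith)
  have hJ (x : h.FormSpace) : J x = h.incl x := rfl
  -- The adjoint relation `𝓔_α(J* F, v) = (F, J v)` is exactly the resolvent equation.
  have hadj (F : Lp ℝ 2 μ) (v : Lp ℝ 2 μ) (hv : v ∈ Q.domain) :
      Q.form (h.incl (J.adjoint F)) v + α * inner ℝ (h.incl (J.adjoint F)) v = inner ℝ F v :=
    J.adjoint_inner_left (h.toFormSpace v hv) F
  refine ⟨fun F => ⟨_, h.incl_mem (J.adjoint F), hadj F⟩, fun w hw ε hε => ?_⟩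
  -- The orthogonal complement of the range of `J*` is the kernel of the injective map `J`.
  have hdense : Dense (range J.adjoint) := by
    have h1 : (LinearMap.range J.adjoint.toLinearMap)ᗮ = ⊥ := by
      rw [ContinuousLinearMap.orthogonal_range, ContinuousLinearMap.adjoint_adjoint,
        LinearMap.ker_eq_bot]
      exact fun x y hxy => Subtype.ext hxy
    have h2 := (Submodule.topologicalClosure_eq_top_iff).2 h1
    have h3 := Submodule.dense_iff_topologicalClosure_eq_top.2 h2
    exact h3
  obtain ⟨_, hF, F, rfl⟩ := Metric.dense_iff.1 hdense (h.toFormSpace w hw) (√ε) (Real.sqrt_pos.2 hε)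
  refine ⟨F, _, h.incl_mem (J.adjoint F), hadj F, ?_⟩
  rw [Metric.mem_ball, dist_comm, dist_eq_norm, Real.lt_sqrt (norm_nonneg _),
    ← real_inner_self_eq_norm_sq, hin, map_sub, h.incl_toFormSpace hw] at hF
  exact hF

theorem exists_isResolventOf (h : Q.IsDirichletForm) {α : ℝ} (hα : 0 < α) {f : X → ℝ}
    (hf : MemLp f 2 μ) : ∃ u, Q.IsResolventOf α f u := by
  obtain ⟨u, hu, hv⟩ := (h.exists_resolvent_aux hα).1 hf.toLp
  exact ⟨u, hu, fun v hvd => by rw [hv v hvd, inner_toLp_eq_integral]⟩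

theorem isResolventOf_resolvent (h : Q.IsDirichletForm) {α : ℝ} (hα : 0 < α) {f : X → ℝ}
    (hf : MemLp f 2 μ) : Q.IsResolventOf α f (Q.resolvent α f) := by
  have hex := h.exists_isResolventOf hα hf
  rw [resolvent, dif_pos hex]
  exact hex.choose_spec

theorem eq_of_isResolventOf (h : Q.IsDirichletForm) {α : ℝ} (hα : 0 < α) {f : X → ℝ}
    {u v : Lp ℝ 2 μ} (hu : Q.IsResolventOf α f u) (hv : Q.IsResolventOf α f v) : u = v := by
  have hd := h.sub_mem hu.1 hv.1
  have h1 := hu.2 _ hd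
  have h2 := hv.2 _ hd
  have h3 : Q.form (u - v) (u - v) + α * inner ℝ (u - v) (u - v) = 0 := by
    rw [h.form_sub_left hu.1 hv.1 hd, inner_sub_left]
    linarith
  have h4 := h.nonneg _ hd
  have h5 := real_inner_self_nonneg (x := u - v)
  have h6 : α * inner ℝ (u - v) (u - v) = 0 := by
    have := mul_nonneg hα.le h5
    linarith
  exact sub_eq_zero.1 (inner_self_eq_zero.1 ((mul_eq_zero.1 h6).resolve_left hα.ne'))

/-- The range of the resolvent is dense in the domain. -/
theorem exists_resolvent_approx (h : Q.IsDirichletForm) {w : Lp ℝ 2 μ} (hw : w ∈ Q.domain)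
    {ε : ℝ} (hε : 0 < ε) : ∃ f : X → ℝ, MemLp f 2 μ ∧
      Q.formOne (w - Q.resolvent 1 f) (w - Q.resolvent 1 f) < ε := by
  obtain ⟨F, u, hu, h1, h2⟩ := (h.exists_resolvent_aux one_pos).2 w hw ε hε
  refine ⟨F, Lp.memLp F, ?_⟩
  have h3 : Q.IsResolventOf 1 F u := ⟨hu, fun v hv => by rw [h1 v hv, inner_eq_integral_mul]⟩
  rw [← h.eq_of_isResolventOf one_pos h3 (h.isResolventOf_resolvent one_pos (Lp.memLp F)), formOne]
  simpa using h2

/-- Multiplication by the indicator of an invariant set preserves the domain. -/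
theorem indicator_mem_domain (h : Q.IsDirichletForm) {A : Set X} (hA : MeasurableSet A)
    (hinv : Q.IsInvariant A) {u : Lp ℝ 2 μ} (hu : u ∈ Q.domain) :
    ∃ w ∈ Q.domain, w =ᵐ[μ] A.indicator u := by
  choose f hf hfu using fun n : ℕ => h.exists_resolvent_approx hu
    (ε := 1 / ((n : ℝ) + 1)) (by positivity)
  set r : ℕ → Lp ℝ 2 μ := fun n => Q.resolvent 1 (f n) with hr
  set s : ℕ → Lp ℝ 2 μ := fun n => Q.resolvent 1 (A.indicator (f n)) with hs
  have hrs (n : ℕ) : Q.IsResolventOf 1 (f n) (r n) := h.isResolventOf_resolvent one_pos (hf n)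
  have hss (n : ℕ) : Q.IsResolventOf 1 (A.indicator (f n)) (s n) :=
    h.isResolventOf_resolvent one_pos ((hf n).indicator hA)
  have hae (n : ℕ) : s n =ᵐ[μ] A.indicator (r n) := hinv 1 one_pos (f n) (hf n)
  -- On the range of the resolvent, multiplication by `1_A` contracts `𝓔₁`. With `r = G₁ f` and `s =
  -- 1_A r = G₁ (1_A f)`, the function `s` vanishes off `A`, so `𝓔₁(s, s) = (1_A f, s) = (f, s) =
  -- 𝓔₁(r, s) ≤ (𝓔₁(r, r) + 𝓔₁(s, s)) / 2`. The same holds for differences.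
  have key (n k : ℕ) : Q.formOne (s n - s k) (s n - s k) ≤ Q.formOne (r n - r k) (r n - r k) := by
    have hsd := h.sub_mem (hss n).1 (hss k).1
    have hrd := h.sub_mem (hrs n).1 (hrs k).1
    have e1 (i : ℕ) : ∫ x, A.indicator (f i) x * (s n - s k : Lp ℝ 2 μ) x ∂μ
        = ∫ x, f i x * (s n - s k : Lp ℝ 2 μ) x ∂μ := by
      refine integral_congr_ae ?_
      filter_upwards [hae n, hae k, Lp.coeFn_sub (s n) (s k)] with x h1 h2 h3
      rw [h3, Pi.sub_apply, h1, h2]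
      by_cases hx : x ∈ A <;> simp [hx]
    have e2 : Q.formOne (s n - s k) (s n - s k) =
        Q.form (r n - r k) (s n - s k) + inner ℝ (r n - r k) (s n - s k) := by
      rw [formOne, h.form_sub_left (hss n).1 (hss k).1 hsd,
        h.form_sub_left (hrs n).1 (hrs k).1 hsd, inner_sub_left, inner_sub_left]
      have a1 := (hss n).2 _ hsd
      have a2 := (hss k).2 _ hsd
      have a3 := (hrs n).2 _ hsd
      have a4 := (hrs k).2 _ hsd
      rw [e1] at a1 a2
      linarith
    have e3 := h.two_mul_formOne_le hrd hsd
    rw [← formOne] at e2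
    linarith
  have hcauchy : ∀ ε > 0, ∃ N, ∀ k ≥ N, ∀ l ≥ N, Q.formOne (s k - s l) (s k - s l) < ε := by
    intro ε hε
    obtain ⟨N, hN⟩ := exists_nat_one_div_lt (show 0 < ε / 4 by positivity)
    refine ⟨N, fun k hk l hl => (key k l).trans_lt ?_⟩
    have b (i : ℕ) (hi : i ≥ N) : Q.formOne (u - r i) (u - r i) < ε / 4 := by
      refine (hfu i).trans (lt_of_le_of_lt ?_ hN)
      gcongr
    have hk' := b k hk
    have hl' := b l hl
    have d1 := h.sub_mem hu (hrs k).1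
    have d2 := h.sub_mem hu (hrs l).1
    have e1 : r k - r l = (u - r l) - (u - r k) := by abel
    have e2 := h.formOne_sub_self_le d2 d1
    rw [e1]
    linarith
  obtain ⟨w, hw, hlim⟩ := h.complete s (fun n => (hss n).1) hcauchy
  -- The limit in the form norm is also the limit in `L²`, where multiplication by `1_A` is
  -- contractive; this identifies it with `1_A u`.
  refine ⟨w, hw, ?_⟩
  set iu : Lp ℝ 2 μ := ((Lp.memLp u).indicator hA).toLp with hiu
  have t1 : Tendsto s atTop (𝓝 w) := by
    rw [tendsto_iff_norm_sub_tendsto_zero]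
    have h0 := hlim.sqrt
    rw [Real.sqrt_zero] at h0
    exact squeeze_zero (fun _ => norm_nonneg _) (fun n =>
      Real.le_sqrt_of_sq_le (h.norm_sq_le_formOne (h.sub_mem (hss n).1 hw))) h0
  have t2 : Tendsto s atTop (𝓝 iu) := by
    rw [tendsto_iff_norm_sub_tendsto_zero]
    have h0 := (tendsto_one_div_add_atTop_nhds_zero_nat (𝕜 := ℝ)).sqrt
    rw [Real.sqrt_zero] at h0
    refine squeeze_zero (fun _ => norm_nonneg _) (fun n => ?_) h0
    have h1 : ‖s n - iu‖ ≤ ‖u - r n‖ := by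
      refine Lp.norm_le_norm_of_ae_le ?_
      filter_upwards [hae n, Lp.coeFn_sub (s n) iu, Lp.coeFn_sub u (r n),
        ((Lp.memLp u).indicator hA).coeFn_toLp] with x h1 h2 h3 h4
      rw [h2, h3, Pi.sub_apply, Pi.sub_apply, h1, h4]
      by_cases hx : x ∈ A
      · simp only [hx, indicator_of_mem]
        exact (norm_sub_rev _ _).le
      · simp [hx]
    refine h1.trans (Real.le_sqrt_of_sq_le ?_)
    exact (h.norm_sq_le_formOne (h.sub_mem hu (hrs n).1)).trans (hfu n).le
  rw [tendsto_nhds_unique t1 t2]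
  exact MemLp.coeFn_toLp _

end IsDirichletForm

end L2Form


/-! ### Order properties of the resolvent, and irreducibility. -/

/-- The mollifications have zero classical gradient, hence are constant, and they converge to `s`
almost everywhere. -/
theorem HasWeakGradient.ae_eq_const {s : E3 → ℝ} (h : HasWeakGradient s 0) :
    ∃ c : ℝ, s =ᵐ[volume] fun _ => c := by
  have h1 : ∀ n x, mollify (shrinkingBump n) s x = mollify (shrinkingBump n) s 0 := by
    intro n x
    refine is_const_of_fderiv_eq_zero (𝕜 := ℝ)
      ((contDiff_mollify _ h.1).differentiable (by simp)) (fun y => ?_) x 0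
    rw [← toDual_gradient, h.gradient_mollify, mollify_apply]
    simp
  have h2 : ∀ᵐ x, Tendsto (fun n => mollify (shrinkingBump n) s 0) atTop (𝓝 (s x)) := by
    have := ContDiffBump.ae_convolution_tendsto_right_of_locallyIntegrable (K := 2)
      tendsto_shrinkingBump_rOut (Eventually.of_forall shrinkingBump_rOut_le) h.1
    filter_upwards [this] with x hx
    exact hx.congr fun n => h1 n x
  obtain ⟨x0, hx0⟩ := h2.exists
  refine ⟨s x0, ?_⟩
  filter_upwards [h2] with x hx
  exact tendsto_nhds_unique hx hx0

namespace distortedForm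

variable {γ : ℝ}

/-- Weak minimum principle, tested with `v = |u| - u`, twice the negative part. Its gradient is
`(sign u - 1) ∇u`, so `𝓔(u, v) ≤ 0` and therefore `(u, v) ≥ 0`. But `u v ≤ 0` pointwise, so `u v =
0` almost everywhere and the negative part vanishes. -/
theorem nonneg_of_forall_nonneg {α : ℝ} (hα : 0 < α) {u : Lp ℝ 2 (mMeasure γ)}
    (hu : u ∈ (distortedForm γ).domain)
    (h : ∀ v ∈ (distortedForm γ).domain, 0 ≤ᵐ[mMeasure γ] v →
      0 ≤ (distortedForm γ).form u v + α * inner ℝ u v) : 0 ≤ᵐ[mMeasure γ] u := by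
  obtain ⟨G, hw, mG⟩ := hu
  have mu := Lp.memLp u
  have ha := (hw.abs_sub_const mu mG 0).sub hw
  have mv : MemLp ((fun x => |u x - 0|) - (u : E3 → ℝ)) 2 (mMeasure γ) := by
    simpa using mu.norm.sub mu
  have hs (s : ℝ) : |Real.sign s| ≤ 1 ∧ Real.sign s ≤ 1 := by
    rcases Real.sign_apply_eq s with h | h | h <;> rw [h] <;> norm_num
  have mH : MemLp ((fun x => Real.sign (u x - 0) • G x) - G) 2 (mMeasure γ) := by
    refine MemLp.sub (mG.mono ((hw.abs_sub_const mu mG 0).2.aestronglyMeasurable.mono_ac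
      (mMeasure_absolutelyContinuous γ)) (Eventually.of_forall fun x => ?_)) mG
    rw [norm_smul]
    exact mul_le_of_le_one_left (norm_nonneg _) (hs _).1
  have hv0 : 0 ≤ᵐ[mMeasure γ] mv.toLp := by
    filter_upwards [mv.coeFn_toLp] with x hx
    rw [hx]
    simp [le_abs_self]
  have h1 := h _ (mem_domain_of_ae_eq ha mH mv.coeFn_toLp) hv0
  rw [form_eq_integral hw ha EventuallyEq.rfl mv.coeFn_toLp] at h1
  have h2 : ∫ x, inner ℝ (G x) (((fun x => Real.sign (u x - 0) • G x) - G) x) ∂(mMeasure γ) ≤ 0 := by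
    refine integral_nonpos fun x => ?_
    simp only [Pi.sub_apply, inner_sub_right, real_inner_smul_right]
    have h3 : 0 ≤ inner ℝ (G x) (G x) := real_inner_self_nonneg
    have h4 := (hs (u x - 0)).2
    change _ ≤ (0 : ℝ)
    nlinarith
  have h3 : 0 ≤ ∫ x, u x * (|u x| - u x) ∂(mMeasure γ) := by
    have h4 : inner ℝ u mv.toLp = ∫ x, u x * (|u x| - u x) ∂(mMeasure γ) := by
      rw [inner_eq_integral_mul]
      refine integral_congr_ae ?_
      filter_upwards [mv.coeFn_toLp] with x hx
      rw [hx]; simp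
    rw [← h4]
    by_contra hneg
    push Not at hneg
    nlinarith [mul_pos_of_neg_of_neg (neg_lt_zero.2 hα) hneg]
  have h5 : Integrable (fun x => -(u x * (|u x| - u x))) (mMeasure γ) :=
    (mu.integrable_mul (mu.abs.sub mu)).neg
  have h6 : ∀ x, 0 ≤ -(u x * (|u x| - u x)) := by
    intro x
    rcases le_total 0 (u x) with hx | hx
    · simp [abs_of_nonneg hx]
    · rw [abs_of_nonpos hx]; nlinarith
  have h7 : ∫ x, -(u x * (|u x| - u x)) ∂(mMeasure γ) = 0 := by
    refine le_antisymm ?_ (integral_nonneg h6)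
    rw [integral_neg]; linarith
  filter_upwards [(integral_eq_zero_iff_of_nonneg h6 h5).1 h7] with x hx
  by_contra hneg
  simp only [Pi.zero_apply, not_le] at hneg
  rw [Pi.zero_apply, abs_of_neg hneg] at hx
  nlinarith [mul_pos_of_neg_of_neg hneg hneg]

theorem memLp_min_of_integrable {f : E3 → ℝ} (hf : Integrable f (mMeasure γ))
    (h0 : 0 ≤ᵐ[mMeasure γ] f) {k : ℝ} (hk : 0 ≤ k) : MemLp (fun x => min (f x) k) 2 (mMeasure γ) := by
  have hm : AEStronglyMeasurable (fun x => min (f x) k) (mMeasure γ) :=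
    hf.1.inf aestronglyMeasurable_const
  rw [memLp_two_iff_integrable_sq hm]
  refine (hf.const_mul k).mono' (hm.pow 2) ?_
  filter_upwards [h0] with x hx
  have hx : 0 ≤ f x := hx
  have h1 : 0 ≤ min (f x) k := le_min hx hk
  rw [Real.norm_of_nonneg (by positivity), sq]
  exact mul_le_mul (min_le_right _ _) (min_le_left _ _) h1 hk

theorem resolvent_nonneg {α : ℝ} (hα : 0 < α) {f : E3 → ℝ} (hf : MemLp f 2 (mMeasure γ))
    (h0 : 0 ≤ᵐ[mMeasure γ] f) : 0 ≤ᵐ[mMeasure γ] (distortedForm γ).resolvent α f := by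
  have hr := isDirichletForm.isResolventOf_resolvent hα hf
  refine nonneg_of_forall_nonneg hα hr.1 fun v hv hv0 => ?_
  rw [hr.2 v hv]
  refine integral_nonneg_of_ae ?_
  filter_upwards [h0, hv0] with x h1 h2
  exact mul_nonneg h1 h2

theorem resolvent_mono {α : ℝ} (hα : 0 < α) {f g : E3 → ℝ} (hf : MemLp f 2 (mMeasure γ))
    (hg : MemLp g 2 (mMeasure γ)) (h : f ≤ᵐ[mMeasure γ] g) :
    (distortedForm γ).resolvent α f ≤ᵐ[mMeasure γ] (distortedForm γ).resolvent α g := by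
  have hD := isDirichletForm (γ := γ)
  have hrf := hD.isResolventOf_resolvent hα hf
  have hrg := hD.isResolventOf_resolvent hα hg
  have key : 0 ≤ᵐ[mMeasure γ]
      ((distortedForm γ).resolvent α g - (distortedForm γ).resolvent α f : Lp ℝ 2 _) := by
    refine nonneg_of_forall_nonneg hα (hD.sub_mem hrg.1 hrf.1) fun v hv hv0 => ?_
    have h1 := hrf.2 v hv
    have h2 := hrg.2 v hv
    have h3 : ∫ x, f x * v x ∂(mMeasure γ) ≤ ∫ x, g x * v x ∂(mMeasure γ) := by
      refine integral_mono_ae (hf.integrable_mul (Lp.memLp v)) (hg.integrable_mul (Lp.memLp v)) ?_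
      filter_upwards [h, hv0] with x h1 h2
      exact mul_le_mul_of_nonneg_right h1 h2
    rw [hD.form_sub_left hrg.1 hrf.1 hv, inner_sub_left]
    linarith
  filter_upwards [key, Lp.coeFn_sub ((distortedForm γ).resolvent α g)
    ((distortedForm γ).resolvent α f)] with x h1 h2
  rw [h2] at h1
  simpa using h1

/-- The difference `G_α f - G_β f` solves the equation at level `α` with the nonnegative datum `(β -
α) G_β f`. -/
theorem resolvent_anti {α β : ℝ} (hα : 0 < α) (hαβ : α ≤ β) {f : E3 → ℝ}
    (hf : MemLp f 2 (mMeasure γ)) (h0 : 0 ≤ᵐ[mMeasure γ] f) :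
    (distortedForm γ).resolvent β f ≤ᵐ[mMeasure γ] (distortedForm γ).resolvent α f := by
  have hD := isDirichletForm (γ := γ)
  have hβ := hα.trans_le hαβ
  have hra := hD.isResolventOf_resolvent hα hf
  have hrb := hD.isResolventOf_resolvent hβ hf
  have hb0 := resolvent_nonneg hβ hf h0
  have key : 0 ≤ᵐ[mMeasure γ]
      ((distortedForm γ).resolvent α f - (distortedForm γ).resolvent β f : Lp ℝ 2 _) := by
    refine nonneg_of_forall_nonneg hα (hD.sub_mem hra.1 hrb.1) fun v hv hv0 => ?_
    have h1 := hra.2 v hv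
    have h2 := hrb.2 v hv
    have h3 : 0 ≤ inner ℝ ((distortedForm γ).resolvent β f) v := by
      rw [inner_eq_integral_mul]
      refine integral_nonneg_of_ae ?_
      filter_upwards [hb0, hv0] with x h1 h2
      exact mul_nonneg h1 h2
    rw [hD.form_sub_left hra.1 hrb.1 hv, inner_sub_left]
    nlinarith [mul_nonneg (sub_nonneg.2 hαβ) h3]
  filter_upwards [key, Lp.coeFn_sub ((distortedForm γ).resolvent α f)
    ((distortedForm γ).resolvent β f)] with x h1 h2
  rw [h2] at h1
  simpa using h1

theorem exists_cutoff_eq_one {φ : E3 → ℝ} (hφ : HasCompactSupport φ) :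
    ∃ n, ∀ x ∈ tsupport φ, cutoff n x = 1 := by
  obtain ⟨R, hR⟩ := hφ.isCompact.isBounded.subset_ball 0
  refine ⟨⌈R⌉₊, fun x hx => cutoff_eq_one ?_⟩
  have h1 := hR hx
  rw [Metric.mem_ball, dist_zero_right] at h1
  linarith [Nat.le_ceil R]

/-- This function fixes 0 and 1 and has zero derivative at both, so it preserves an indicator while
annihilating its gradient. -/
theorem hasDerivAt_half_one_sub_cos (t : ℝ) :
    HasDerivAt (fun t => (1 - Real.cos (Real.pi * t)) / 2) (Real.pi / 2 * Real.sin (Real.pi * t)) t := by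
  have h1 := ((((hasDerivAt_id t).const_mul Real.pi).cos).const_sub 1).div_const 2
  refine h1.congr_deriv ?_
  rw [id]; ring

theorem hasWeakGradient_indicator_of_isInvariant {A : Set E3} (hA : MeasurableSet A)
    (hinv : (distortedForm γ).IsInvariant A) :
    HasWeakGradient (A.indicator fun _ => (1 : ℝ)) 0 where
  locallyIntegrable := (locallyIntegrable_const (1 : ℝ)).indicator hA
  locallyIntegrable_grad := locallyIntegrable_zero
  integral_eq φ hφ v := by
    obtain ⟨n, hn⟩ := exists_cutoff_eq_one hφ.2
    -- The indicator itself need not lie in `L²(m_γ)`. Its product with a cut-off equal to 1 on the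
    -- support of `φ` does, and agrees with it wherever `φ` is tested.
    obtain ⟨w, ⟨G, hw, mG⟩, hwA⟩ := isDirichletForm.indicator_mem_domain hA hinv
      (toLp_mem_domain (γ := γ) (cutoff_mem n))
    have hF := hw.comp_of_hasDerivAt (Lp.memLp w) mG hasDerivAt_half_one_sub_cos (by fun_prop)
      (C := Real.pi / 2) (fun t => by
        rw [abs_mul, abs_of_pos (by positivity)]
        exact mul_le_of_le_one_right (by positivity) (Real.abs_sin_le_one _))
    have hae : ∀ᵐ x, x ∈ tsupport φ → w x = A.indicator (fun _ => (1 : ℝ)) x := by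
      refine ae_volume_of_ae (γ := γ) ?_
      filter_upwards [hwA, (memLp_of_mem (γ := γ) (cutoff_mem n)).coeFn_toLp] with x h1 h2 hx
      rw [h1]
      by_cases hxA : x ∈ A
      · simp [hxA, h2, hn x hx]
      · simp [hxA]
    have e1 : ∫ x, A.indicator (fun _ => (1 : ℝ)) x * fderiv ℝ φ x v
        = ∫ x, (1 - Real.cos (Real.pi * w x)) / 2 * fderiv ℝ φ x v := by
      refine integral_congr_ae ?_
      filter_upwards [hae] with x hx
      by_cases hxφ : x ∈ tsupport φ
      · rw [hx hxφ]
        by_cases hxA : x ∈ A <;> simp [hxA]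
      · rw [image_eq_zero_of_notMem_tsupport fun h => hxφ (tsupport_fderiv_subset ℝ h)]
        simp
    have e2 : ∫ x, φ x * inner ℝ ((Real.pi / 2 * Real.sin (Real.pi * w x)) • G x) v = 0 := by
      refine integral_eq_zero_of_ae ?_
      filter_upwards [hae] with x hx
      by_cases hxφ : x ∈ tsupport φ
      · rw [hx hxφ]
        by_cases hxA : x ∈ A <;> simp [hxA]
      · simp [image_eq_zero_of_notMem_tsupport hxφ]
    rw [e1, hF.3 φ hφ v, e2]
    simp

theorem isIrreducible : (distortedForm γ).IsIrreducible := by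
  intro A hA hinv
  obtain ⟨c, hc⟩ := (hasWeakGradient_indicator_of_isInvariant hA hinv).ae_eq_const
  have hc' := mMeasure_absolutelyContinuous γ hc
  by_cases h1 : c = 1
  · right
    rw [← mem_ae_iff]
    filter_upwards [hc'] with x hx
    by_contra hxA
    rw [h1, indicator_of_notMem hxA] at hx
    norm_num at hx
  · left
    rw [← compl_compl A, ← mem_ae_iff]
    filter_upwards [hc'] with x hx hxA
    rw [indicator_of_mem hxA] at hx
    exact h1 hx.symm

end distortedForm


/-! ### Recurrence for `γ ≥ 0`. -/

/-- A smooth positive decreasing function that behaves like `1 / (2t)` at infinity. -/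
noncomputable def decay (t : ℝ) : ℝ := √(t ^ 2 + 1) - t

/-- The derivative of `decay`. -/
noncomputable def decayDeriv (t : ℝ) : ℝ := t / √(t ^ 2 + 1) - 1

theorem hasDerivAt_decay (t : ℝ) : HasDerivAt decay (decayDeriv t) t := by
  have h := (hasDerivAt_sqrt_sq_add 0 one_pos t).sub (hasDerivAt_id t)
  simp only [sub_zero, one_pow] at h
  exact h

theorem continuous_decayDeriv : Continuous decayDeriv := by
  have : ∀ t : ℝ, √(t ^ 2 + 1) ≠ 0 := fun t => (Real.sqrt_pos.2 (by positivity)).ne'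
  unfold decayDeriv
  fun_prop (disch := assumption)

theorem sqrt_sq_add_one_gt (t : ℝ) : |t| < √(t ^ 2 + 1) := by
  rw [← Real.sqrt_sq_eq_abs]
  exact Real.sqrt_lt_sqrt (sq_nonneg t) (by linarith)

theorem decay_pos (t : ℝ) : 0 < decay t := by
  have := sqrt_sq_add_one_gt t
  have := le_abs_self t
  unfold decay; linarith

theorem abs_div_sqrt_sq_add_one_le (t : ℝ) : |t / √(t ^ 2 + 1)| ≤ 1 := by
  simpa using abs_div_sqrt_sq_add_le_one t 1

theorem decayDeriv_nonpos (t : ℝ) : decayDeriv t ≤ 0 := by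
  have := (abs_le.1 (abs_div_sqrt_sq_add_one_le t)).2
  unfold decayDeriv; linarith

theorem abs_decayDeriv_le (t : ℝ) : |decayDeriv t| ≤ 2 := by
  have := abs_le.1 (abs_div_sqrt_sq_add_one_le t)
  rw [abs_le]; unfold decayDeriv
  constructor <;> linarith

theorem abs_decayDeriv_le_one {t : ℝ} (ht : 0 ≤ t) : |decayDeriv t| ≤ 1 := by
  have h1 : 0 ≤ t / √(t ^ 2 + 1) := by positivity
  have h2 := decayDeriv_nonpos t
  rw [abs_le]; unfold decayDeriv at *
  constructor <;> linarith

theorem antitone_decay : Antitone decay :=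
  antitone_of_deriv_nonpos (fun t => (hasDerivAt_decay t).differentiableAt)
    fun t => by rw [(hasDerivAt_decay t).deriv]; exact decayDeriv_nonpos t

theorem continuous_decay : Continuous decay :=
  continuous_iff_continuousAt.2 fun t => (hasDerivAt_decay t).continuousAt

theorem decay_mul_add (t : ℝ) : decay t * (√(t ^ 2 + 1) + t) = 1 := by
  have := Real.sq_sqrt (show 0 ≤ t ^ 2 + 1 by positivity)
  unfold decay; nlinarith

theorem decay_le_one {t : ℝ} (ht : 0 ≤ t) : decay t ≤ 1 := by
  have := antitone_decay ht
  simpa [decay] using this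

/-- Bounds the term `α ∫ u χ² F(u)` by `α ∫ χ²`, with no control on the size of `u`. -/
theorem mul_decay_le_one (t : ℝ) : t * decay t ≤ 1 := by
  have h1 := decay_mul_add t
  have h2 := mul_nonneg (decay_pos t).le (Real.sqrt_nonneg (t ^ 2 + 1))
  nlinarith

/-- The inequality that lets the cross term of the Caccioppoli estimate be absorbed; it reduces to
`F(t) √(t² + 1) ≤ 1`. -/
theorem decay_sq_le {t : ℝ} (ht : 0 ≤ t) : decay t ^ 2 ≤ -decayDeriv t := by
  have hs : 0 < √(t ^ 2 + 1) := Real.sqrt_pos.2 (by positivity)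
  have h1 : -decayDeriv t = decay t / √(t ^ 2 + 1) := by
    unfold decay decayDeriv; field_simp; ring
  rw [h1, le_div_iff₀ hs]
  have h2 := decay_mul_add t
  have h3 := mul_nonneg (decay_pos t).le ht
  have h4 : decay t * √(t ^ 2 + 1) ≤ 1 := by nlinarith
  have := decay_pos t
  calc decay t ^ 2 * √(t ^ 2 + 1) = decay t * (decay t * √(t ^ 2 + 1)) := by ring
    _ ≤ decay t * 1 := by gcongr
    _ = decay t := mul_one _

namespace distortedForm

variable {γ : ℝ}

theorem integrable_inner_of_memLp {μ : Measure E3} {G H : E3 → E3} (hG : MemLp G 2 μ)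
    (hH : MemLp H 2 μ) : Integrable (fun x => inner ℝ (G x) (H x)) μ :=
  (hG.norm.integrable_mul hH.norm).mono' (hG.1.inner hH.1)
    (Eventually.of_forall fun x => norm_inner_le_norm (𝕜 := ℝ) (G x) (H x))

/-- A Caccioppoli inequality for the resolvent. -/
theorem caccioppoli {α : ℝ} (hα : 0 < α) {g : E3 → ℝ} {u : Lp ℝ 2 (mMeasure γ)}
    (hu : (distortedForm γ).IsResolventOf α g u) (hu0 : 0 ≤ᵐ[mMeasure γ] u)
    {G : E3 → E3} (hw : HasWeakGradient u G) (mG : MemLp G 2 (mMeasure γ)) {χ : E3 → ℝ}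
    (hχ : χ ∈ smoothCompactlySupported) :
    ∫ x, g x * (χ x ^ 2 * decay (u x)) ∂(mMeasure γ) +
      1 / 4 * ∫ x, χ x ^ 2 * ‖decayDeriv (u x) • G x‖ ^ 2 ∂(mMeasure γ) ≤
      ∫ x, ‖gradient χ x‖ ^ 2 ∂(mMeasure γ) + α * ∫ x, χ x ^ 2 ∂(mMeasure γ) := by
  have mu := Lp.memLp u
  have hF := hw.comp_of_hasDerivAt mu mG hasDerivAt_decay continuous_decayDeriv abs_decayDeriv_le
  have hχ2 : ContDiff ℝ ∞ fun x => χ x ^ 2 := hχ.1.pow 2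
  have hχ2c : HasCompactSupport fun x => χ x ^ 2 :=
    hχ.2.comp_left (g := fun t : ℝ => t ^ 2) (by norm_num)
  have hv := hF.contDiff_mul hχ2
  set H : E3 → E3 := fun x => χ x ^ 2 • decayDeriv (u x) • G x +
    decay (u x) • gradient (fun x => χ x ^ 2) x with hH
  have hgrad (x : E3) : gradient (fun x => χ x ^ 2) x = (2 * χ x) • gradient χ x := by
    refine HasGradientAt.gradient ?_
    rw [hasGradientAt_iff_hasFDerivAt, map_smul, toDual_gradient]
    have := (hχ.1.differentiable (by simp) x).hasFDerivAt.pow 2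
    simpa using this
  obtain ⟨M, hM⟩ := hχ2.continuous.bounded_above_of_compact_support hχ2c
  have mχ2 : MemLp (fun x => χ x ^ 2) 2 (mMeasure γ) := memLp_of_mem ⟨hχ2, hχ2c⟩
  have mχ : MemLp χ 2 (mMeasure γ) := memLp_of_mem hχ
  have mgχ : MemLp (gradient χ) 2 (mMeasure γ) := memLp_gradient_of_mem hχ
  have hdm : AEStronglyMeasurable (fun x => decay (u x)) (mMeasure γ) :=
    continuous_decay.comp_aestronglyMeasurable mu.1
  have hddm : AEStronglyMeasurable (fun x => decayDeriv (u x)) (mMeasure γ) :=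
    continuous_decayDeriv.comp_aestronglyMeasurable mu.1
  have mv : MemLp (fun x => χ x ^ 2 * decay (u x)) 2 (mMeasure γ) := by
    refine mχ2.mono (mχ2.1.mul hdm) ?_
    filter_upwards [hu0] with x hx
    rw [norm_mul, Real.norm_of_nonneg (decay_pos _).le]
    exact mul_le_of_le_one_right (norm_nonneg _) (decay_le_one hx)
  have mK : MemLp (fun x => decayDeriv (u x) • G x) 2 (mMeasure γ) := by
    refine mG.mono (hddm.smul mG.1) ?_
    filter_upwards [hu0] with x hx
    rw [norm_smul]
    exact mul_le_of_le_one_left (norm_nonneg _) (abs_decayDeriv_le_one hx)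
  have mH : MemLp H 2 (mMeasure γ) := by
    refine MemLp.add ?_ ?_
    · refine (mK.const_smul M).mono (mχ2.1.smul mK.1) (Eventually.of_forall fun x => ?_)
      rw [Pi.smul_apply, norm_smul (χ x ^ 2), norm_smul M]
      exact mul_le_mul_of_nonneg_right ((hM x).trans (Real.le_norm_self M)) (norm_nonneg _)
    · refine (memLp_gradient_of_mem (γ := γ) ⟨hχ2, hχ2c⟩).mono
        (hdm.smul (memLp_gradient_of_mem (γ := γ) ⟨hχ2, hχ2c⟩).1) ?_
      filter_upwards [hu0] with x hx
      rw [norm_smul, Real.norm_of_nonneg (decay_pos _).le]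
      exact mul_le_of_le_one_left (norm_nonneg _) (decay_le_one hx)
  -- The resolvent equation tested with `χ² F(u)`.
  have heq := hu.2 _ (mem_domain_of_ae_eq hv mH mv.coeFn_toLp)
  rw [form_eq_integral hw hv EventuallyEq.rfl mv.coeFn_toLp, inner_eq_integral_mul] at heq
  have e1 : ∫ x, u x * (mv.toLp : Lp ℝ 2 (mMeasure γ)) x ∂(mMeasure γ) = ∫ x, u x * (χ x ^ 2 * decay (u x)) ∂(mMeasure γ) := by
    refine integral_congr_ae ?_
    filter_upwards [mv.coeFn_toLp] with x hx
    rw [hx]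
  have e2 : ∫ x, g x * (mv.toLp : Lp ℝ 2 (mMeasure γ)) x ∂(mMeasure γ) = ∫ x, g x * (χ x ^ 2 * decay (u x)) ∂(mMeasure γ) := by
    refine integral_congr_ae ?_
    filter_upwards [mv.coeFn_toLp] with x hx
    rw [hx]
  rw [e1, e2] at heq
  have iχ2 : Integrable (fun x => χ x ^ 2) (mMeasure γ) := mχ.integrable_sq
  have i1 : Integrable (fun x => ‖gradient χ x‖ ^ 2) (mMeasure γ) := mgχ.integrable_norm_pow two_ne_zero
  have i2 : Integrable (fun x => χ x ^ 2 * ‖decayDeriv (u x) • G x‖ ^ 2) (mMeasure γ) :=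
    (mK.integrable_norm_pow two_ne_zero).bdd_mul mχ2.1 (Eventually.of_forall hM)
  have b1 : ∫ x, u x * (χ x ^ 2 * decay (u x)) ∂(mMeasure γ) ≤ ∫ x, χ x ^ 2 ∂(mMeasure γ) := by
    refine integral_mono_ae (mu.integrable_mul mv) iχ2 ?_
    filter_upwards [hu0] with x hx
    calc u x * (χ x ^ 2 * decay (u x)) = χ x ^ 2 * (u x * decay (u x)) := by ring
      _ ≤ χ x ^ 2 * 1 := by gcongr; exact mul_decay_le_one _
      _ = χ x ^ 2 := mul_one _
  have b2 : 1 / 2 * ∫ x, inner ℝ (G x) (H x) ∂(mMeasure γ) ≤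
      ∫ x, (‖gradient χ x‖ ^ 2 - 1 / 4 * (χ x ^ 2 * ‖decayDeriv (u x) • G x‖ ^ 2)) ∂(mMeasure γ) := by
    rw [← integral_const_mul]
    refine integral_mono_ae ((integrable_inner_of_memLp mG mH).const_mul _) (i1.sub (i2.const_mul _)) ?_
    filter_upwards [hu0] with x hx
    have hx : 0 ≤ u x := hx
    have c1 : inner ℝ (G x) (H x) = χ x ^ 2 * decayDeriv (u x) * ‖G x‖ ^ 2 +
        2 * (χ x * decay (u x) * inner ℝ (G x) (gradient χ x)) := by
      rw [hH]
      simp only [inner_add_right, real_inner_smul_right, real_inner_self_eq_norm_sq, hgrad]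
      ring
    have c2 : χ x * decay (u x) * inner ℝ (G x) (gradient χ x) ≤
        |χ x| * decay (u x) * (‖G x‖ * ‖gradient χ x‖) := by
      refine (le_abs_self _).trans ?_
      rw [abs_mul, abs_mul, abs_of_pos (decay_pos _)]
      have := decay_pos (u x)
      gcongr
      exact abs_real_inner_le_norm _ _
    -- Young's inequality, weighted so that half of the good term `(1/2) χ² F'(u) |G|²` absorbs the
    -- cross term through `F² ≤ -F'`. The other half dominates `(1/4) χ² |F'(u) G|²` because `|F'| ≤
    -- 1` on the half-line.
    have c3 : |χ x| * decay (u x) * (‖G x‖ * ‖gradient χ x‖) ≤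
        1 / 4 * (χ x ^ 2 * decay (u x) ^ 2 * ‖G x‖ ^ 2) + ‖gradient χ x‖ ^ 2 := by
      rw [← sq_abs (χ x)]
      nlinarith [sq_nonneg (1 / 2 * (|χ x| * decay (u x) * ‖G x‖) - ‖gradient χ x‖)]
    have c4 : χ x ^ 2 * decay (u x) ^ 2 * ‖G x‖ ^ 2 ≤ χ x ^ 2 * (-decayDeriv (u x)) * ‖G x‖ ^ 2 := by
      gcongr; exact decay_sq_le hx
    have c5 : χ x ^ 2 * ‖decayDeriv (u x) • G x‖ ^ 2 ≤
        χ x ^ 2 * (-decayDeriv (u x)) * ‖G x‖ ^ 2 := by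
      rw [norm_smul, mul_pow, mul_assoc, Real.norm_eq_abs]
      gcongr
      rw [sq, ← abs_of_nonpos (decayDeriv_nonpos (u x))]
      exact mul_le_of_le_one_left (abs_nonneg _) (abs_decayDeriv_le_one hx)
    simp only [c1]
    linarith
  rw [integral_sub i1 (i2.const_mul _), integral_const_mul] at b2
  have b3 := mul_le_mul_of_nonneg_left b1 hα.le
  linarith

/-- For `γ ≥ 0` the exponential factor is at most 1. This is how the sign of `γ` enters the proof of
recurrence. -/
theorem mMeasure_ball_le (hγ : 0 ≤ γ) {R : ℝ} (hR : 0 ≤ R) : mMeasure γ (Metric.ball 0 R) ≤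
    ENNReal.ofReal ((4 * Real.pi ^ 2)⁻¹ * (3 * volume.real (Metric.ball (0 : E3) 1) * R)) := by
  rw [mMeasure, withDensity_apply _ measurableSet_ball, ENNReal.ofReal_mul (by positivity),
    ← setLIntegral_inv_norm_sq hR, ← lintegral_const_mul' _ _ ENNReal.ofReal_ne_top]
  refine lintegral_mono fun x => ?_
  simp only
  rw [← ENNReal.ofReal_mul (by positivity), psi_sq]
  gcongr
  refine mul_le_of_le_one_left (by positivity) (Real.exp_le_one_iff.2 ?_)
  have := mul_nonneg hγ (norm_nonneg x)
  linarith

/-- If `γ ≥ 0`, the cut-off functions have vanishing energy. -/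
theorem tendsto_integral_gradient_cutoff (hγ : 0 ≤ γ) :
    Tendsto (fun n => ∫ x, ‖gradient (cutoff n) x‖ ^ 2 ∂(mMeasure γ)) atTop (𝓝 0) := by
  obtain ⟨M, hM0, hM⟩ := exists_norm_gradient_cutoff_le
  set C : ℝ := (4 * Real.pi ^ 2)⁻¹ * (3 * volume.real (Metric.ball (0 : E3) 1)) with hC
  have hlim : Tendsto (fun n : ℕ => M ^ 2 * (3 * C) * (1 / ((n : ℝ) + 1))) atTop (𝓝 0) := by
    simpa using (tendsto_one_div_add_atTop_nhds_zero_nat (𝕜 := ℝ)).const_mul (M ^ 2 * (3 * C))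
  refine squeeze_zero (fun n => integral_nonneg fun x => by positivity) (fun n => ?_) hlim
  set N : ℝ := (n : ℝ) + 1 with hN
  have hNpos : 0 < N := by positivity
  -- The gradient is supported in the closed ball of radius `2N`; radius `3N` leaves room for an
  -- open ball. The energy is then at most `3 C N (M / N)²`.
  have h1 (x : E3) : ‖gradient (cutoff n) x‖ ^ 2 ≤
      (Metric.ball (0 : E3) (3 * N)).indicator (fun _ => (M * N⁻¹) ^ 2) x := by
    by_cases hx : x ∈ Metric.ball (0 : E3) (3 * N)
    · rw [indicator_of_mem hx]
      have := hM n x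
      gcongr
    · rw [indicator_of_notMem hx, gradient_eq_zero_of_notMem_tsupport, norm_zero]
      · norm_num
      · intro hxt
        have h2 : tsupport (cutoff n) ⊆ Metric.closedBall 0 (2 * N) := by
          refine closure_minimal (fun y hy => ?_) Metric.isClosed_closedBall
          rw [mem_closedBall_zero_iff]
          by_contra hlt
          exact hy (cutoff_eq_zero (not_le.1 hlt).le)
        have h3 := h2 hxt
        rw [mem_closedBall_zero_iff] at h3
        rw [mem_ball_zero_iff, not_lt] at hx
        linarith
  have hm := mMeasure_ball_lt_top γ (3 * N)
  have h2 : (mMeasure γ).real (Metric.ball 0 (3 * N)) ≤ C * (3 * N) := by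
    refine ENNReal.toReal_le_of_le_ofReal (by positivity) ?_
    refine (mMeasure_ball_le hγ (by positivity)).trans (ENNReal.ofReal_le_ofReal ?_)
    rw [hC]; apply le_of_eq; ring
  calc ∫ x, ‖gradient (cutoff n) x‖ ^ 2 ∂(mMeasure γ)
      ≤ ∫ x, (Metric.ball (0 : E3) (3 * N)).indicator (fun _ => (M * N⁻¹) ^ 2) x ∂(mMeasure γ) := by
        refine integral_mono_of_nonneg (Eventually.of_forall fun x => by positivity) ?_
          (Eventually.of_forall h1)
        rw [integrable_indicator_iff measurableSet_ball]
        exact integrableOn_const hm.ne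
    _ = (mMeasure γ).real (Metric.ball 0 (3 * N)) * (M * N⁻¹) ^ 2 := by
        rw [integral_indicator measurableSet_ball, setIntegral_const, smul_eq_mul]
    _ ≤ C * (3 * N) * (M * N⁻¹) ^ 2 := by gcongr
    _ = M ^ 2 * (3 * C) * (1 / N) := by field_simp

theorem potential_eq_zero {f : E3 → ℝ} (hf : f =ᵐ[mMeasure γ] 0) :
    ∀ᵐ x ∂(mMeasure γ), (distortedForm γ).potential f x = 0 := by
  have hD := isDirichletForm (γ := γ)
  have key (n k : ℕ) :
      (distortedForm γ).resolvent (1 / ((n : ℝ) + 1)) (fun y => min (f y) (k : ℝ)) = 0 := by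
    have h0 : (fun y => min (f y) (k : ℝ)) =ᵐ[mMeasure γ] 0 := by
      filter_upwards [hf] with x hx
      have hx : f x = 0 := hx
      simp only [hx, Pi.zero_apply]
      exact min_eq_left (Nat.cast_nonneg k)
    have hm : MemLp (fun y => min (f y) (k : ℝ)) 2 (mMeasure γ) := MemLp.zero.ae_eq h0.symm
    have hα : (0 : ℝ) < 1 / ((n : ℝ) + 1) := by positivity
    refine hD.eq_of_isResolventOf hα (hD.isResolventOf_resolvent hα hm)
      ⟨hD.zero_mem, fun v hv => ?_⟩
    have h1 := hD.form_sub_left hv hv hv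
    rw [sub_self, sub_self] at h1
    rw [h1, inner_zero_left, mul_zero, add_zero]
    refine (integral_eq_zero_of_ae ?_).symm
    filter_upwards [h0] with x hx
    simp [hx]
  refine Eventually.of_forall fun x => ?_
  simp only [L2Form.potential, key]
  simp

theorem isRecurrent (hγ : 0 ≤ γ) : (distortedForm γ).IsRecurrent := by
  intro f hf hf0
  by_cases hfz : f =ᵐ[mMeasure γ] 0
  · filter_upwards [potential_eq_zero hfz] with x hx using Or.inl hx
  have hD := isDirichletForm (γ := γ)
  -- The resolvents of the truncation at level 1 are terms of the supremum that defines the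
  -- potential, so it suffices that they tend to infinity. The cast of `1` makes `g` coincide with
  -- the term `k = 1`.
  set g : E3 → ℝ := fun y => min (f y) ((1 : ℕ) : ℝ) with hg
  have mg : MemLp g 2 (mMeasure γ) := memLp_min_of_integrable hf hf0 (Nat.cast_nonneg 1)
  have hg0 : 0 ≤ᵐ[mMeasure γ] g := by
    filter_upwards [hf0] with x hx
    exact le_min hx (Nat.cast_nonneg 1)
  have ig : Integrable g (mMeasure γ) := by
    refine hf.mono' mg.1 ?_
    filter_upwards [hg0] with x hx
    rw [Real.norm_of_nonneg hx]
    exact min_le_left _ _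
  have hgpos : 0 < ∫ x, g x ∂(mMeasure γ) := by
    refine lt_of_le_of_ne (integral_nonneg_of_ae hg0) fun h => hfz ?_
    filter_upwards [(integral_eq_zero_iff_of_nonneg_ae hg0 ig).1 h.symm, hf0] with x hx hx0
    have hx : min (f x) ((1 : ℕ) : ℝ) = 0 := hx
    rcases min_choice (f x) ((1 : ℕ) : ℝ) with h | h
    · rw [h] at hx; exact hx
    · rw [h] at hx; norm_num at hx
  set α : ℕ → ℝ := fun n => 1 / ((n : ℝ) + 1) with hα
  have hαpos (n : ℕ) : 0 < α n := by rw [hα]; positivity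
  have hαlim : Tendsto α atTop (𝓝 0) := tendsto_one_div_add_atTop_nhds_zero_nat
  have hαanti (n k : ℕ) (h : n ≤ k) : α k ≤ α n := by
    simp only [hα]; gcongr
  set u : ℕ → Lp ℝ 2 (mMeasure γ) := fun n => (distortedForm γ).resolvent (α n) g with hu
  have hur (n : ℕ) : (distortedForm γ).IsResolventOf (α n) g (u n) :=
    hD.isResolventOf_resolvent (hαpos n) mg
  have hu0 (n : ℕ) : 0 ≤ᵐ[mMeasure γ] u n := resolvent_nonneg (hαpos n) mg hg0
  choose G hw mG using fun n => (hur n).1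
  have hmono : ∀ᵐ x ∂(mMeasure γ), ∀ n, u n x ≤ u (n + 1) x :=
    ae_all_iff.2 fun n => resolvent_anti (hαpos _) (hαanti _ _ n.le_succ) mg hg0
  have hF (n : ℕ) := (hw n).comp_of_hasDerivAt (Lp.memLp (u n)) (mG n) hasDerivAt_decay
    continuous_decayDeriv abs_decayDeriv_le
  set e : ℕ → ℝ := fun k => ∫ x, ‖gradient (cutoff k) x‖ ^ 2 ∂(mMeasure γ) with he
  set b : ℕ → ℝ := fun k => ∫ x, cutoff k x ^ 2 ∂(mMeasure γ) with hb
  have helim : Tendsto e atTop (𝓝 0) := tendsto_integral_gradient_cutoff hγ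
  have hcac (n k : ℕ) := caccioppoli (hαpos n) (hur n) (hu0 n) (hw n) (mG n) (cutoff_mem k)
  have hlimn (k : ℕ) : Tendsto (fun n => e k + α n * b k) atTop (𝓝 (e k)) := by
    simpa using (hαlim.mul_const (b k)).const_add (e k)
  have hsmall : ∀ δ > 0, ∃ k₀, ∀ k ≥ k₀, ∀ᶠ n in atTop, e k + α n * b k < δ := by
    intro δ hδ
    obtain ⟨k₀, hk₀⟩ := eventually_atTop.1 (helim.eventually (gt_mem_nhds hδ))
    exact ⟨k₀, fun k hk => (hlimn k).eventually (gt_mem_nhds (hk₀ k hk))⟩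
  have hFm (n : ℕ) : AEStronglyMeasurable (fun x => decayDeriv (u n x) • G n x) (mMeasure γ) :=
    aestronglyMeasurable_mMeasure_iff.2 (hF n).2.aestronglyMeasurable
  -- the gradients of `decay (u n)` vanish in the limit
  have hgrad (R : ℝ) : Tendsto (fun n => eLpNorm (fun x => decayDeriv (u n x) • G n x) 2
      ((mMeasure γ).restrict (Metric.ball 0 R))) atTop (𝓝 0) := by
    have hsq : Tendsto (fun n => eLpNorm (fun x => decayDeriv (u n x) • G n x) 2
      ((mMeasure γ).restrict (Metric.ball 0 R)) ^ 2) atTop (𝓝 0) := by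
      rw [ENNReal.tendsto_nhds_zero]
      intro δ hδ
      rcases eq_or_ne δ ⊤ with rfl | hδt
      · exact Eventually.of_forall fun _ => le_top
      -- The quarter compensates the factor in the Caccioppoli inequality. Afterwards `k` is also
      -- taken at least `R`, so that the cut-off equals 1 on the ball.
      obtain ⟨k₀, hk₀⟩ := hsmall (δ.toReal / 4) (by
        have := ENNReal.toReal_pos hδ.ne' hδt; positivity)
      have hk := hk₀ (max k₀ ⌈R⌉₊) (le_max_left _ _)
      set k := max k₀ ⌈R⌉₊ with hkdef
      filter_upwards [hk] with n hn
      have hball : ∀ x ∈ Metric.ball (0 : E3) R, cutoff k x = 1 := fun x hx => cutoff_eq_one (by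
        rw [mem_ball_zero_iff] at hx
        have h1 := Nat.le_ceil R
        have h2 : (⌈R⌉₊ : ℝ) ≤ k := by exact_mod_cast le_max_right _ _
        linarith)
      have i2 : Integrable (fun x => cutoff k x ^ 2 * ‖decayDeriv (u n x) • G n x‖ ^ 2)
          (mMeasure γ) := by
        have mK : MemLp (fun x => decayDeriv (u n x) • G n x) 2 (mMeasure γ) := by
          refine ((mG n).const_smul (2 : ℝ)).mono (hFm n) (Eventually.of_forall fun x => ?_)
          rw [Pi.smul_apply, norm_smul, norm_smul]
          exact mul_le_mul_of_nonneg_right ((abs_decayDeriv_le _).trans (le_abs_self _))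
            (norm_nonneg _)
        refine (mK.integrable_norm_pow two_ne_zero).bdd_mul (c := 1)
          ((contDiff_cutoff k).continuous.pow 2).aestronglyMeasurable
          (Eventually.of_forall fun x => ?_)
        rw [Real.norm_of_nonneg (by positivity)]
        exact pow_le_one₀ (cutoff_nonneg k x) (cutoff_le_one k x)
      have h1 : ∫ x, cutoff k x ^ 2 * ‖decayDeriv (u n x) • G n x‖ ^ 2 ∂(mMeasure γ) ≤ δ.toReal := by
        have h2 := hcac n k
        have h3 : 0 ≤ ∫ x, g x * (cutoff k x ^ 2 * decay (u n x)) ∂(mMeasure γ) := by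
          refine integral_nonneg_of_ae ?_
          filter_upwards [hg0] with x hx
          have := (decay_pos (u n x)).le
          exact mul_nonneg hx (by positivity)
        change _ ≤ e k + α n * b k at h2
        linarith
      rw [eLpNorm_two_sq, ← ENNReal.ofReal_toReal hδt]
      refine le_trans ?_ (ENNReal.ofReal_le_ofReal h1)
      rw [ofReal_integral_eq_lintegral_ofReal i2 (Eventually.of_forall fun x => by positivity)]
      refine le_trans ?_ (setLIntegral_le_lintegral (Metric.ball 0 R) _)
      refine setLIntegral_mono' measurableSet_ball fun x hx => ?_
      rw [hball x hx, one_pow, one_mul, ENNReal.ofReal_pow (norm_nonneg _), ofReal_norm]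
    have h2 := hsq.ennrpow_const (1 / 2)
    simp only [one_div, ENNReal.zero_rpow_of_pos (show (0 : ℝ) < 2⁻¹ by norm_num)] at h2
    refine h2.congr fun n => ?_
    rw [← ENNReal.rpow_natCast, ← ENNReal.rpow_mul]
    norm_num
  -- Taking the infimum makes `s ≤ decay (u n)` hold at every point; monotonicity in `n`, valid
  -- almost everywhere, shows that it is also the limit.
  set s : E3 → ℝ := fun x => ⨅ n, decay (u n x) with hs
  have hbdd (x : E3) : BddBelow (range fun n => decay (u n x)) :=
    ⟨0, by rintro _ ⟨n, rfl⟩; exact (decay_pos _).le⟩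
  have hslim : ∀ᵐ x ∂(mMeasure γ), Tendsto (fun n => decay (u n x)) atTop (𝓝 (s x)) := by
    filter_upwards [hmono] with x hx
    exact tendsto_atTop_ciInf (fun n k hnk => antitone_decay (monotone_nat_of_le_succ hx hnk))
      (hbdd x)
  have hsle (n : ℕ) (x : E3) : s x ≤ decay (u n x) := ciInf_le (hbdd x) n
  have hs0 (x : E3) : 0 ≤ s x := le_ciInf fun n => (decay_pos _).le
  have hsm : AEStronglyMeasurable s volume :=
    aestronglyMeasurable_of_tendsto_ae _ (fun n => (hF n).1.aestronglyMeasurable)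
      (ae_volume_of_ae hslim)
  have hs1 : ∀ᵐ x ∂(mMeasure γ), ∀ n, decay (u n x) ≤ 1 := by
    filter_upwards [ae_all_iff.2 hu0] with x hx n
    exact decay_le_one (hx n)
  have hsw : HasWeakGradient s 0 := by
    refine HasWeakGradient.of_tendsto_integral hF ?_ locallyIntegrable_zero ?_ ?_
    · refine (locallyIntegrable_const (1 : ℝ)).mono hsm ?_
      filter_upwards [ae_volume_of_ae hs1] with x hx
      rw [Real.norm_of_nonneg (hs0 x), norm_one]
      exact (hsle 0 x).trans (hx 0)
    · intro φ hφ hφc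
      refine tendsto_integral_of_dominated_convergence (fun x => ‖φ x‖) (fun n =>
        hφ.aestronglyMeasurable.smul (hF n).1.aestronglyMeasurable)
        (hφ.norm.integrable_of_hasCompactSupport hφc.norm) (fun n => ?_) ?_
      · filter_upwards [ae_volume_of_ae hs1] with x hx
        rw [norm_smul, Real.norm_of_nonneg (decay_pos _).le]
        exact mul_le_of_le_one_right (norm_nonneg _) (hx n)
      · filter_upwards [ae_volume_of_ae hslim] with x hx using hx.const_smul _
    · intro φ hφ hφc
      refine tendsto_integral_smul_of_tendsto_eLpNorm_ball (fun n => (hF n).2)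
        locallyIntegrable_zero (fun R => ?_) hφ hφc
      obtain ⟨c, hc, h'⟩ := exists_eLpNorm_one_ball_le (F := E3) γ R
      have h2 := ENNReal.Tendsto.const_mul (hgrad R) (Or.inr hc)
      rw [mul_zero] at h2
      refine tendsto_of_tendsto_of_tendsto_of_le_of_le tendsto_const_nhds h2 (fun _ => zero_le)
        fun n => ?_
      exact (congrArg (fun f => eLpNorm f 1 _) (sub_zero _)).le.trans
        (h' _ (hF n).2.aestronglyMeasurable)
  obtain ⟨c, hc⟩ := hsw.ae_eq_const
  replace hc : ∀ᵐ x ∂(mMeasure γ), s x = c := mMeasure_absolutelyContinuous γ hc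
  have hc0 : c = 0 := by
    have hne : (ae (mMeasure γ)).NeBot := by
      rw [ae_neBot]
      intro h0
      rw [h0, integral_zero_measure] at hgpos
      exact lt_irrefl _ hgpos
    obtain ⟨x0, hx0⟩ := hc.exists
    have hcnn : 0 ≤ c := by
      rw [← show s x0 = c from hx0]; exact hs0 x0
    have iχ (k : ℕ) : Integrable (fun x => g x * cutoff k x ^ 2) (mMeasure γ) := by
      refine ig.mul_bdd (c := 1) ((contDiff_cutoff k).continuous.pow 2).aestronglyMeasurable
        (Eventually.of_forall fun x => ?_)
      rw [Real.norm_of_nonneg (by positivity)]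
      exact pow_le_one₀ (cutoff_nonneg k x) (cutoff_le_one k x)
    -- Caccioppoli with `c ≤ decay (u n)`. The limit in `n` is taken first, at fixed `k`, to remove
    -- `α n * b k`; then `k` tends to infinity and the cut-off energy `e k` vanishes.
    have h1 (n k : ℕ) : c * ∫ x, g x * cutoff k x ^ 2 ∂(mMeasure γ) ≤ e k + α n * b k := by
      have h2 := hcac n k
      have h3 : 0 ≤ ∫ x, cutoff k x ^ 2 * ‖decayDeriv (u n x) • G n x‖ ^ 2 ∂(mMeasure γ) :=
        integral_nonneg fun x => by positivity
      have h4 : c * ∫ x, g x * cutoff k x ^ 2 ∂(mMeasure γ) ≤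
          ∫ x, g x * (cutoff k x ^ 2 * decay (u n x)) ∂(mMeasure γ) := by
        rw [← integral_const_mul]
        refine integral_mono_ae ((iχ k).const_mul c) ?_ ?_
        · have h5 : Integrable (fun x => g x * cutoff k x ^ 2 * decay (u n x)) (mMeasure γ) := by
            refine (iχ k).mul_bdd (c := 1)
              (continuous_decay.comp_aestronglyMeasurable (Lp.memLp (u n)).1) ?_
            filter_upwards [hs1] with x hx
            rw [Real.norm_of_nonneg (decay_pos _).le]
            exact hx n
          simpa only [mul_assoc] using h5
        · filter_upwards [hc, hg0] with x hx hxg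
          have h5 : c ≤ decay (u n x) := by
            rw [← show s x = c from hx]; exact hsle n x
          have hxg : 0 ≤ g x := hxg
          calc c * (g x * cutoff k x ^ 2) ≤ decay (u n x) * (g x * cutoff k x ^ 2) := by gcongr
            _ = _ := by ring
      change _ ≤ e k + α n * b k at h2
      linarith
    have h2 (k : ℕ) : c * ∫ x, g x * cutoff k x ^ 2 ∂(mMeasure γ) ≤ e k :=
      ge_of_tendsto' (hlimn k) fun n => h1 n k
    have h3 : Tendsto (fun k => ∫ x, g x * cutoff k x ^ 2 ∂(mMeasure γ)) atTop
        (𝓝 (∫ x, g x ∂(mMeasure γ))) := by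
      refine tendsto_integral_of_dominated_convergence (fun x => ‖g x‖) (fun k => (iχ k).1)
        ig.norm (fun k => Eventually.of_forall fun x => ?_) (Eventually.of_forall fun x => ?_)
      · rw [norm_mul, Real.norm_of_nonneg (by positivity : 0 ≤ cutoff k x ^ 2)]
        exact mul_le_of_le_one_right (norm_nonneg _)
          (pow_le_one₀ (cutoff_nonneg k x) (cutoff_le_one k x))
      · simpa using ((tendsto_cutoff x).pow 2).const_mul (g x)
    have h4 : c * ∫ x, g x ∂(mMeasure γ) ≤ 0 := le_of_tendsto_of_tendsto' (h3.const_mul c) helim h2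
    nlinarith
  filter_upwards [hc] with x hx
  right
  rw [hc0] at hx
  have hx : s x = 0 := hx
  -- If the potential were below `B` at `x`, then `u n x ≤ B` for all `n`, hence `s x ≥ decay B >
  -- 0`.
  refine ENNReal.eq_top_of_forall_nnreal_le fun B => ?_
  by_contra hlt
  have hB (n : ℕ) : u n x ≤ B := by
    by_contra hn
    push Not at hn
    refine hlt (le_trans ?_ (le_iSup₂ (f := fun n k : ℕ => ENNReal.ofReal
      ((distortedForm γ).resolvent (1 / ((n : ℝ) + 1)) (fun y => min (f y) (k : ℝ)) x)) n 1))
    rw [← ENNReal.ofReal_coe_nnreal]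
    exact ENNReal.ofReal_le_ofReal hn.le
  have h1 : decay B ≤ s x := le_ciInf fun n => antitone_decay (hB n)
  have h2 := decay_pos B
  linarith

end distortedForm


/-! ### Spectral gap and transience for `γ < 0`. -/

/-- The divergence theorem for the radial field `h(x) x` on `ℝ³` against a test function. -/
theorem integral_radial_mul_fderiv {h k : E3 → ℝ} (hh : ContDiff ℝ 1 h)
    (hk : ∀ x v, fderiv ℝ h x v = k x * inner ℝ x v) (hkc : Continuous k)
    {ψ : E3 → ℝ} (hψ : ψ ∈ smoothCompactlySupported) :
    ∫ x, h x * fderiv ℝ ψ x x = - ∫ x, ψ x * (3 * h x + k x * ‖x‖ ^ 2) := by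
  -- Integration by parts of each component `h(x) ⟨x, b i⟩`, summed over the basis; the dimension 3
  -- appears as the sum of the `‖b i‖²`.
  set b := stdOrthonormalBasis ℝ E3
  have hV (v : E3) : ContDiff ℝ 1 fun x : E3 => h x * inner ℝ x v :=
    hh.mul (contDiff_id.inner ℝ contDiff_const)
  have hgrad (v x : E3) : inner ℝ (gradient (fun x : E3 => h x * inner ℝ x v) x) v =
      h x * inner ℝ v v + k x * (inner ℝ x v * inner ℝ x v) := by
    have h1 : HasFDerivAt (fun x : E3 => inner ℝ x v) (innerSL ℝ v) x := by
      have := (innerSL ℝ v).hasFDerivAt (x := x)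
      refine this.congr_of_eventuallyEq (Eventually.of_forall fun y => ?_)
      simp [real_inner_comm]
    have h2 : HasFDerivAt (fun x : E3 => h x * inner ℝ x v)
        (h x • innerSL ℝ v + inner ℝ x v • fderiv ℝ h x) x :=
      ((hh.differentiable one_ne_zero x).hasFDerivAt).mul h1
    rw [inner_gradient_left, h2.fderiv]
    simp only [_root_.add_apply, _root_.smul_apply, innerSL_apply_apply,
      smul_eq_mul, hk]
    ring
  have hib (v : E3) := (HasWeakGradient.of_contDiff (hV v)).integral_eq ψ hψ v
  simp only [hgrad] at hib
  have hi1 (v : E3) : Integrable (fun x => h x * inner ℝ x v * fderiv ℝ ψ x v) volume :=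
    Continuous.integrable_of_hasCompactSupport
      ((hV v).continuous.mul (smoothCompactlySupported.continuous_fderiv_apply hψ v))
      (smoothCompactlySupported.hasCompactSupport_fderiv_apply hψ v).mul_left
  have hi2 (v : E3) : Integrable (fun x => ψ x *
      (h x * inner ℝ v v + k x * (inner ℝ x v * inner ℝ x v))) volume := by
    have := hh.continuous
    have := hψ.1.continuous
    exact Continuous.integrable_of_hasCompactSupport (by fun_prop) hψ.2.mul_right
  have hsum := Finset.sum_congr rfl fun i (_ : i ∈ Finset.univ) => hib (b i)
  rw [Finset.sum_neg_distrib, ← integral_finsetSum _ fun i _ => hi1 (b i),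
    ← integral_finsetSum _ fun i _ => hi2 (b i)] at hsum
  have e1 (x : E3) : ∑ i, h x * inner ℝ x (b i) * fderiv ℝ ψ x (b i) = h x * fderiv ℝ ψ x x := by
    have hx : fderiv ℝ ψ x x = ∑ i, fderiv ℝ ψ x (inner ℝ (b i) x • b i) := by
      rw [← map_sum, b.sum_repr' x]
    rw [hx, Finset.mul_sum]
    refine Finset.sum_congr rfl fun i _ => ?_
    rw [map_smul, smul_eq_mul, real_inner_comm, mul_assoc]
  have e2 (x : E3) : ∑ i, ψ x * (h x * inner ℝ (b i) (b i) + k x * (inner ℝ x (b i) * inner ℝ x (b i)))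
      = ψ x * (3 * h x + k x * ‖x‖ ^ 2) := by
    rw [← Finset.mul_sum, Finset.sum_add_distrib, ← Finset.mul_sum, ← Finset.mul_sum]
    have h1 : ∑ i, inner ℝ x (b i) * inner ℝ x (b i) = ‖x‖ ^ 2 := by
      rw [← real_inner_self_eq_norm_sq, ← b.sum_inner_mul_inner x x]
      refine Finset.sum_congr rfl fun i _ => ?_
      rw [real_inner_comm x (b i)]
    have h2 : ∑ i, (inner ℝ (b i) (b i) : ℝ) = 3 := by
      simp
    rw [h1, h2, mul_comm (h x)]
  simpa only [e1, e2] using hsum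

/-- The regularized radius `√(|x|² + ε²)`. -/
noncomputable def regRadius (ε : ℝ) (x : E3) : ℝ := √(‖x‖ ^ 2 + ε ^ 2)

theorem regRadius_pos {ε : ℝ} (hε : 0 < ε) (x : E3) : 0 < regRadius ε x :=
  Real.sqrt_pos.2 (by positivity)

theorem norm_le_regRadius (ε : ℝ) (x : E3) : ‖x‖ ≤ regRadius ε x :=
  Real.le_sqrt_of_sq_le (by nlinarith)

theorem regRadius_le {ε : ℝ} (hε : 0 < ε) (x : E3) : regRadius ε x ≤ ‖x‖ + ε :=
  Real.sqrt_le_iff.2 ⟨by positivity, by nlinarith [norm_nonneg x]⟩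

theorem regRadius_sq (ε : ℝ) (x : E3) : regRadius ε x ^ 2 = ‖x‖ ^ 2 + ε ^ 2 :=
  Real.sq_sqrt (by positivity)

theorem contDiff_regRadius {ε : ℝ} (hε : 0 < ε) : ContDiff ℝ 1 (regRadius ε) :=
  ((contDiff_norm_sq ℝ).add contDiff_const).sqrt fun x => by positivity

theorem hasFDerivAt_regRadius {ε : ℝ} (hε : 0 < ε) (x : E3) :
    HasFDerivAt (regRadius ε) ((regRadius ε x)⁻¹ • innerSL ℝ x) x := by
  have h1 : HasFDerivAt (fun x : E3 => ‖x‖ ^ 2 + ε ^ 2) (2 • innerSL ℝ x) x :=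
    (hasStrictFDerivAt_norm_sq x).hasFDerivAt.add_const (ε ^ 2)
  have h2 := h1.sqrt (by positivity)
  refine h2.congr_fderiv ?_
  rw [← Nat.cast_smul_eq_nsmul ℝ, smul_smul]
  congr 1
  unfold regRadius
  push_cast
  field_simp

/-- With `p = √(|x|² + ε²)`, the smooth field `exp (2ap) x / p³` has divergence `exp (2ap) (2a|x|² /
p⁴ + 3ε² / p⁵)`. Pairing it with `φ²` and using Cauchy–Schwarz pointwise gives the gap, with errors
that vanish as `ε → 0`. The regularization admits test functions that do not vanish near the origin.
-/
theorem regularized_spectral_gap {a ε : ℝ} (ha : 0 < a) (hε : 0 < ε) {φ : E3 → ℝ}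
    (hφ : φ ∈ smoothCompactlySupported) :
    a ^ 2 * ∫ x, φ x ^ 2 * (‖x‖ ^ 4 / regRadius ε x ^ 4) ∂(mMeasure (-a)) ≤
      Real.exp (2 * a * ε) * ∫ x, ‖gradient φ x‖ ^ 2 ∂(mMeasure (-a)) := by
  have hp := regRadius_pos hε
  have hpc := (contDiff_regRadius hε).continuous
  set p := regRadius ε with hpdef
  set h : E3 → ℝ := fun x => Real.exp (2 * a * p x) * (p x ^ 3)⁻¹ with hh
  set k : E3 → ℝ := fun x => Real.exp (2 * a * p x) * (2 * a * (p x ^ 4)⁻¹ - 3 * (p x ^ 5)⁻¹)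
    with hk
  have hhd : ContDiff ℝ 1 h :=
    (contDiff_const.mul (contDiff_regRadius hε)).exp.mul
      (((contDiff_regRadius hε).pow 3).inv fun x => (pow_pos (hp x) 3).ne')
  have hkc : Continuous k :=
    (continuous_const.mul hpc).rexp.mul ((continuous_const.mul ((hpc.pow 4).inv₀ fun x =>
      (pow_pos (hp x) 4).ne')).sub (continuous_const.mul ((hpc.pow 5).inv₀ fun x =>
      (pow_pos (hp x) 5).ne')))
  have hfd (x v : E3) : fderiv ℝ h x v = k x * inner ℝ x v := by
    have h1 : HasDerivAt (fun t : ℝ => Real.exp (2 * a * t) * (t ^ 3)⁻¹)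
        (Real.exp (2 * a * p x) * (2 * a * (p x ^ 3)⁻¹ - 3 * (p x ^ 4)⁻¹)) (p x) := by
      have e1 : HasDerivAt (fun t : ℝ => Real.exp (2 * a * t))
          (Real.exp (2 * a * p x) * (2 * a)) (p x) := by
        simpa using ((hasDerivAt_id (p x)).const_mul (2 * a)).exp
      have e2 := (hasDerivAt_pow 3 (p x)).inv (pow_pos (hp x) 3).ne'
      refine (e1.mul e2).congr_deriv ?_
      have := (hp x).ne'
      simp only [Pi.inv_apply]
      field_simp
      ring
    have h2 := h1.comp_hasFDerivAt x (hasFDerivAt_regRadius hε x)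
    have h3 : HasFDerivAt h _ x := h2
    rw [h3.fderiv]
    simp only [_root_.smul_apply, innerSL_apply_apply, smul_eq_mul, hk, ← hpdef]
    have := (hp x).ne'
    field_simp
  have hψ : (fun x => φ x ^ 2) ∈ smoothCompactlySupported :=
    ⟨hφ.1.pow 2, hφ.2.comp_left (g := fun t : ℝ => t ^ 2) (by norm_num)⟩
  have hdiv := integral_radial_mul_fderiv hhd hfd hkc hψ
  have hgc := continuous_gradient (hφ.1.of_le (by simp))
  have hψd (x : E3) : fderiv ℝ (fun x => φ x ^ 2) x x = 2 * φ x * inner ℝ (gradient φ x) x := by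
    rw [((hφ.1.differentiable (by simp) x).hasFDerivAt.pow 2).fderiv, inner_gradient_left]
    simp
  simp only [hψd] at hdiv
  have hc := hhd.continuous
  have hφc := hφ.1.continuous
  have i1 : Integrable (fun x => h x * (2 * φ x * inner ℝ (gradient φ x) x)) volume :=
    Continuous.integrable_of_hasCompactSupport (by fun_prop) (hφ.2.mul_left.mul_right.mul_left)
  have i2 : Integrable (fun x => φ x ^ 2 * (3 * h x + k x * ‖x‖ ^ 2)) volume :=
    Continuous.integrable_of_hasCompactSupport (by fun_prop) hψ.2.mul_right
  set W : E3 → ℝ := fun x => psi (-a) x ^ 2 with hW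
  have mφ := distortedForm.memLp_of_mem (γ := -a) hφ
  have mg := distortedForm.memLp_gradient_of_mem (γ := -a) hφ
  have j1 : Integrable (fun x => φ x ^ 2 * (‖x‖ ^ 4 / p x ^ 4)) (mMeasure (-a)) := by
    refine mφ.integrable_sq.mono' (by
      refine Continuous.aestronglyMeasurable ((hφc.pow 2).mul ((continuous_norm.pow 4).div₀ (hpc.pow 4) fun x => (pow_pos (hp x) 4).ne'))) (Eventually.of_forall fun x => ?_)
    rw [Real.norm_of_nonneg (by have := hp x; positivity)]
    refine mul_le_of_le_one_right (sq_nonneg _) (div_le_one_of_le₀ ?_ (pow_pos (hp x) 4).le)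
    exact pow_le_pow_left₀ (norm_nonneg x) (norm_le_regRadius ε x) 4
  have j2 : Integrable (fun x => ‖gradient φ x‖ ^ 2) (mMeasure (-a)) :=
    mg.integrable_norm_pow two_ne_zero
  have j3 := (j1.const_mul (a ^ 2)).sub (j2.const_mul (Real.exp (2 * a * ε)))
  have hneg : ∫ x, (a ^ 2 * (φ x ^ 2 * (‖x‖ ^ 4 / p x ^ 4)) -
      Real.exp (2 * a * ε) * ‖gradient φ x‖ ^ 2) ∂(mMeasure (-a)) ≤ 0 := by
    -- The divergence identity, written as a vanishing integral. What remains is a pointwise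
    -- inequality between integrands.
    have hz : ∫ x, (a * (4 * Real.pi ^ 2)⁻¹) * (φ x ^ 2 * (3 * h x + k x * ‖x‖ ^ 2) +
        h x * (2 * φ x * inner ℝ (gradient φ x) x)) = 0 := by
      rw [integral_const_mul, integral_add i2 i1, hdiv]; ring
    rw [← hz]
    have j4 := j3
    rw [mMeasure, integrable_withDensity_iff_integrable_smul' (measurable_psi_sq _)
      (Eventually.of_forall fun _ => ENNReal.ofReal_lt_top)] at j4
    rw [mMeasure, integral_withDensity_eq_integral_toReal_smul (measurable_psi_sq _)
      (Eventually.of_forall fun _ => ENNReal.ofReal_lt_top)]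
    refine integral_mono_ae j4 ((i2.add i1).const_mul _) ?_
    filter_upwards [ae_ne_zero_E3] with x hx
    have hr : 0 < ‖x‖ := norm_pos_iff.2 hx
    have hpx := hp x
    have hle := norm_le_regRadius ε x
    have hle2 := regRadius_le hε x
    have hsq := regRadius_sq ε x
    rw [← hpdef] at hle hle2 hsq
    simp only [smul_eq_mul]
    rw [ENNReal.toReal_ofReal (sq_nonneg _), psi_sq]
    set q := p x
    set r := ‖x‖
    have hin : |inner ℝ (gradient φ x) x| ≤ ‖gradient φ x‖ * r := abs_real_inner_le_norm _ _
    set I := inner ℝ (gradient φ x) x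
    set g := ‖gradient φ x‖
    set c := (4 * Real.pi ^ 2)⁻¹ with hcdef
    have hc0 : 0 < c := by positivity
    have hE1 : Real.exp (-(2 * -a * r)) ≤ Real.exp (2 * a * q) :=
      Real.exp_le_exp.2 (by nlinarith)
    -- From `p ≤ |x| + ε`; the source of the factor `exp (2aε)` in the statement.
    have hE2 : Real.exp (2 * a * q) ≤ Real.exp (2 * a * ε) * Real.exp (-(2 * -a * r)) := by
      rw [← Real.exp_add]; exact Real.exp_le_exp.2 (by nlinarith)
    have hE0 := Real.exp_pos (2 * a * q)
    have s1 : Real.exp (-(2 * -a * r)) * c * (r ^ 2)⁻¹ * (a ^ 2 * (φ x ^ 2 * (r ^ 4 / q ^ 4))) ≤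
        c * Real.exp (2 * a * q) * (a * φ x * r / q ^ 2) ^ 2 := by
      calc _ = c * Real.exp (-(2 * -a * r)) * (a * φ x * r / q ^ 2) ^ 2 := by field_simp
        _ ≤ _ := by gcongr
    have s2 : c * Real.exp (2 * a * q) * (g / q) ^ 2 ≤
        Real.exp (-(2 * -a * r)) * c * (r ^ 2)⁻¹ * (Real.exp (2 * a * ε) * g ^ 2) := by
      calc _ ≤ c * (Real.exp (2 * a * ε) * Real.exp (-(2 * -a * r))) * (g / r) ^ 2 := by gcongr
        _ = _ := by field_simp
    have s3 : a * c * (φ x ^ 2 * (3 * h x + k x * r ^ 2) + h x * (2 * φ x * I)) =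
        c * Real.exp (2 * a * q) * (2 * (a * φ x * r / q ^ 2) ^ 2 + 2 * (a * (φ x * I) / q ^ 3)
          + 3 * a * φ x ^ 2 * ε ^ 2 / q ^ 5) := by
      have hε2 : ε ^ 2 = q ^ 2 - r ^ 2 := by linarith
      rw [hε2]
      simp only [hh, hk]
      change a * c * (φ x ^ 2 * (3 * (Real.exp (2 * a * q) * (q ^ 3)⁻¹) +
        Real.exp (2 * a * q) * (2 * a * (q ^ 4)⁻¹ - 3 * (q ^ 5)⁻¹) * r ^ 2) +
        Real.exp (2 * a * q) * (q ^ 3)⁻¹ * (2 * φ x * I)) = _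
      field_simp
      ring
    have s4 : -(|a * φ x * r / q ^ 2| * (g / q)) ≤ a * (φ x * I) / q ^ 3 := by
      have e1 : |a * φ x * r / q ^ 2| * (g / q) = a * (|φ x| * (g * r)) / q ^ 3 := by
        rw [abs_div, abs_mul, abs_mul, abs_of_pos ha, abs_of_pos hr, abs_of_pos (pow_pos hpx 2)]
        field_simp
      rw [e1, ← neg_div, ← mul_neg]
      have e2 : -(|φ x| * (g * r)) ≤ φ x * I := by
        refine (neg_le_neg ?_).trans (neg_abs_le _)
        rw [abs_mul]
        gcongr
      gcongr
    -- The part of the divergence created by the regularization has a favourable sign and is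
    -- dropped. The rest is `A² - B² ≤ 2A² - 2AB`, that is, `(A - B)² ≥ 0`, with `A = |aφr / q²|`
    -- and `B = g / q`.
    have s5 : 0 ≤ 3 * a * φ x ^ 2 * ε ^ 2 / q ^ 5 := by positivity
    have s6 : (a * φ x * r / q ^ 2) ^ 2 - (g / q) ^ 2 ≤ 2 * (a * φ x * r / q ^ 2) ^ 2 +
        2 * (a * (φ x * I) / q ^ 3) + 3 * a * φ x ^ 2 * ε ^ 2 / q ^ 5 := by
      rw [← sq_abs (a * φ x * r / q ^ 2)]
      nlinarith [sq_nonneg (|a * φ x * r / q ^ 2| - g / q)]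
    have s7 := mul_le_mul_of_nonneg_left s6 (mul_pos hc0 hE0).le
    rw [s3, mul_sub]
    rw [mul_sub] at s7
    linarith
  rw [integral_sub (j1.const_mul _) (j2.const_mul _), integral_const_mul, integral_const_mul] at hneg
  linarith

theorem tendsto_norm_div_regRadius {x : E3} (hx : x ≠ 0) {ε : ℕ → ℝ} (hε : Tendsto ε atTop (𝓝 0)) :
    Tendsto (fun n => ‖x‖ ^ 4 / regRadius (ε n) x ^ 4) atTop (𝓝 1) := by
  have hr : 0 < ‖x‖ := norm_pos_iff.2 hx
  have h1 : Tendsto (fun n => regRadius (ε n) x) atTop (𝓝 ‖x‖) := by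
    have := ((hε.pow 2).const_add (‖x‖ ^ 2)).sqrt
    simpa [regRadius] using this
  have h2 := (h1.pow 4).inv₀ (pow_pos hr 4).ne' |>.const_mul (‖x‖ ^ 4)
  rw [mul_inv_cancel₀ (pow_pos hr 4).ne'] at h2
  exact h2

/-- The spectral gap of the form for `γ = -a < 0` on test functions. -/
theorem spectral_gap_of_mem {a : ℝ} (ha : 0 < a) {φ : E3 → ℝ}
    (hφ : φ ∈ smoothCompactlySupported) :
    a ^ 2 * ∫ x, φ x ^ 2 ∂(mMeasure (-a)) ≤ ∫ x, ‖gradient φ x‖ ^ 2 ∂(mMeasure (-a)) := by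
  set ε : ℕ → ℝ := fun n => 1 / ((n : ℝ) + 1) with hεdef
  have hεlim : Tendsto ε atTop (𝓝 0) := tendsto_one_div_add_atTop_nhds_zero_nat
  have hεpos (n : ℕ) : 0 < ε n := by rw [hεdef]; positivity
  have mφ := distortedForm.memLp_of_mem (γ := -a) hφ
  have h1 : Tendsto (fun n => ∫ x, φ x ^ 2 * (‖x‖ ^ 4 / regRadius (ε n) x ^ 4) ∂(mMeasure (-a)))
      atTop (𝓝 (∫ x, φ x ^ 2 ∂(mMeasure (-a)))) := by
    refine tendsto_integral_of_dominated_convergence (fun x => φ x ^ 2) (fun n => ?_)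
      mφ.integrable_sq (fun n => Eventually.of_forall fun x => ?_) ?_
    · exact ((hφ.1.continuous.pow 2).mul ((continuous_norm.pow 4).div₀
        ((contDiff_regRadius (hεpos n)).continuous.pow 4)
        fun x => (pow_pos (regRadius_pos (hεpos n) x) 4).ne')).aestronglyMeasurable
    · have := regRadius_pos (hεpos n) x
      rw [Real.norm_of_nonneg (by positivity)]
      refine mul_le_of_le_one_right (sq_nonneg _) (div_le_one_of_le₀ ?_ (pow_pos this 4).le)
      exact pow_le_pow_left₀ (norm_nonneg x) (norm_le_regRadius _ x) 4
    · filter_upwards [(mMeasure_absolutelyContinuous (-a)).ae_le ae_ne_zero_E3] with x hx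
      simpa using (tendsto_norm_div_regRadius hx hεlim).const_mul (φ x ^ 2)
  have h2 : Tendsto (fun n => Real.exp (2 * a * ε n) *
      ∫ x, ‖gradient φ x‖ ^ 2 ∂(mMeasure (-a))) atTop
      (𝓝 (∫ x, ‖gradient φ x‖ ^ 2 ∂(mMeasure (-a)))) := by
    have := ((hεlim.const_mul (2 * a)).rexp).mul_const (∫ x, ‖gradient φ x‖ ^ 2 ∂(mMeasure (-a)))
    simpa using this
  exact le_of_tendsto_of_tendsto' (h1.const_mul (a ^ 2)) h2
    fun n => regularized_spectral_gap ha (hεpos n) hφ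

theorem eLpNorm_two_sq_eq_ofReal_integral {X F : Type*} [MeasurableSpace X] [NormedAddCommGroup F]
    {μ : Measure X} {f : X → F} (hf : MemLp f 2 μ) :
    eLpNorm f 2 μ ^ 2 = ENNReal.ofReal (∫ x, ‖f x‖ ^ 2 ∂μ) := by
  rw [eLpNorm_two_sq, ofReal_integral_eq_lintegral_ofReal (hf.integrable_norm_pow two_ne_zero)
    (Eventually.of_forall fun x => by positivity)]
  refine lintegral_congr fun x => ?_
  rw [ENNReal.ofReal_pow (norm_nonneg _), ofReal_norm]

/-- The spectral gap of the form for `γ = -a < 0`. -/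
theorem HasWeakGradient.spectral_gap {a : ℝ} (ha : 0 < a) {f : E3 → ℝ} {G : E3 → E3}
    (h : HasWeakGradient f G) (hf : MemLp f 2 (mMeasure (-a))) (hG : MemLp G 2 (mMeasure (-a))) :
    a ^ 2 * ∫ x, f x ^ 2 ∂(mMeasure (-a)) ≤ ∫ x, ‖G x‖ ^ 2 ∂(mMeasure (-a)) := by
  obtain ⟨φ, hφ, h1, h2, -⟩ := h.exists_smooth_seq hf hG
  have hlim {F : Type} [NormedAddCommGroup F] {u : ℕ → E3 → F} {v : E3 → F}
      (hu : ∀ n, MemLp (u n) 2 (mMeasure (-a))) (hv : MemLp v 2 (mMeasure (-a)))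
      (huv : Tendsto (fun n => eLpNorm (u n - v) 2 (mMeasure (-a))) atTop (𝓝 0)) :
      Tendsto (fun n => ∫ x, ‖u n x‖ ^ 2 ∂(mMeasure (-a))) atTop
        (𝓝 (∫ x, ‖v x‖ ^ 2 ∂(mMeasure (-a)))) := by
    have e {w : E3 → F} (hw : MemLp w 2 (mMeasure (-a))) :
        ∫ x, ‖w x‖ ^ 2 ∂(mMeasure (-a)) = ‖hw.toLp‖ ^ 2 := by
      rw [Lp.norm_toLp, ← ENNReal.toReal_pow, eLpNorm_two_sq_eq_ofReal_integral hw,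
        ENNReal.toReal_ofReal (integral_nonneg fun x => by positivity)]
    simp only [e (hu _), e hv]
    have : Tendsto (fun n => (hu n).toLp) atTop (𝓝 hv.toLp) :=
      (Lp.tendsto_Lp_iff_tendsto_eLpNorm'' u hu v hv).2 huv
    exact this.norm.pow 2
  have t1 := hlim (fun n => distortedForm.memLp_of_mem (hφ n)) hf h1
  have t2 := hlim (fun n => distortedForm.memLp_gradient_of_mem (hφ n)) hG h2
  simp only [Real.norm_eq_abs, sq_abs] at t1
  exact le_of_tendsto_of_tendsto' (t1.const_mul (a ^ 2)) t2 fun n => spectral_gap_of_mem ha (hφ n)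

namespace distortedForm

/-- The energy estimate for the truncation of a resolvent. -/
theorem integral_trunc_resolvent_le {a α N A : ℝ} (ha : 0 < a) (hα : 0 < α) (hN : 0 ≤ N)
    {g : E3 → ℝ} (hg : Integrable g (mMeasure (-a))) (mg : MemLp g 2 (mMeasure (-a)))
    (hg0 : 0 ≤ᵐ[mMeasure (-a)] g) (hA : ∫ x, g x ∂(mMeasure (-a)) ≤ A) :
    ∫ x, min (max 0 ((distortedForm (-a)).resolvent α g x)) N ^ 2 ∂(mMeasure (-a)) ≤
      2 / a ^ 2 * (N * A) := by
  set u := (distortedForm (-a)).resolvent α g with hu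
  have hur : (distortedForm (-a)).IsResolventOf α g u :=
    isDirichletForm.isResolventOf_resolvent hα mg
  have hu0 : 0 ≤ᵐ[mMeasure (-a)] u := resolvent_nonneg hα mg hg0
  obtain ⟨G, hw, mG⟩ := hur.1
  have mu := Lp.memLp u
  have hv := hw.trunc mu mG hN
  set v : E3 → ℝ := fun x => min (max 0 (u x)) N with hvdef
  set H : E3 → E3 := fun x => truncDeriv N (u x) • G x with hH
  have hv0 (x : E3) : 0 ≤ v x := le_min (le_max_left _ _) hN
  have mv : MemLp v 2 (mMeasure (-a)) := by
    refine mu.mono ((aestronglyMeasurable_const.sup mu.1).inf aestronglyMeasurable_const)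
      (Eventually.of_forall fun x => ?_)
    rw [Real.norm_of_nonneg (hv0 x)]
    exact (min_le_left _ _).trans (max_le (norm_nonneg _) (Real.le_norm_self _))
  have mH : MemLp H 2 (mMeasure (-a)) := by
    refine mG.mono (aestronglyMeasurable_mMeasure_iff.2
      hv.locallyIntegrable_grad.aestronglyMeasurable) (Eventually.of_forall fun x => ?_)
    have := truncDeriv_mem hN (u x)
    rw [norm_smul, Real.norm_of_nonneg this.1]
    exact mul_le_of_le_one_left (norm_nonneg _) this.2
  have heq := hur.2 _ (mem_domain_of_ae_eq hv mH mv.coeFn_toLp)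
  rw [form_eq_integral hw hv EventuallyEq.rfl mv.coeFn_toLp, real_inner_comm,
    inner_toLp_eq_integral] at heq
  have e1 : ∫ x, g x * (mv.toLp : Lp ℝ 2 (mMeasure (-a))) x ∂(mMeasure (-a)) =
      ∫ x, g x * v x ∂(mMeasure (-a)) := by
    refine integral_congr_ae ?_
    filter_upwards [mv.coeFn_toLp] with x hx
    rw [hx]
  rw [e1] at heq
  have b1 : 0 ≤ ∫ x, v x * u x ∂(mMeasure (-a)) := by
    refine integral_nonneg_of_ae ?_
    filter_upwards [hu0] with x hx using mul_nonneg (hv0 x) hx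
  have b2 : ∫ x, g x * v x ∂(mMeasure (-a)) ≤ N * A := by
    calc ∫ x, g x * v x ∂(mMeasure (-a)) ≤ ∫ x, N * g x ∂(mMeasure (-a)) := by
          refine integral_mono_ae (mg.integrable_mul mv) (hg.const_mul N) ?_
          filter_upwards [hg0] with x hx
          rw [mul_comm N]
          exact mul_le_mul_of_nonneg_left (min_le_right _ _) hx
      _ ≤ N * A := by rw [integral_const_mul]; gcongr
  -- The derivative of the truncation lies in `[0, 1]`, so its square is at most itself and the
  -- energy of `v` is at most `𝓔(u, v) ≤ (g, v) ≤ N A`. The factor 2 in the final bound undoes the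
  -- `1 / 2` in the form.
  have b3 : ∫ x, ‖H x‖ ^ 2 ∂(mMeasure (-a)) ≤ ∫ x, inner ℝ (G x) (H x) ∂(mMeasure (-a)) := by
    refine integral_mono (mH.integrable_norm_pow two_ne_zero) (integrable_inner_of_memLp mG mH)
      fun x => ?_
    have := truncDeriv_mem hN (u x)
    simp only [hH, norm_smul, real_inner_smul_right, real_inner_self_eq_norm_sq, mul_pow,
      Real.norm_of_nonneg this.1]
    gcongr
    rw [sq]
    exact mul_le_of_le_one_left this.1 this.2
  have b4 := hv.spectral_gap ha mv mH
  have b5 := mul_nonneg hα.le b1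
  rw [div_mul_eq_mul_div, le_div_iff₀ (by positivity)]
  linarith

/-- Chebyshev's inequality for the truncation: `N² m(u ≥ N) ≤ ∫ (u ∧ N)² ≤ 2 N A / a²`. One power of
`N` survives, and the bound does not depend on `α`. -/
theorem measure_le_resolvent_le {a α N A : ℝ} (ha : 0 < a) (hα : 0 < α) (hN : 0 < N)
    {g : E3 → ℝ} (hg : Integrable g (mMeasure (-a))) (mg : MemLp g 2 (mMeasure (-a)))
    (hg0 : 0 ≤ᵐ[mMeasure (-a)] g) (hA : ∫ x, g x ∂(mMeasure (-a)) ≤ A) :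
    mMeasure (-a) {x | N ≤ (distortedForm (-a)).resolvent α g x} ≤
      ENNReal.ofReal (2 / a ^ 2 * A / N) := by
  have h1 := integral_trunc_resolvent_le ha hα hN.le hg mg hg0 hA
  set u := (distortedForm (-a)).resolvent α g with hu
  have mu := Lp.memLp u
  have mv : MemLp (fun x => min (max 0 (u x)) N) 2 (mMeasure (-a)) := by
    refine mu.mono ((aestronglyMeasurable_const.sup mu.1).inf aestronglyMeasurable_const)
      (Eventually.of_forall fun x => ?_)
    rw [Real.norm_of_nonneg (le_min (le_max_left _ _) hN.le)]
    exact (min_le_left _ _).trans (max_le (norm_nonneg _) (Real.le_norm_self _))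
  have h2 := mul_meas_ge_le_integral_of_nonneg (Eventually.of_forall fun x => sq_nonneg _)
    mv.integrable_sq (N ^ 2)
  have hsub : {x | N ≤ u x} ⊆ {x | N ^ 2 ≤ min (max 0 (u x)) N ^ 2} := fun x hx => by
    have hx : N ≤ u x := hx
    have : min (max 0 (u x)) N = N := min_eq_right (hx.trans (le_max_right _ _))
    simp [this]
  have hfin : mMeasure (-a) {x | N ^ 2 ≤ min (max 0 (u x)) N ^ 2} ≠ ⊤ :=
    (mv.integrable_sq.measure_ge_lt_top (by positivity)).ne
  refine (measure_mono hsub).trans ?_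
  rw [← ENNReal.ofReal_toReal hfin]
  refine ENNReal.ofReal_le_ofReal ?_
  rw [le_div_iff₀ hN]
  have h3 := h2.trans h1
  rw [measureReal_def] at h3
  refine le_of_mul_le_mul_left ?_ hN
  linarith

theorem isTransient {γ : ℝ} (hγ : γ < 0) : (distortedForm γ).IsTransient := by
  obtain ⟨a, ha, rfl⟩ : ∃ a, 0 < a ∧ γ = -a := ⟨-γ, by linarith, by ring⟩
  intro f hf hf0
  set A := ∫ x, f x ∂(mMeasure (-a)) with hA
  set g : ℕ → E3 → ℝ := fun k y => min (f y) (k : ℝ) with hg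
  have mg (k : ℕ) : MemLp (g k) 2 (mMeasure (-a)) :=
    memLp_min_of_integrable hf hf0 (Nat.cast_nonneg k)
  have hg0 (k : ℕ) : 0 ≤ᵐ[mMeasure (-a)] g k := by
    filter_upwards [hf0] with x hx using le_min hx (Nat.cast_nonneg k)
  have ig (k : ℕ) : Integrable (g k) (mMeasure (-a)) := by
    refine hf.mono' (mg k).1 ?_
    filter_upwards [hg0 k] with x hx
    rw [Real.norm_of_nonneg hx]
    exact min_le_left _ _
  have hgA (k : ℕ) : ∫ x, g k x ∂(mMeasure (-a)) ≤ A :=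
    integral_mono (ig k) hf fun x => min_le_left _ _
  set α : ℕ → ℝ := fun n => 1 / ((n : ℝ) + 1) with hα
  have hαpos (n : ℕ) : 0 < α n := by rw [hα]; positivity
  set u : ℕ → ℕ → Lp ℝ 2 (mMeasure (-a)) :=
    fun n k => (distortedForm (-a)).resolvent (α n) (g k) with hu
  have hmono : ∀ᵐ x ∂(mMeasure (-a)), ∀ n k n' k', n ≤ n' → k ≤ k' → u n k x ≤ u n' k' x := by
    simp only [ae_all_iff]
    intro n k n' k' hn hk
    have h1 := resolvent_anti (hαpos n') (by simp only [hα]; gcongr : α n' ≤ α n) (mg k) (hg0 k)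
    have h2 := resolvent_mono (hαpos n') (mg k) (mg k') (Eventually.of_forall fun x =>
      min_le_min le_rfl (Nat.cast_le.2 hk))
    filter_upwards [h1, h2] with x h1 h2 using h1.trans h2
  have key (N : ℕ) : mMeasure (-a) {x | (distortedForm (-a)).potential f x = ⊤} ≤
      ENNReal.ofReal (2 / a ^ 2 * A / ((N : ℝ) + 1)) := by
    have hN : (0 : ℝ) < (N : ℝ) + 1 := by positivity
    -- The resolvents increase in both indices almost everywhere, so the diagonal exhausts the
    -- supremum. The sets `S j` increase up to null sets; their accumulated unions make continuity
    -- from below applicable.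
    set S : ℕ → Set E3 := fun j => {x | (N : ℝ) + 1 ≤ u j j x} with hS
    calc mMeasure (-a) {x | (distortedForm (-a)).potential f x = ⊤}
        ≤ mMeasure (-a) (⋃ j, S j) := by
          refine measure_mono_ae ?_
          filter_upwards [hmono] with x hx htop
          have htop : (distortedForm (-a)).potential f x = ⊤ := htop
          have hlt : ENNReal.ofReal ((N : ℝ) + 1) < (distortedForm (-a)).potential f x := by
            rw [htop]; exact ENNReal.ofReal_lt_top
          obtain ⟨n, hn⟩ := lt_iSup_iff.1 hlt
          obtain ⟨k, hk⟩ := lt_iSup_iff.1 hn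
          refine mem_iUnion.2 ⟨max n k, ?_⟩
          have h1 : (N : ℝ) + 1 < u n k x := (ENNReal.ofReal_lt_ofReal_iff_of_nonneg hN.le).1 hk
          exact h1.le.trans (hx n k _ _ (le_max_left _ _) (le_max_right _ _))
      _ = ⨆ j, mMeasure (-a) (accumulate S j) := measure_iUnion_eq_iSup_accumulate
      _ ≤ ENNReal.ofReal (2 / a ^ 2 * A / ((N : ℝ) + 1)) := by
          refine iSup_le fun j => ?_
          refine le_trans (measure_mono_ae ?_)
            (measure_le_resolvent_le ha (hαpos j) hN (ig j) (mg j) (hg0 j) (hgA j))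
          filter_upwards [hmono] with x hx hxj
          obtain ⟨i, hij, hi⟩ := mem_accumulate.1 hxj
          exact le_trans hi (hx i i j j hij hij)
  have hlim : Tendsto (fun N : ℕ => ENNReal.ofReal (2 / a ^ 2 * A / ((N : ℝ) + 1))) atTop (𝓝 0) := by
    have h1 : Tendsto (fun N : ℕ => 2 / a ^ 2 * A * (1 / ((N : ℝ) + 1))) atTop (𝓝 0) := by
      simpa using (tendsto_one_div_add_atTop_nhds_zero_nat (𝕜 := ℝ)).const_mul (2 / a ^ 2 * A)
    have h2 := ENNReal.tendsto_ofReal h1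
    simpa [div_eq_mul_inv] using h2
  have hzero : mMeasure (-a) {x | (distortedForm (-a)).potential f x = ⊤} = 0 :=
    le_antisymm (ge_of_tendsto' hlim key) zero_le
  rw [ae_iff]
  simpa only [lt_top_iff_ne_top, not_not] using hzero

end distortedForm

theorem theorem2p1 (γ : ℝ) :
    ((distortedForm γ).IsDirichletForm ∧
      (distortedForm γ).IsRegular ∧
      (distortedForm γ).IsIrreducible ∧
      (distortedForm γ).IsSpecialStandardCore smoothCompactlySupported) ∧
    (0 ≤ γ → (distortedForm γ).IsRecurrent) ∧
    (γ < 0 → (distortedForm γ).IsTransient) := by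
  exact ⟨⟨distortedForm.isDirichletForm, distortedForm.isRegular, distortedForm.isIrreducible,
    distortedForm.isSpecialStandardCore⟩, distortedForm.isRecurrent, distortedForm.isTransient⟩
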